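/- **Setting.** Let $\mathcal X$ be a topological space (for instance a Riemannian manifold) with its Borel $\sigma$-algebra, $\mathbb P$ a Borel probability measure on $\mathcal X$, and $f:\mathcal X\to\mathcal X$ a measurable map preserving $\mathbb P$. Let $\varphi:\mathcal X\to\mathbb R\cup\{\pm\infty\}$ be measurable with a global maximum at a periodic point $\zeta$ of $f$ of prime period $p\ge1$, and put $u_F=\varphi(\zeta)$ and $X_n=\varphi\circ f^n$ for $n\ge 0$. Write $$U(u)=\{X_0>u\},\qquad U^{(\kappa)}(u)=\bigcap_{j=0}^{\kappa}f^{-jp}(U(u)),\qquad Q^{\kappa}_{p,0}(u)=U^{(\kappa)}(u)\setminus U^{(\kappa+1)}(u)\qquad(\kappa\ge 0),$$ and, for $A\subset\mathbb R$, $\mathscr N_u(A)=\sum_{i\in A\cap\mathbb N_0}\mathbf 1_{\{X_i>u\}}$. A *topological ball centred at $\zeta$* is an open set homeomorphic to an open Euclidean unit ball by a homeomorphism sending $\zeta$ to the origin. **Hypotheses.** * (R1) For all $u<u_F$ sufficiently close to $u_F$ the set $U(u)$ is a topological ball centred at $\zeta$, and $u\mapsto\mathbb P(U(u))$ is continuous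 on a neighbourhood of $u_F$. * (R2) ($\zeta$ is repelling.) The number $0<\theta<1$ is such that for every $i\ge0$ the set $U^{(i)}(u)$ is a topological ball centred at $\zeta$ for all $u<u_F$ sufficiently close to $u_F$, and $\mathbb P(U^{(i)}(u))\big/\mathbb P(U(u))\to(1-\theta)^i$ as $u\uparrow u_F$. * $(u_n)$ is a sequence of real numbers with $n\,\mathbb P(X_0>u_n)\to\tau$ for some $\tau>0$. * $D_p(u_n)^*$: there are $\gamma(n,t)$, nonincreasing in $t\in\mathbb N_0$ for each $n$, and a sequence $t_n\in\mathbb N_0$ with $t_n=o(n)$ and $n\gamma(n,t_n)\to0$, such that for all $n,t,\kappa_1\in\mathbb N_0$, all finite families of pairwise disjoint intervals $I_j=[a_j,b_j)$ with $a_j\ge t$, and all $\kappa_j\in\mathbb N_0$, $$\Big|\mathbb P\Big(Q^{\kappa_1}_{p,0}(u_n)\cap\bigcap_j\{\mathscr N_{u_n}(I_j)=\kappa_j\}\Big)-\mathbb P\big(Q^{\kappa_1}_{p,0}(u_n)\big)\,\mathbb P\Big(\bigcap_j\{\mathscr N_{u_n}(I_j)=\kappa_j\}\Big)\Big|\le\gamma(n,t).$$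 * $D'_p(u_n)^*$: for the same $(t_n)$, there is a sequence of nonnegative integers $k_n\to\infty$ with $k_nt_n=o(n)$ and $$\lim_{n\to\infty}n\sum_{j=1}^{\lfloor n/k_n\rfloor}\mathbb P\big(Q^0_{p,0}(u_n)\cap\{X_j>u_n\}\big)=0.$$ **Conclusion.** Let $v_n=1/\mathbb P(X_0>u_n)$ and let $N_n$ be the rare event point process on $[0,\infty)$, $N_n(J)=\mathscr N_{u_n}(v_nJ)$. Then $N_n$ converges in distribution, as random elements of the space of locally finite measures on $[0,\infty)$ with the vague topology, to a compound Poisson process $N$ of intensity $\theta$ with geometric multiplicity: $N=\sum_{i\ge1}D_i\,\delta_{T_1+\dots+T_i}$, where the $T_i$ are i.i.d. exponential with mean $1/\theta$, the $D_i$ are i.i.d. and independent of $(T_i)$, and a cluster of depth $\kappa$, that is of size $\kappa+1$, has probability $\pi(\kappa)=\theta(1-\theta)^{\kappa}$: $$\mathbb P(D_i=\kappa+1)=\theta(1-\theta)^{\kappa},\qquad \kappa\in\mathbb N_0 .$$ -/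

import Mathlib

open MeasureTheory ProbabilityTheory Filter Topology Set
open scoped ENNReal NNReal CompactlySupported

noncomputable section

namespace REPP

/-! ### The stationary process and its exceedances -/

section Exceedances

variable {X : Type*}

/-- The time series `X_n = φ ∘ f^n`. -/
def process (f : X → X) (φ : X → EReal) (n : ℕ) (x : X) : EReal := φ (f^[n] x)

/-- The exceedance set `U(u) = {X_0 > u}`. -/
def exceedSet (φ : X → EReal) (u : EReal) : Set X := {x | u < φ x}

/-- The nested sets `U^(κ)(u) = ⋂_{j = 0}^{κ} f^{-jp}(U(u))`; they satisfy
`U^(0)(u) = U(u)` and `U^(κ+1)(u) = f^{-p}(U^(κ)(u)) ∩ U(u)`. -/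
def nestedSet (f : X → X) (φ : X → EReal) (p κ : ℕ) (u : EReal) : Set X :=
  ⋂ j ∈ Finset.range (κ + 1), f^[j * p] ⁻¹' exceedSet φ u

theorem nestedSet_zero (f : X → X) (φ : X → EReal) (p : ℕ) (u : EReal) :
    nestedSet f φ p 0 u = exceedSet φ u := by
  simp [nestedSet]

theorem nestedSet_succ (f : X → X) (φ : X → EReal) (p κ : ℕ) (u : EReal) :
    nestedSet f φ p (κ + 1) u = f^[p] ⁻¹' nestedSet f φ p κ u ∩ exceedSet φ u := by
  ext x
  simp only [nestedSet, mem_iInter, mem_preimage, mem_inter_iff, Finset.mem_range]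
  constructor
  · intro h
    refine ⟨fun j hj => ?_, by simpa using h 0 (by omega)⟩
    have := h (j + 1) (by omega)
    rwa [Nat.add_mul, one_mul, Function.iterate_add_apply] at this
  · rintro ⟨h, h0⟩ j hj
    cases j with
    | zero => simpa using h0
    | succ j =>
      rw [Nat.add_mul, one_mul, Function.iterate_add_apply]
      exact h j (by omega)

/-- The annulus `Q_{p,0}^κ(u) = U^(κ)(u) \ U^(κ+1)(u)`. For `κ = 0` this is the escape set
`{X_0 > u, X_p ≤ u}`. -/
def annulus (f : X → X) (φ : X → EReal) (p κ : ℕ) (u : EReal) : Set X :=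
  nestedSet f φ p κ u \ nestedSet f φ p (κ + 1) u

/-- `𝒩_u(A) = ∑_{i ∈ A ∩ ℕ₀} 1_{X_i > u}`, the number of exceedances of `u` at the integer times
in `A ⊆ ℝ`. -/
def exceedCount (f : X → X) (φ : X → EReal) (u : EReal) (A : Set ℝ) (x : X) : ℕ∞ :=
  {i : ℕ | (i : ℝ) ∈ A ∧ u < process f φ i x}.encard

end Exceedances

/-! ### Conditions (R1) and (R2) -/

/-- `B` is an (open) topological ball centred at `ζ`: an open set that is homeomorphic to the open
unit ball of a Euclidean space by a homeomorphism sending `ζ` to the origin. -/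
def IsTopologicalBall {X : Type*} [TopologicalSpace X] (ζ : X) (B : Set X) : Prop :=
  IsOpen B ∧ ∃ hζ : ζ ∈ B, ∃ (d : ℕ) (h : B ≃ₜ Metric.ball (0 : EuclideanSpace ℝ (Fin d)) 1),
    (h ⟨ζ, hζ⟩ : EuclideanSpace ℝ (Fin d)) = 0

/-- Condition (R1). With `u_F = φ ζ` the maximum, "`u` sufficiently close to `u_F`" is the filter
of levels approaching `u_F` from below. -/
def ConditionR1 {X : Type*} [TopologicalSpace X] [MeasurableSpace X] (P : Measure X)
    (φ : X → EReal) (ζ : X) : Prop :=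
  (∀ᶠ u in 𝓝[<] (φ ζ), IsTopologicalBall ζ (exceedSet φ u)) ∧
    ∃ V ∈ 𝓝 (φ ζ), ContinuousOn (fun u => P.real (exceedSet φ u)) V

/-- Condition (R2) with backward contraction rate `1 - θ`: for each `i`, as `u ↑ u_F`, the set
`⋂_{j ≤ i} f^{-jp}(X_0 > u)` is a ball around `ζ`, and its probability is asymptotic to
`(1 - θ)^i P(X_0 > u)`. -/
def ConditionR2 {X : Type*} [TopologicalSpace X] [MeasurableSpace X] (P : Measure X)
    (f : X → X) (φ : X → EReal) (ζ : X) (p : ℕ) (θ : ℝ) : Prop :=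
  ∀ i : ℕ, (∀ᶠ u in 𝓝[<] (φ ζ), IsTopologicalBall ζ (nestedSet f φ p i u)) ∧
    Tendsto (fun u => P.real (nestedSet f φ p i u) / P.real (exceedSet φ u))
      (𝓝[<] (φ ζ)) (𝓝 ((1 - θ) ^ i))

/-! ### The mixing conditions -/

section Mixing

variable {X : Type*} [MeasurableSpace X]

/-- Condition `D_p(u_n)^*`, realised with the time gaps `t_n`. -/
def ConditionDpStar (P : Measure X) (f : X → X) (φ : X → EReal) (p : ℕ) (u : ℕ → ℝ)
    (t : ℕ → ℕ) : Prop :=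
  ∃ γ : ℕ → ℕ → ℝ,
    (∀ (n s κ₁ m : ℕ) (a b : Fin m → ℝ) (κ : Fin m → ℕ),
      (∀ j, (s : ℝ) ≤ a j) → Pairwise (fun i j => Disjoint (Ico (a i) (b i)) (Ico (a j) (b j))) →
      |P.real (annulus f φ p κ₁ (u n) ∩
            {x | ∀ j, exceedCount f φ (u n) (Ico (a j) (b j)) x = κ j})
          - P.real (annulus f φ p κ₁ (u n)) *
            P.real {x | ∀ j, exceedCount f φ (u n) (Ico (a j) (b j)) x = κ j}| ≤ γ n s) ∧
    (∀ n, Antitone (γ n)) ∧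
    Tendsto (fun n : ℕ => (n : ℝ) * γ n (t n)) atTop (𝓝 0) ∧
    (fun n => (t n : ℝ)) =o[atTop] (fun n => (n : ℝ))

/-- Condition `D'_p(u_n)^*`, relative to the time gaps `t_n` of `D_p(u_n)^*`. -/
def ConditionDpPrimeStar (P : Measure X) (f : X → X) (φ : X → EReal) (p : ℕ) (u : ℕ → ℝ)
    (t : ℕ → ℕ) : Prop :=
  ∃ k : ℕ → ℕ, Tendsto k atTop atTop ∧
    (fun n => (k n : ℝ) * (t n : ℝ)) =o[atTop] (fun n => (n : ℝ)) ∧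
    Tendsto (fun n : ℕ => (n : ℝ) * ∑ j ∈ Finset.Icc 1 (n / k n),
      P.real (annulus f φ p 0 (u n) ∩ {x | (u n : EReal) < process f φ j x})) atTop (𝓝 0)

end Mixing

/-! ### Random measures on `[0, ∞)` and the vague topology -/

/-- The space of locally finite Borel measures on `[0, ∞)`. Point processes are random elements
of this space. -/
def LocFinMeasure : Type := {μ : Measure ℝ≥0 // IsLocallyFiniteMeasure μ}

/-- The vague topology: the coarsest one for which `μ ↦ ∫ g dμ` is continuous for every continuous
compactly supported `g`. -/
instance : TopologicalSpace LocFinMeasure :=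
  ⨅ g : C_c(ℝ≥0, ℝ),
    TopologicalSpace.induced (fun μ : LocFinMeasure => ∫ s, g s ∂μ.1) inferInstance

instance : MeasurableSpace LocFinMeasure := borel _

instance : BorelSpace LocFinMeasure := ⟨rfl⟩

/-! ### The rare event point process -/

section PointProcess

variable {X : Type*}

/-- The measure `∑_j 1_{X_j(x) > u} δ_{j / v}` on `[0, ∞)`. -/
def rescaledExceedMeasure (f : X → X) (φ : X → EReal) (u : EReal) (v : ℝ) (x : X) :
    Measure ℝ≥0 :=
  (Measure.count.restrict {j : ℕ | u < process f φ j x}).map (fun j : ℕ => ((j : ℝ) / v).toNNReal)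

/-- The defining property of the rare event point process: `N(J) = 𝒩_u(v J)`. -/
theorem rescaledExceedMeasure_apply (f : X → X) (φ : X → EReal) (u : EReal) {v : ℝ} (hv : 0 < v)
    (x : X) {J : Set ℝ≥0} (hJ : MeasurableSet J) :
    rescaledExceedMeasure f φ u v x J =
      (exceedCount f φ u ((fun s : ℝ≥0 => v * (s : ℝ)) '' J) x : ℝ≥0∞) := by
  rw [rescaledExceedMeasure, Measure.map_apply (measurable_of_countable _) hJ,
    Measure.restrict_apply (MeasurableSet.of_discrete), Measure.count_apply
    (MeasurableSet.of_discrete), exceedCount]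
  congr 2
  ext j
  simp only [mem_inter_iff, mem_preimage, mem_ofPred_eq, mem_image]
  refine and_congr_left fun _ => ⟨fun h => ⟨_, h, ?_⟩, ?_⟩
  · rw [Real.coe_toNNReal _ (by positivity)]
    field_simp
  · rintro ⟨s, hs, h⟩
    rw [← h, mul_div_cancel_left₀ _ hv.ne', Real.toNNReal_coe]
    exact hs

theorem isLocallyFinite_rescaledExceedMeasure (f : X → X) (φ : X → EReal) (u : EReal) {v : ℝ}
    (hv : 0 < v) (x : X) : IsLocallyFiniteMeasure (rescaledExceedMeasure f φ u v x) := by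
  refine ⟨fun s => ⟨Iio (s + 1), Iio_mem_nhds (by simp), ?_⟩⟩
  rw [rescaledExceedMeasure, Measure.map_apply (measurable_of_countable _) measurableSet_Iio]
  refine lt_of_le_of_lt (Measure.restrict_apply_le _ _) ?_
  rw [Measure.count_apply_lt_top]
  refine (Set.finite_Iio (⌈v * (s + 1)⌉₊ + 1)).subset fun j hj => ?_
  simp only [mem_preimage, mem_Iio] at hj ⊢
  have h1 : (j : ℝ) / v < s + 1 := by
    have := (NNReal.coe_lt_coe.2 hj)
    rwa [Real.coe_toNNReal _ (by positivity), NNReal.coe_add, NNReal.coe_one] at this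
  have h2 : (j : ℝ) < v * (s + 1) := by
    rw [div_lt_iff₀ hv] at h1
    linarith
  have h3 : (j : ℝ) < ⌈v * ((s : ℝ) + 1)⌉₊ := h2.trans_le (Nat.le_ceil _)
  have : j < ⌈v * ((s : ℝ) + 1)⌉₊ := by exact_mod_cast h3
  omega

open Classical in
/-- The rare event point process at level `u`: `N(J) = 𝒩_u(v J)` with `v = 1 / P(X_0 > u)`.
When `P(X_0 > u) = 0` the time scale is undefined, and the zero measure is used. -/
def rareEventPointProcess [MeasurableSpace X] (P : Measure X) (f : X → X) (φ : X → EReal)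
    (u : EReal) (x : X) : LocFinMeasure :=
  if hv : 0 < 1 / P.real (exceedSet φ u) then
    ⟨rescaledExceedMeasure f φ u (1 / P.real (exceedSet φ u)) x,
      isLocallyFinite_rescaledExceedMeasure f φ u hv x⟩
  else ⟨0, inferInstance⟩

end PointProcess

/-! ### Compound Poisson processes -/

/-- `N` is a compound Poisson process of intensity `θ` with (integer valued) multiplicity
distribution `π`: almost surely `N = ∑_i D_i δ_{T_0 + ⋯ + T_i}`, where the `T_i` are i.i.d.
exponential of mean `1 / θ`, the `D_i` are i.i.d. with `Q(D_i = k) = π k`, and the two sequences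
are independent. -/
def IsCompoundPoissonProcess {Ω : Type*} [MeasurableSpace Ω] (Q : Measure Ω) (θ : ℝ) (π : ℕ → ℝ)
    (N : Ω → LocFinMeasure) : Prop :=
  ∃ (T : ℕ → Ω → ℝ) (D : ℕ → Ω → ℕ),
    (∀ i, Measurable (T i)) ∧ (∀ i, Measurable (D i)) ∧
    (∀ i, Q.map (T i) = expMeasure θ) ∧ iIndepFun T Q ∧
    (∀ i k, Q.real {ω | D i ω = k} = π k) ∧ iIndepFun D Q ∧
    IndepFun (fun ω i => T i ω) (fun ω i => D i ω) Q ∧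
    ∀ᵐ ω ∂Q, (N ω).1 = Measure.sum fun i =>
      (D i ω : ℝ≥0∞) • Measure.dirac (∑ j ∈ Finset.range (i + 1), T j ω).toNNReal

/-- The geometric multiplicity distribution: a cluster of depth `κ ≥ 0`, i.e. of size `κ + 1`, has
probability `θ (1 - θ)^κ`. -/
def geometricMultiplicity (θ : ℝ) : ℕ → ℝ
  | 0 => 0
  | κ + 1 => θ * (1 - θ) ^ κ

end REPP

end

/-! Vague convergence is tested on finitely many cells. If for each `m` a measure agrees with `μ` on
the cells of mesh `2⁻ᵐ` in `[0, m)`, these measures tend to `μ`, by Riemann sums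
(`tendsto_of_cell_eq`). So the event that a point process lies in an open set is a countable
combination of events about integer count vectors, and the portmanteau theorem with Fatou's lemma
reduces convergence in distribution to convergence of the joint laws of the cell counts
(`tendstoInDistribution_of_dyadicCounts`). By Lévy's continuity theorem it suffices that `E ∏ z_j ^
K_j` converges whenever all `|z_j| = 1`, where `K_j` is the count of the `j`-th cell.

For the compound Poisson process this expectation is `∏ exp (h c(z_j))`, with `h` the mesh and `c =
clusterExponent θ`. It comes from a martingale along the arrival times (`integral_prod_mul_expTail`,
`integral_limit_marked`).

For the dynamical system write `π = P(X_0 > u_n)` and let `I(a)` be the mean of the product of the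
weights `w_i` over the exceedance times `i` in `[a, b)` (`meanWeight`). Then `I(a) - I(a + 1)` is
`w_a - 1` times the mean of the later weights on `{X_a > u_n}`. Split this event by the depth `κ` of
the chain of exceedances at `a, a + p, ...`. By `D'` the next `E` times contribute exactly `z ^ κ`,
up to `o(π)`; by `D` the times after the gap are nearly independent of the annulus; putting the `E`
skipped times back costs `O(E π²) = o(π)`. Since `P(Q^κ) ~ θ (1 - θ)^κ π` by (R2), this gives `I(a)
= exp (π c(z)) I(a + 1) + o(π)` (`norm_meanWeight_step_le`,
`eventually_norm_meanWeight_sub_exp_le`). A cell holds about `h / π` integer times, and `Re c ≤ 0`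
keeps errors from growing, so crossing the cell backwards multiplies `I` by `exp (h c(z_j))` in the
limit (`tendsto_of_exp_recursion`).

The start of a cluster never has to be identified: only the future of `a` enters, and an exceedance
with `κ` successors turns `z ^ κ` into `z ^ (κ + 1)`. -/

namespace REPP

/-! ### Vague convergence through masses of cells -/

/-- The cell `[j h, (j + 1) h)` of the uniform partition of `[0, ∞)` of mesh `h`. -/
def cell (h : ℝ≥0) (j : ℕ) : Set ℝ≥0 := Ico (j * h) ((j + 1) * h)

/-- The mesh `2⁻ᵐ`. -/
noncomputable def dyadicMesh (m : ℕ) : ℝ≥0 := (2 ^ m)⁻¹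

theorem dyadicMesh_pos (m : ℕ) : 0 < dyadicMesh m := by
  unfold dyadicMesh; positivity

theorem measurableSet_cell (h : ℝ≥0) (j : ℕ) : MeasurableSet (cell h j) := measurableSet_Ico

theorem cell_disjoint (h : ℝ≥0) : Pairwise (fun i j => Disjoint (cell h i) (cell h j)) := by
  have key : ∀ i j : ℕ, i < j → Disjoint (cell h i) (cell h j) := by
    intro i j hij
    rw [cell, cell, Set.Ico_disjoint_Ico]
    refine (min_le_left _ _).trans (le_trans ?_ (le_max_right _ _))
    gcongr
    exact_mod_cast hij
  intro i j hij
  rcases lt_or_gt_of_ne hij with h1 | h1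
  · exact key i j h1
  · exact (key j i h1).symm

theorem mem_cell_iff {h : ℝ≥0} (hh : 0 < h) (j : ℕ) (s : ℝ≥0) :
    s ∈ cell h j ↔ ⌊s / h⌋₊ = j := by
  rw [cell, mem_Ico, Nat.floor_eq_iff (by positivity), le_div_iff₀ hh, div_lt_iff₀ hh]

theorem iUnion_cell {h : ℝ≥0} (hh : 0 < h) (M : ℕ) :
    ⋃ j ∈ Finset.range M, cell h j = Iio (M * h) := by
  ext s
  simp only [mem_iUnion, Finset.mem_range, mem_cell_iff hh, exists_prop, exists_eq_right',
    mem_Iio]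
  rw [Nat.floor_lt (by positivity), div_lt_iff₀ hh]

/-- Two measures with the same cell masses have the same Riemann sums, so this bounds the difference
of their integrals. -/
theorem abs_integral_sub_riemann_le (ν : Measure ℝ≥0) [IsLocallyFiniteMeasure ν] {g : ℝ≥0 → ℝ}
    (hg : Continuous g) {h : ℝ≥0} (hh : 0 < h) (M : ℕ) (hsupp : ∀ s, (M * h : ℝ≥0) ≤ s → g s = 0)
    {ε : ℝ} (hε : ∀ j, ∀ s ∈ cell h j, |g s - g (j * h)| ≤ ε) :
    |∫ s, g s ∂ν - ∑ j ∈ Finset.range M, g (j * h) * ν.real (cell h j)|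
      ≤ ε * ν.real (Iio (M * h)) := by
  have hfin : ν (Iio (M * h)) < ∞ :=
    (measure_mono fun s (hs : s < M * h) => mem_Icc.2 ⟨zero_le, hs.le⟩).trans_lt
      (isCompact_Icc (a := (0 : ℝ≥0)) (b := M * h)).measure_lt_top
  have hcfin : ∀ j, ν (cell h j) < ∞ := fun j =>
    (measure_mono Ico_subset_Icc_self).trans_lt isCompact_Icc.measure_lt_top
  have hint : ∀ j, IntegrableOn g (cell h j) ν := fun j =>
    (hg.continuousOn.integrableOn_compact isCompact_Icc).mono_set Ico_subset_Icc_self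
  have h1 : ∫ s, g s ∂ν = ∑ j ∈ Finset.range M, ∫ s in cell h j, g s ∂ν := by
    rw [← integral_biUnion_finset _ (fun j _ => measurableSet_cell h j)
      (fun i _ j _ hij => cell_disjoint h hij) (fun j _ => hint j), iUnion_cell hh,
      setIntegral_eq_integral_of_forall_compl_eq_zero]
    intro s hs
    exact hsupp s (not_lt.1 hs)
  have h2 : ν.real (Iio (M * h)) = ∑ j ∈ Finset.range M, ν.real (cell h j) := by
    rw [← iUnion_cell hh, measureReal_biUnion_finset (fun i _ j _ hij => cell_disjoint h hij)
      (fun j _ => measurableSet_cell h j) (fun j _ => (hcfin j).ne)]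
  rw [h1, h2, ← Finset.sum_sub_distrib, Finset.mul_sum]
  refine (Finset.abs_sum_le_sum_abs _ _).trans (Finset.sum_le_sum fun j _ => ?_)
  have h3 : ∫ s in cell h j, g s ∂ν - g (j * h) * ν.real (cell h j)
      = ∫ s in cell h j, (g s - g (j * h)) ∂ν := by
    rw [integral_sub (hint j) (integrableOn_const (hcfin j).ne), setIntegral_const, smul_eq_mul,
      mul_comm (g _)]
  rw [h3, ← Real.norm_eq_abs]
  exact norm_setIntegral_le_of_norm_le_const (hcfin j) (fun s hs => hε j s hs)

theorem tendsto_of_cell_eq (μ : LocFinMeasure) (μ' : ℕ → LocFinMeasure)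
    (h : ∀ m, ∀ j < m * 2 ^ m, (μ' m).1 (cell (dyadicMesh m) j) = μ.1 (cell (dyadicMesh m) j)) :
    Tendsto μ' atTop (𝓝 μ) := by
  rw [nhds_iInf, tendsto_iInf]
  intro g
  rw [nhds_induced, tendsto_comap_iff]
  obtain ⟨B, hB⟩ : ∃ B : ℕ, ∀ s : ℝ≥0, (B : ℝ≥0) ≤ s → g s = 0 := by
    obtain ⟨b, hb⟩ := g.hasCompactSupport.isCompact.bddAbove
    obtain ⟨B, hB⟩ := exists_nat_gt b
    refine ⟨B, fun s hs => ?_⟩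
    by_contra hne
    exact absurd (hb (subset_tsupport _ hne)) (not_le.2 (hB.trans_le hs))
  have huc : UniformContinuous g := g.hasCompactSupport.uniformContinuous_of_continuous g.continuous
  have := μ.2
  set C := μ.1.real (Iio (B : ℝ≥0)) with hC
  rw [Metric.tendsto_atTop]
  intro ε hε
  -- The denominator `2 * C + 1` makes the sum of the two Riemann errors, each at most `C` times
  -- this number, smaller than `ε`, also when `C = 0`.
  obtain ⟨δ, hδ, hδ'⟩ := Metric.uniformContinuous_iff.1 huc (ε / (2 * C + 1)) (by positivity)
  obtain ⟨m0, hm0⟩ := exists_pow_lt_of_lt_one hδ (by norm_num : (1 / 2 : ℝ) < 1)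
  -- Beyond `m0` the mesh is below `δ`; beyond `B` the controlled cells cover the support of `g`.
  refine ⟨max m0 B, fun m hm => ?_⟩
  have hmB : B ≤ m := (le_max_right _ _).trans hm
  have hBm : ((B * 2 ^ m : ℕ) : ℝ≥0) * dyadicMesh m = B := by
    rw [dyadicMesh]; push_cast; field_simp
  have hosc : ∀ j, ∀ s ∈ cell (dyadicMesh m) j,
      |g s - g (j * dyadicMesh m)| ≤ ε / (2 * C + 1) := by
    intro j s hs
    refine (hδ' ?_).le
    have h1 : ((j : ℝ) * (dyadicMesh m : ℝ)) ≤ s := by exact_mod_cast hs.1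
    have h2 : (s : ℝ) < (j + 1) * (dyadicMesh m : ℝ) := by exact_mod_cast hs.2
    have h3 : (dyadicMesh m : ℝ) < δ := by
      refine lt_of_le_of_lt ?_ hm0
      rw [dyadicMesh]; push_cast
      rw [← inv_pow, one_div]
      exact pow_le_pow_of_le_one (by norm_num) (by norm_num) ((le_max_left _ _).trans hm)
    rw [NNReal.dist_eq, NNReal.coe_mul, NNReal.coe_natCast, abs_lt]
    constructor <;> linarith
  have key : ∀ ν : LocFinMeasure,
      |∫ s, g s ∂ν.1 - ∑ j ∈ Finset.range (B * 2 ^ m),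
        g (j * dyadicMesh m) * ν.1.real (cell (dyadicMesh m) j)|
      ≤ ε / (2 * C + 1) * ν.1.real (Iio (B : ℝ≥0)) := by
    intro ν
    have := ν.2
    have := abs_integral_sub_riemann_le ν.1 g.continuous (dyadicMesh_pos m) (B * 2 ^ m)
      (by rw [hBm]; exact hB) hosc
    rwa [hBm] at this
  have hcells : ∀ j ∈ Finset.range (B * 2 ^ m),
      (μ' m).1 (cell (dyadicMesh m) j) = μ.1 (cell (dyadicMesh m) j) := by
    intro j hj
    exact h m j ((Finset.mem_range.1 hj).trans_le (by gcongr))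
  have hreal : (μ' m).1.real (Iio (B : ℝ≥0)) = C := by
    rw [hC, measureReal_def, measureReal_def, ← hBm, ← iUnion_cell (dyadicMesh_pos m),
      measure_biUnion_finset (fun i _ j _ hij => cell_disjoint _ hij)
        (fun j _ => measurableSet_cell _ j),
      measure_biUnion_finset (fun i _ j _ hij => cell_disjoint _ hij)
        (fun j _ => measurableSet_cell _ j), Finset.sum_congr rfl hcells]
  have k1 := key (μ' m)
  have k2 := key μ
  rw [hreal] at k1
  rw [← hC] at k2
  have hsum : ∑ j ∈ Finset.range (B * 2 ^ m),
        g (j * dyadicMesh m) * (μ' m).1.real (cell (dyadicMesh m) j)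
      = ∑ j ∈ Finset.range (B * 2 ^ m),
        g (j * dyadicMesh m) * μ.1.real (cell (dyadicMesh m) j) := by
    refine Finset.sum_congr rfl fun j hj => ?_
    rw [measureReal_def, measureReal_def, hcells j hj]
  rw [hsum] at k1
  have hC0 : 0 ≤ C := measureReal_nonneg
  have hlt : ε / (2 * C + 1) * C + ε / (2 * C + 1) * C < ε := by
    rw [div_mul_eq_mul_div, ← add_div, div_lt_iff₀ (by positivity)]
    nlinarith
  rw [Function.comp_apply, Real.dist_eq]
  rw [abs_le] at k1 k2
  rw [abs_lt]
  constructor <;> linarith [k1.1, k1.2, k2.1, k2.2]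

/-- The set of count vectors at dyadic level `m` that force a measure into `G`. -/
def forcingCounts (G : Set LocFinMeasure) (m : ℕ) : Set (Fin (m * 2 ^ m) → ℕ) :=
  {κ | ∀ μ : LocFinMeasure, (∀ j : Fin _, μ.1 (cell (dyadicMesh m) j) = κ j) → μ ∈ G}

/-- At every level where the counts of `μ` do not force membership, pick a measure outside `G` with
the same counts, and take `μ` itself at the other levels. The resulting sequence tends to `μ`, so it
is eventually in the open set `G`, which rules out the first case. -/
theorem eventually_mem_forcingCounts {G : Set LocFinMeasure} (hG : IsOpen G) {μ : LocFinMeasure}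
    (hμ : μ ∈ G) (κ : (m : ℕ) → Fin (m * 2 ^ m) → ℕ)
    (hκ : ∀ m, ∀ j : Fin _, μ.1 (cell (dyadicMesh m) j) = κ m j) :
    ∀ᶠ m in atTop, κ m ∈ forcingCounts G m := by
  classical
  have hex : ∀ m, ∃ μ' : LocFinMeasure,
      (∀ j < m * 2 ^ m, μ'.1 (cell (dyadicMesh m) j) = μ.1 (cell (dyadicMesh m) j)) ∧
        (μ' ∈ G → κ m ∈ forcingCounts G m) := by
    intro m
    by_cases hm : κ m ∈ forcingCounts G m
    · exact ⟨μ, fun _ _ => rfl, fun _ => hm⟩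
    · simp only [forcingCounts, mem_ofPred_eq, not_forall] at hm
      obtain ⟨μ', h1, h2⟩ := hm
      exact ⟨μ', fun j hj => (h1 ⟨j, hj⟩).trans (hκ m ⟨j, hj⟩).symm, fun h => absurd h h2⟩
  choose μ' h1 h2 using hex
  filter_upwards [(tendsto_of_cell_eq μ μ' h1).eventually (hG.mem_nhds hμ)] with m hm
  exact h2 m hm

/-- The random measure `N` has integer masses `K m j` on the dyadic cells. -/
structure HasDyadicCounts {Ω : Type*} [MeasurableSpace Ω] (N : Ω → LocFinMeasure)
    (K : (m : ℕ) → Ω → Fin (m * 2 ^ m) → ℕ) : Prop where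
  measurable : ∀ m, Measurable (K m)
  apply_cell : ∀ m ω, ∀ j : Fin _, (N ω).1 (cell (dyadicMesh m) j) = K m ω j

theorem HasDyadicCounts.preimage_subset {Ω : Type*} [MeasurableSpace Ω] {N : Ω → LocFinMeasure}
    {K : (m : ℕ) → Ω → Fin (m * 2 ^ m) → ℕ} (h : HasDyadicCounts N K) (G : Set LocFinMeasure)
    (m : ℕ) : K m ⁻¹' forcingCounts G m ⊆ N ⁻¹' G :=
  fun ω hω => hω (N ω) fun j => h.apply_cell m ω j

/-- This yields both the Borel measurability of `N` and an increasing approximation of the event `N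
∈ G` by events on discrete count vectors. -/
theorem HasDyadicCounts.preimage_eq {Ω : Type*} [MeasurableSpace Ω] {N : Ω → LocFinMeasure}
    {K : (m : ℕ) → Ω → Fin (m * 2 ^ m) → ℕ} (h : HasDyadicCounts N K) {G : Set LocFinMeasure}
    (hG : IsOpen G) : N ⁻¹' G = ⋃ m, ⋂ i ≥ m, K i ⁻¹' forcingCounts G i := by
  ext ω
  simp only [mem_preimage, mem_iUnion, mem_iInter]
  constructor
  · intro hω
    exact eventually_atTop.1
      (eventually_mem_forcingCounts hG hω (fun m => K m ω) fun m j => h.apply_cell m ω j)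
  · rintro ⟨m, hm⟩
    exact h.preimage_subset G m (hm m le_rfl)

theorem HasDyadicCounts.measurable_map {Ω : Type*} [MeasurableSpace Ω] {N : Ω → LocFinMeasure}
    {K : (m : ℕ) → Ω → Fin (m * 2 ^ m) → ℕ} (h : HasDyadicCounts N K) : Measurable N := by
  refine measurable_of_isOpen fun G hG => ?_
  rw [h.preimage_eq hG]
  exact .iUnion fun m => .iInter fun i => .iInter fun _ => h.measurable i (.of_discrete)

/-- Fatou's lemma for the counting measure on the possible values; a lower bound for the liminf
needs no tightness. -/
theorem le_liminf_measure_preimage_of_tendsto {ι : Type*} [Countable ι] [MeasurableSpace ι]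
    [MeasurableSingletonClass ι] {X Ω : Type*} [MeasurableSpace X] [MeasurableSpace Ω]
    {P : Measure X} {Q : Measure Ω} {K' : ℕ → X → ι} {K : Ω → ι} (hK' : ∀ n, Measurable (K' n))
    (hK : Measurable K)
    (hconv : ∀ κ, Tendsto (fun n => P (K' n ⁻¹' {κ})) atTop (𝓝 (Q (K ⁻¹' {κ})))) (V : Set ι) :
    Q (K ⁻¹' V) ≤ atTop.liminf fun n => P (K' n ⁻¹' V) := by
  have hV : V.Countable := V.to_countable
  rw [← tsum_measure_preimage_singleton hV fun κ _ => hK (measurableSet_singleton κ)]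
  simp_rw [← tsum_measure_preimage_singleton hV fun κ _ => hK' _ (measurableSet_singleton κ),
    ← lintegral_count]
  refine le_trans (lintegral_mono fun κ => ?_)
    (lintegral_liminf_le fun n => measurable_of_countable _)
  exact (hconv κ).liminf_eq.ge

theorem tendstoInDistribution_of_dyadicCounts {X Ω : Type*} [MeasurableSpace X]
    [MeasurableSpace Ω] {P : Measure X} [IsProbabilityMeasure P] {Q : Measure Ω}
    [IsProbabilityMeasure Q] {N' : ℕ → X → LocFinMeasure} {N : Ω → LocFinMeasure}
    {K' : ℕ → (m : ℕ) → X → Fin (m * 2 ^ m) → ℕ} {K : (m : ℕ) → Ω → Fin (m * 2 ^ m) → ℕ}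
    (h' : ∀ n, HasDyadicCounts (N' n) (K' n)) (h : HasDyadicCounts N K)
    (hconv : ∀ m κ, Tendsto (fun n => P (K' n m ⁻¹' {κ})) atTop (𝓝 (Q (K m ⁻¹' {κ})))) :
    TendstoInDistribution N' atTop N (fun _ => P) Q := by
  refine ⟨fun n => (h' n).measurable_map.aemeasurable, h.measurable_map.aemeasurable, ?_⟩
  refine tendsto_of_forall_isOpen_le_liminf_nat' fun G hG => ?_
  simp only [ProbabilityMeasure.coe_mk]
  rw [Measure.map_apply h.measurable_map hG.measurableSet]
  simp_rw [Measure.map_apply (h' _).measurable_map hG.measurableSet]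
  rw [h.preimage_eq hG]
  have hmono : Monotone fun m => ⋂ i ≥ m, K i ⁻¹' forcingCounts G i := by
    intro a b hab
    exact biInter_mono (fun i (hi : i ≥ b) => hab.trans hi) fun _ _ => le_rfl
  rw [hmono.measure_iUnion]
  -- Of the intersection over `i ≥ m` only the term `i = m` is kept: an event about a single count
  -- vector, for which Fatou's bound is available.
  refine iSup_le fun m => (measure_mono (biInter_subset_of_mem (le_refl m))).trans ?_
  refine (le_liminf_measure_preimage_of_tendsto (fun n => (h' n).measurable m) (h.measurable m)
    (hconv m) _).trans (liminf_le_liminf (Eventually.of_forall fun n => ?_))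
  exact measure_mono ((h' n).preimage_subset G m)

/-! ### Convergence of integer vectors through their characteristic functions -/

section CharFun

variable {d : Type*} [Fintype d]

/-- An integer vector as a point of Euclidean space. -/
noncomputable def natVec (κ : d → ℕ) : EuclideanSpace ℝ d := WithLp.toLp 2 fun j => (κ j : ℝ)

theorem natVec_eq_of_dist_lt {κ κ' : d → ℕ} (h : dist (natVec κ') (natVec κ) < 1) : κ' = κ := by
  ext j
  have h1 : |(κ' j : ℝ) - κ j| < 1 := by
    have := (EuclideanSpace.dist_eq (natVec κ') (natVec κ)).symm.trans_lt h
    rw [Real.sqrt_lt' one_pos] at this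
    have h2 := (Finset.single_le_sum (fun i _ => sq_nonneg (dist (natVec κ' i) (natVec κ i)))
      (Finset.mem_univ j)).trans_lt this
    rw [Real.dist_eq] at h2
    have h3 : |natVec κ' j - natVec κ j| < 1 := by
      nlinarith [abs_nonneg (natVec κ' j - natVec κ j)]
    exact h3
  rw [abs_lt] at h1
  have h2 : (κ' j : ℝ) < κ j + 1 := by linarith
  have h3 : (κ j : ℝ) < κ' j + 1 := by linarith
  have h4 : κ' j < κ j + 1 := by exact_mod_cast h2
  have h5 : κ j < κ' j + 1 := by exact_mod_cast h3
  omega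

/-- The characteristic function of an integer vector is its generating function at the unimodular
points `exp (i t_j)`. -/
theorem charFun_map_natVec {X : Type*} [MeasurableSpace X] (P : Measure X) {K : X → d → ℕ}
    (hK : Measurable K) (t : EuclideanSpace ℝ d) :
    charFun (P.map (natVec ∘ K)) t
      = ∫ x, ∏ j, Complex.exp (t j * Complex.I) ^ K x j ∂P := by
  rw [charFun_apply, integral_map ((measurable_of_countable natVec).comp hK).aemeasurable]
  · refine integral_congr_ae (Eventually.of_forall fun x => ?_)
    simp only [Function.comp_apply]
    rw [natVec, PiLp.inner_apply]
    simp only [RCLike.inner_apply, conj_trivial]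
    push_cast
    rw [Finset.sum_mul, Complex.exp_sum]
    refine Finset.prod_congr rfl fun j _ => ?_
    rw [← Complex.exp_nat_mul]
    congr 1
    ring
  · fun_prop

/-- Lévy's theorem gives weak convergence in Euclidean space. A ball of radius `1/2` about an
integer point contains no other one and has none on its boundary, so it is a continuity set that
isolates the atom. -/
theorem tendsto_measure_singleton_of_charFun {X Ω : Type*} [MeasurableSpace X]
    [MeasurableSpace Ω] {P : Measure X} [IsProbabilityMeasure P] {Q : Measure Ω}
    [IsProbabilityMeasure Q] {K' : ℕ → X → d → ℕ} {K : Ω → d → ℕ}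
    (hK' : ∀ n, Measurable (K' n)) (hK : Measurable K)
    (h : ∀ z : d → ℂ, (∀ j, ‖z j‖ = 1) →
      Tendsto (fun n => ∫ x, ∏ j, z j ^ K' n x j ∂P) atTop (𝓝 (∫ ω, ∏ j, z j ^ K ω j ∂Q)))
    (κ : d → ℕ) :
    Tendsto (fun n => P (K' n ⁻¹' {κ})) atTop (𝓝 (Q (K ⁻¹' {κ}))) := by
  have hm : Measurable (natVec (d := d)) := measurable_of_countable _
  let μs : ℕ → ProbabilityMeasure (EuclideanSpace ℝ d) := fun n =>
    ⟨P.map (natVec ∘ K' n), Measure.isProbabilityMeasure_map (hm.comp (hK' n)).aemeasurable⟩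
  let μ : ProbabilityMeasure (EuclideanSpace ℝ d) :=
    ⟨Q.map (natVec ∘ K), Measure.isProbabilityMeasure_map (hm.comp hK).aemeasurable⟩
  have hlim : Tendsto μs atTop (𝓝 μ) := by
    refine ProbabilityMeasure.tendsto_iff_tendsto_charFun.2 fun t => ?_
    simp only [μs, μ, ProbabilityMeasure.coe_mk]
    simp_rw [charFun_map_natVec _ (hK' _), charFun_map_natVec _ hK]
    exact h _ fun j => Complex.norm_exp_ofReal_mul_I _
  have hpre : ∀ r : ℝ, 0 < r → r < 1 → natVec ⁻¹' Metric.closedBall (natVec κ) r = {κ} := by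
    intro r hr hr1
    ext κ'
    constructor
    · intro hκ'
      exact natVec_eq_of_dist_lt (lt_of_le_of_lt hκ' hr1)
    · rintro rfl
      simp [hr.le]
  have hpre' : natVec ⁻¹' Metric.ball (natVec κ) (1 / 2) = {κ} := by
    ext κ'
    constructor
    · intro hκ'
      exact natVec_eq_of_dist_lt (lt_trans hκ' (by norm_num))
    · rintro rfl
      simp
  have hfr : (μ : Measure (EuclideanSpace ℝ d)) (frontier (Metric.ball (natVec κ) (1 / 2))) = 0 := by
    simp only [μ, ProbabilityMeasure.coe_mk]
    rw [Measure.map_apply (hm.comp hK) isClosed_frontier.measurableSet, Set.preimage_comp]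
    have : natVec ⁻¹' frontier (Metric.ball (natVec κ) (1 / 2)) = ∅ := by
      rw [Metric.isOpen_ball.frontier_eq, Set.preimage_sdiff, hpre', sdiff_eq_empty]
      exact (preimage_mono Metric.closure_ball_subset_closedBall).trans
        (hpre _ (by norm_num) (by norm_num)).le
    rw [this, preimage_empty, measure_empty]
  have := ProbabilityMeasure.tendsto_measure_of_null_frontier_of_tendsto' hlim hfr
  simp only [μs, μ, ProbabilityMeasure.coe_mk] at this
  rw [Measure.map_apply (hm.comp hK) Metric.isOpen_ball.measurableSet] at this
  simp_rw [Measure.map_apply (hm.comp (hK' _)) Metric.isOpen_ball.measurableSet,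
    Set.preimage_comp] at this
  rwa [hpre'] at this

end CharFun

/-! ### The exponential functional of a marked renewal sequence -/

theorem measurable_exponentialPDF (θ : ℝ) : Measurable (exponentialPDF θ) :=
  (measurable_exponentialPDFReal θ).ennreal_ofReal

theorem integral_expMeasure {θ : ℝ} (hθ : 0 < θ) (G : ℝ → ℂ) :
    ∫ s, G s ∂expMeasure θ = ∫ s in Ioi (0 : ℝ), ((θ * Real.exp (-(θ * s)) : ℝ) : ℂ) * G s := by
  have h0 : expMeasure θ = volume.withDensity (exponentialPDF θ) := rfl
  rw [h0, integral_withDensity_eq_integral_toReal_smul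
    (measurable_exponentialPDF θ) (by simp [exponentialPDF]),
    ← integral_Ici_eq_integral_Ioi, ← integral_indicator measurableSet_Ici]
  refine integral_congr_ae (Eventually.of_forall fun s => ?_)
  by_cases hs : 0 ≤ s
  · simp only [indicator_of_mem (show s ∈ Ici (0 : ℝ) from hs), exponentialPDF_of_nonneg hs]
    rw [ENNReal.toReal_ofReal (by positivity), Complex.real_smul]
  · simp only [indicator_of_notMem (show s ∉ Ici (0 : ℝ) from hs),
      exponentialPDF_of_neg (not_le.1 hs)]
    simp

/-! ### The harmonic function of the exponential renewal walk -/

section Harmonic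

/-- The function `a ↦ exp (θ ∫_a^B (r - 1))`. -/
noncomputable def expTail (θ : ℝ) (r : ℝ → ℂ) (B a : ℝ) : ℂ :=
  Complex.exp (θ * ∫ x in a..B, (r x - 1))

variable {θ B : ℝ} {r : ℝ → ℂ}

theorem expTail_eq_one (hB : ∀ s, B ≤ s → r s = 1) {a : ℝ} (ha : B ≤ a) :
    expTail θ r B a = 1 := by
  have : ∫ x in a..B, (r x - 1) = ∫ x in a..B, (0 : ℂ) := by
    refine intervalIntegral.integral_congr fun x hx => ?_
    rw [uIcc_of_ge ha] at hx
    simp [hB x hx.1]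
  simp [expTail, this]

theorem intervalIntegrable_sub_one (hr : Measurable r) (hr1 : ∀ s, ‖r s‖ ≤ 1) (a b : ℝ) :
    IntervalIntegrable (fun x => r x - 1) volume a b := by
  rw [intervalIntegrable_iff]
  refine Measure.integrableOn_of_bounded (M := 2) measure_Ioc_lt_top.ne
    (hr.sub_const 1).aestronglyMeasurable (Eventually.of_forall fun x => ?_)
  exact (norm_sub_le _ _).trans (by simpa using by linarith [hr1 x])

theorem continuous_expTail (hr : Measurable r) (hr1 : ∀ s, ‖r s‖ ≤ 1) :
    Continuous (expTail θ r B) := by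
  have h : Continuous fun a => ∫ x in B..a, (r x - 1) :=
    intervalIntegral.continuous_primitive (intervalIntegrable_sub_one hr hr1) B
  have h' : Continuous fun a => ∫ x in a..B, (r x - 1) := by
    refine h.neg.congr fun a => ?_
    rw [Pi.neg_apply, intervalIntegral.integral_symm, neg_neg]
  exact Complex.continuous_exp.comp (continuous_const.mul h')

theorem norm_expTail_le (hθ : 0 < θ) (hr1 : ∀ s, ‖r s‖ ≤ 1)
    (hB0 : 0 ≤ B) (hB : ∀ s, B ≤ s → r s = 1) {a : ℝ} (ha : 0 ≤ a) :
    ‖expTail θ r B a‖ ≤ Real.exp (θ * (2 * B)) := by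
  rcases le_total B a with h | h
  · rw [expTail_eq_one hB h, norm_one]
    exact Real.one_le_exp (by positivity)
  · rw [expTail, Complex.norm_exp, Real.exp_le_exp, Complex.re_ofReal_mul]
    refine mul_le_mul_of_nonneg_left ?_ hθ.le
    refine (Complex.re_le_norm _).trans ?_
    refine (intervalIntegral.norm_integral_le_of_norm_le_const (C := 2) fun x _ => ?_).trans ?_
    · exact (norm_sub_le _ _).trans (by simpa using by linarith [hr1 x])
    · rw [abs_of_nonneg (by linarith)]
      linarith

/-- Only a right derivative is asked for: `r` will be a step function, continuous from the right. -/
theorem hasDerivWithinAt_expTail (hr : Measurable r) (hr1 : ∀ s, ‖r s‖ ≤ 1)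
    (hrc : ∀ s, ContinuousWithinAt r (Ioi s) s) (a : ℝ) :
    HasDerivWithinAt (expTail θ r B) (expTail θ r B a * (θ * (1 - r a))) (Ioi a) a := by
  have h1 := intervalIntegral.integral_hasDerivWithinAt_left (s := Ici a) (t := Ioi a)
    (intervalIntegrable_sub_one hr hr1 a B)
    (hr.sub_const 1).stronglyMeasurable.stronglyMeasurableAtFilter
    ((hrc a).sub continuousWithinAt_const)
  have h2 := ((h1.mono Ioi_subset_Ici_self).const_mul (θ : ℂ)).cexp
  refine h2.congr_deriv ?_
  rw [expTail]
  ring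

/-- Since `expTail` has logarithmic derivative `θ (1 - r)`, the function `H s = -exp (-θ s) *
expTail (a + s)` is an antiderivative of the integrand `θ exp (-θ s) r (a + s) expTail (a + s)`. It
vanishes at infinity and equals `-expTail a` at `0`. -/
theorem integral_expTail (hθ : 0 < θ) (hr : Measurable r) (hr1 : ∀ s, ‖r s‖ ≤ 1)
    (hrc : ∀ s, ContinuousWithinAt r (Ioi s) s) (hB0 : 0 ≤ B) (hB : ∀ s, B ≤ s → r s = 1)
    {a : ℝ} (ha : 0 ≤ a) :
    ∫ s, r (a + s) * expTail θ r B (a + s) ∂expMeasure θ = expTail θ r B a := by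
  rw [integral_expMeasure hθ]
  set F : ℝ → ℂ := fun s => ((θ * Real.exp (-(θ * s)) : ℝ) : ℂ) * (r (a + s) * expTail θ r B (a + s))
  set H : ℝ → ℂ := fun s => -((Real.exp (-(θ * s)) : ℝ) : ℂ) * expTail θ r B (a + s)
  have hcont := continuous_expTail (θ := θ) (B := B) hr hr1
  have hFm : Measurable F := by
    have := hcont.measurable
    fun_prop
  have hFb : ∀ s ∈ Ioi (0 : ℝ), ‖F s‖ ≤ (θ * Real.exp (θ * (2 * B))) * Real.exp (-θ * s) := by
    intro s hs
    have h1 := norm_expTail_le hθ hr1 hB0 hB (add_nonneg ha (le_of_lt hs))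
    simp only [F, norm_mul, Complex.norm_real, Real.norm_eq_abs, abs_of_pos hθ, Real.abs_exp]
    rw [neg_mul]
    have h2 : ‖r (a + s)‖ * ‖expTail θ r B (a + s)‖ ≤ Real.exp (θ * (2 * B)) :=
      (mul_le_of_le_one_left (norm_nonneg _) (hr1 _)).trans h1
    calc θ * Real.exp (-(θ * s)) * (‖r (a + s)‖ * ‖expTail θ r B (a + s)‖)
        ≤ θ * Real.exp (-(θ * s)) * Real.exp (θ * (2 * B)) := by gcongr
      _ = _ := by ring
  have hFi : IntegrableOn F (Ioi 0) := by
    refine Integrable.mono' ((exp_neg_integrableOn_Ioi 0 hθ).const_mul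
      (θ * Real.exp (θ * (2 * B)))) hFm.aestronglyMeasurable ?_
    exact (ae_restrict_iff' measurableSet_Ioi).2 (Eventually.of_forall hFb)
  have hHF : ∀ b : ℝ, 0 ≤ b → ∫ s in (0 : ℝ)..b, F s = H b - H 0 := by
    intro b hb
    refine intervalIntegral.integral_eq_sub_of_hasDeriv_right ?_ ?_ ?_
    · refine Continuous.continuousOn ?_
      have := hcont.comp (continuous_const_add a)
      simp only [H]
      fun_prop
    · intro s _
      have h1 : HasDerivWithinAt (fun s => expTail θ r B (a + s))
          (expTail θ r B (a + s) * (θ * (1 - r (a + s)))) (Ioi s) s := by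
        have h2 := hasDerivWithinAt_expTail (θ := θ) (B := B) hr hr1 hrc (a + s)
        have h3 : HasDerivWithinAt (fun s : ℝ => a + s) 1 (Ioi s) s :=
          ((hasDerivAt_id s).const_add a).hasDerivWithinAt
        have := HasDerivWithinAt.scomp s h2 h3 (fun x (hx : s < x) => by
          simpa using hx)
        simpa [Function.comp_def] using this
      have h4 : HasDerivAt (fun s : ℝ => -((Real.exp (-(θ * s)) : ℝ) : ℂ))
          ((θ * Real.exp (-(θ * s)) : ℝ) : ℂ) s := by
        have := (hasDerivAt_neg_exp_mul_exp (r := θ) (x := s)).ofReal_comp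
        simpa using this
      refine (h4.hasDerivWithinAt.mul h1).congr_deriv ?_
      simp only [F]
      push_cast
      ring
    · rw [intervalIntegrable_iff, uIoc_of_le hb]
      exact hFi.mono_set Ioc_subset_Ioi_self
  have hlim1 := intervalIntegral_tendsto_integral_Ioi 0 hFi tendsto_id
  have hlim2 : Tendsto (fun b => H b - H 0) atTop (𝓝 (0 - H 0)) := by
    refine Tendsto.sub_const ?_ _
    have h1 : Tendsto (fun b : ℝ => Real.exp (-(θ * b))) atTop (𝓝 0) :=
      Real.tendsto_exp_neg_atTop_nhds_zero.comp (tendsto_id.const_mul_atTop hθ)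
    have h2 : Tendsto (fun b : ℝ => -((Real.exp (-(θ * b)) : ℝ) : ℂ)) atTop (𝓝 0) := by
      have := ((Complex.continuous_ofReal.tendsto 0).comp h1).neg
      simpa using this
    refine h2.congr' ?_
    filter_upwards [eventually_ge_atTop (max B 0)] with b hb
    have hb1 : B ≤ a + b := by linarith [le_max_left B 0]
    simp only [H, expTail_eq_one hB hb1, mul_one]
  have hlim3 : Tendsto (fun b => H b - H 0) atTop (𝓝 (∫ s in Ioi (0 : ℝ), F s)) := by
    refine hlim1.congr' ?_
    filter_upwards [eventually_ge_atTop 0] with b hb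
    exact hHF b hb
  rw [tendsto_nhds_unique hlim3 hlim2]
  simp [H]

end Harmonic

/-! ### Almost sure behaviour of the arrival times -/

section Renewal

variable {Ω : Type*} [MeasurableSpace Ω] {Q : Measure Ω} {T : ℕ → Ω → ℝ} {θ : ℝ}

theorem ae_nonneg_of_map_expMeasure (hT : ∀ i, Measurable (T i))
    (hexp : ∀ i, Q.map (T i) = expMeasure θ) : ∀ᵐ ω ∂Q, ∀ i, 0 ≤ T i ω := by
  rw [ae_all_iff]
  intro i
  have h1 : ∀ᵐ s ∂expMeasure θ, 0 ≤ s := by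
    have h0 : expMeasure θ = volume.withDensity (exponentialPDF θ) := rfl
    rw [h0, ae_withDensity_iff (measurable_exponentialPDF θ)]
    refine Eventually.of_forall fun s hs => ?_
    by_contra hneg
    exact hs (exponentialPDF_of_neg (not_le.1 hneg))
  rw [← hexp i] at h1
  exact ae_of_ae_map (hT i).aemeasurable h1

/-- By the second Borel–Cantelli lemma infinitely many waiting times are at least `1`. -/
theorem ae_tendsto_sum_atTop [IsProbabilityMeasure Q] (hθ : 0 < θ) (hT : ∀ i, Measurable (T i))
    (hexp : ∀ i, Q.map (T i) = expMeasure θ) (hind : iIndepFun T Q) :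
    ∀ᵐ ω ∂Q, Tendsto (fun k => ∑ j ∈ Finset.range k, T j ω) atTop atTop := by
  have hpos : expMeasure θ (Ici 1) ≠ 0 := by
    have h0 : expMeasure θ = volume.withDensity (exponentialPDF θ) := rfl
    rw [h0, withDensity_apply _ measurableSet_Ici]
    refine (setLIntegral_pos_iff (measurable_exponentialPDF θ)).2 ?_ |>.ne'
    refine lt_of_lt_of_le ?_ (measure_mono (s := Ici (1 : ℝ)) fun s (hs : 1 ≤ s) => ⟨?_, hs⟩)
    · simp
    · rw [Function.mem_support]
      exact (ENNReal.ofReal_pos.2 (exponentialPDFReal_pos hθ (by linarith : (0 : ℝ) < s))).ne'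
  have hset : ∀ i, Q (T i ⁻¹' Ici 1) = expMeasure θ (Ici 1) := fun i => by
    rw [← hexp i, Measure.map_apply (hT i) measurableSet_Ici]
  have hindset : iIndepSet (fun i => T i ⁻¹' Ici 1) Q := by
    refine (iIndepSet_iff_meas_biInter fun i => hT i measurableSet_Ici).2 fun s => ?_
    exact hind.measure_inter_preimage_eq_mul s fun i _ => measurableSet_Ici
  have hBC := measure_limsup_eq_one (fun i => hT i measurableSet_Ici) hindset (by
    simp_rw [hset]
    exact ENNReal.tsum_const_eq_top_of_ne_zero hpos)
  have hae : ∀ᵐ ω ∂Q, ω ∈ limsup (fun i => T i ⁻¹' Ici 1) atTop := by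
    rw [← mem_ae_iff_prob_eq_one] at hBC
    · exact hBC
    · exact .measurableSet_limsup fun i => hT i measurableSet_Ici
  filter_upwards [hae, ae_nonneg_of_map_expMeasure hT hexp] with ω h1 h2
  have hmono : Monotone fun k => ∑ j ∈ Finset.range k, T j ω :=
    fun a b hab => Finset.sum_le_sum_of_subset_of_nonneg (Finset.range_mono hab)
      fun i _ _ => h2 i
  rw [mem_limsup_iff_frequently_mem] at h1
  have key : ∀ n : ℕ, ∃ k, (n : ℝ) ≤ ∑ j ∈ Finset.range k, T j ω := by
    intro n
    induction n with
    | zero => exact ⟨0, by simp⟩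
    | succ n ih =>
      obtain ⟨k, hk⟩ := ih
      obtain ⟨i, hi, hi1⟩ := (frequently_atTop.1 h1) k
      refine ⟨i + 1, ?_⟩
      rw [Finset.sum_range_succ]
      push_cast
      have := hmono hi
      have hi2 : 1 ≤ T i ω := hi1
      simp only at this
      linarith
  refine tendsto_atTop_atTop_of_monotone hmono fun b => ?_
  obtain ⟨n, hn⟩ := exists_nat_ge b
  obtain ⟨k, hk⟩ := key n
  exact ⟨k, hn.trans hk⟩

end Renewal

/-! ### The martingale along the arrivals and its limit -/

section Martingale

variable {Ω : Type*} {T : ℕ → Ω → ℝ} {θ : ℝ}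

/-- The partial sum `T_0 + ⋯ + T_{k-1}`. -/
def arrival (T : ℕ → Ω → ℝ) (k : ℕ) (ω : Ω) : ℝ := ∑ j ∈ Finset.range k, T j ω

theorem arrival_succ (T : ℕ → Ω → ℝ) (k : ℕ) (ω : Ω) :
    arrival T (k + 1) ω = arrival T k ω + T k ω := Finset.sum_range_succ _ _

theorem arrival_mono {ω : Ω} (h : ∀ i, 0 ≤ T i ω) : Monotone fun k => arrival T k ω :=
  fun _ _ hab => Finset.sum_le_sum_of_subset_of_nonneg (Finset.range_mono hab) fun i _ _ => h i

theorem arrival_nonneg {ω : Ω} (h : ∀ i, 0 ≤ T i ω) (k : ℕ) : 0 ≤ arrival T k ω :=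
  Finset.sum_nonneg fun i _ => h i

variable [MeasurableSpace Ω] {Q : Measure Ω}

theorem measurable_arrival (hT : ∀ i, Measurable (T i)) (k : ℕ) : Measurable (arrival T k) :=
  Finset.measurable_sum _ fun i _ => hT i

/-- Independence is available for the restriction to the first `k` coordinates; extending it by zero
leaves `G` unchanged because `G` reads only those coordinates. -/
theorem indepFun_past (hT : ∀ i, Measurable (T i)) (hind : iIndepFun T Q) {E : Type*}
    [MeasurableSpace E] {G : (ℕ → ℝ) → E} (hG : Measurable G) (k : ℕ)
    (hGk : ∀ t t' : ℕ → ℝ, (∀ i < k, t i = t' i) → G t = G t') :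
    IndepFun (fun ω => G fun i => T i ω) (T k) Q := by
  classical
  have h := hind.indepFun_finset (Finset.range k) {k} (by simp) hT
  let ext : (Finset.range k → ℝ) → ℕ → ℝ := fun x i => if h : i ∈ Finset.range k then x ⟨i, h⟩ else 0
  have hext : Measurable ext := by
    refine measurable_pi_lambda _ fun i => ?_
    by_cases hi : i ∈ Finset.range k
    · simp only [ext, hi, dite_true]
      exact measurable_pi_apply (⟨i, hi⟩ : Finset.range k)
    · simp only [ext, hi, dite_false]
      exact measurable_const
  have h2 := h.comp (hG.comp hext)
    (measurable_pi_apply (⟨k, Finset.mem_singleton_self k⟩ : ({k} : Finset ℕ)))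
  refine h2.congr (Eventually.of_forall fun ω => ?_) (Eventually.of_forall fun ω => rfl)
  refine hGk _ _ fun i hi => ?_
  simp [ext, hi]

variable [IsProbabilityMeasure Q]

/-- The integrand is a martingale in `k`: given the first `k` waiting times, `integral_expTail`
averages out the next one. The maximum with `0` changes it only on a null set and makes it bounded
everywhere, as `expTail` is controlled only on the half line. -/
theorem integral_prod_mul_expTail (hθ : 0 < θ) (hT : ∀ i, Measurable (T i))
    (hexp : ∀ i, Q.map (T i) = expMeasure θ) (hind : iIndepFun T Q) {r : ℝ → ℂ} {B : ℝ}
    (hr : Measurable r) (hr1 : ∀ s, ‖r s‖ ≤ 1) (hrc : ∀ s, ContinuousWithinAt r (Ioi s) s)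
    (hB0 : 0 ≤ B) (hB : ∀ s, B ≤ s → r s = 1) (k : ℕ) :
    ∫ ω, (∏ i ∈ Finset.range k, r (arrival T (i + 1) ω)) *
      expTail θ r B (max (arrival T k ω) 0) ∂Q = expTail θ r B 0 := by
  have := isProbabilityMeasure_expMeasure hθ
  have hcont := continuous_expTail (θ := θ) (B := B) hr hr1
  have hm := hcont.measurable
  induction k with
  | zero => simp [arrival]
  | succ k ih =>
    rw [← ih]
    set V : Ω → ℂ × ℝ := fun ω =>
      (∏ i ∈ Finset.range k, r (arrival T (i + 1) ω), arrival T k ω) with hV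
    have hVm : Measurable V := by
      refine Measurable.prodMk (Finset.measurable_fun_prod _ fun i _ => ?_) (measurable_arrival hT k)
      exact hr.comp (measurable_arrival hT _)
    have hVT : IndepFun V (T k) Q := by
      refine indepFun_past hT hind (G := fun t : ℕ → ℝ =>
        (∏ i ∈ Finset.range k, r (∑ j ∈ Finset.range (i + 1), t j), ∑ j ∈ Finset.range k, t j))
        ?_ k ?_
      · have : ∀ k, Measurable fun t : ℕ → ℝ => ∑ j ∈ Finset.range k, t j :=
          fun k => Finset.measurable_fun_sum _ fun i _ => measurable_pi_apply i
        exact (Finset.measurable_fun_prod _ fun i _ => hr.comp (this _)).prodMk (this k)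
      · intro t t' htt
        refine congr_arg₂ Prod.mk (Finset.prod_congr rfl fun i hi => ?_)
          (Finset.sum_congr rfl fun j hj => htt j (Finset.mem_range.1 hj))
        congr 1
        refine Finset.sum_congr rfl fun j hj => htt j ?_
        have := Finset.mem_range.1 hi
        have := Finset.mem_range.1 hj
        omega
    have hlaw : Q.map (fun ω => (V ω, T k ω)) = (Q.map V).prod (expMeasure θ) := by
      rw [hVT.map_prod_eq_prod_map_map hVm.aemeasurable (hT k).aemeasurable, hexp]
    set F : (ℂ × ℝ) × ℝ → ℂ := fun q =>
      q.1.1 * (r (q.1.2 + q.2) * expTail θ r B (max (q.1.2 + q.2) 0)) with hF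
    have hFm : Measurable F := by fun_prop
    have hVprob : IsProbabilityMeasure (Q.map V) := Measure.isProbabilityMeasure_map hVm.aemeasurable
    have hnn := ae_nonneg_of_map_expMeasure hT hexp
    have hV1 : ∀ ω, ‖(V ω).1‖ ≤ 1 := fun ω => by
      rw [hV, norm_prod]
      exact Finset.prod_le_one (fun _ _ => norm_nonneg _) fun _ _ => hr1 _
    have hFint : Integrable F ((Q.map V).prod (expMeasure θ)) := by
      rw [← hlaw, integrable_map_measure hFm.aestronglyMeasurable
        (hVm.prodMk (hT k)).aemeasurable]
      refine Integrable.of_bound (hFm.comp (hVm.prodMk (hT k))).aestronglyMeasurable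
        (Real.exp (θ * (2 * B))) (Eventually.of_forall fun ω => ?_)
      simp only [hF, Function.comp_apply, norm_mul]
      refine (mul_le_of_le_one_left (by positivity) (hV1 ω)).trans ?_
      refine (mul_le_of_le_one_left (norm_nonneg _) (hr1 _)).trans ?_
      exact norm_expTail_le hθ hr1 hB0 hB (le_max_right _ _)
    calc ∫ ω, (∏ i ∈ Finset.range (k + 1), r (arrival T (i + 1) ω)) *
          expTail θ r B (max (arrival T (k + 1) ω) 0) ∂Q
        = ∫ ω, F (V ω, T k ω) ∂Q := by
          refine integral_congr_ae (Eventually.of_forall fun ω => ?_)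
          simp only [hF, hV, Finset.prod_range_succ, arrival_succ]
          ring
      _ = ∫ q, F q ∂((Q.map V).prod (expMeasure θ)) := by
          rw [← hlaw, integral_map (hVm.prodMk (hT k)).aemeasurable hFm.aestronglyMeasurable]
      _ = ∫ v, ∫ s, F (v, s) ∂expMeasure θ ∂(Q.map V) := integral_prod _ hFint
      _ = ∫ ω, ∫ s, F (V ω, s) ∂expMeasure θ ∂Q := by
          refine integral_map hVm.aemeasurable ?_
          exact hFm.stronglyMeasurable.integral_prod_right.aestronglyMeasurable
      _ = _ := by
          refine integral_congr_ae ?_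
          filter_upwards [hnn] with ω hω
          have hs := arrival_nonneg hω k
          simp only [hF]
          rw [integral_const_mul, max_eq_left hs, ← integral_expTail hθ hr hr1 hrc hB0 hB hs]
          congr 1
          refine integral_congr_ae ?_
          have hnn' : ∀ᵐ s ∂expMeasure θ, 0 ≤ s := by
            rw [← hexp k, ae_map_iff (hT k).aemeasurable measurableSet_Ici]
            filter_upwards [hnn] with ω hω using hω k
          filter_upwards [hnn'] with s hs'
          simp only [hV]
          rw [max_eq_left (add_nonneg hs hs')]

variable {D : ℕ → Ω → ℕ}

/-- Given the arrival times, the marks are independent with generating function `ρ`, so Fubini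
replaces each power by its mean. -/
theorem integral_prod_pow_mark (hT : ∀ i, Measurable (T i)) (hD : ∀ i, Measurable (D i))
    (hindD : iIndepFun D Q) (hTD : IndepFun (fun ω i => T i ω) (fun ω i => D i ω) Q)
    {ρ : ℂ → ℂ} (hρ : ∀ i z, ‖z‖ ≤ 1 → ∫ ω, z ^ D i ω ∂Q = ρ z) {g : ℝ → ℂ} (hg : Measurable g)
    (hg1 : ∀ s, ‖g s‖ ≤ 1) (k : ℕ) :
    ∫ ω, ∏ i ∈ Finset.range k, g (arrival T (i + 1) ω) ^ D i ω ∂Q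
      = ∫ ω, ∏ i ∈ Finset.range k, ρ (g (arrival T (i + 1) ω)) ∂Q := by
  have hTm : Measurable fun ω i => T i ω := measurable_pi_lambda _ hT
  have hDm : Measurable fun ω i => D i ω := measurable_pi_lambda _ hD
  set F : (ℕ → ℝ) × (ℕ → ℕ) → ℂ := fun q =>
    ∏ i ∈ Finset.range k, g (∑ j ∈ Finset.range (i + 1), q.1 j) ^ q.2 i with hF
  have hFm : Measurable F := by
    refine Finset.measurable_fun_prod _ fun i _ => ?_
    refine Measurable.pow ?_ ((measurable_pi_apply i).comp measurable_snd)
    exact hg.comp (Finset.measurable_fun_sum _ fun j _ => by fun_prop)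
  have hlaw := hTD.map_prod_eq_prod_map_map hTm.aemeasurable hDm.aemeasurable
  have hFb : ∀ q, ‖F q‖ ≤ 1 := fun q => by
    rw [hF, norm_prod]
    refine Finset.prod_le_one (fun _ _ => norm_nonneg _) fun _ _ => ?_
    rw [norm_pow]
    exact pow_le_one₀ (norm_nonneg _) (hg1 _)
  have hp1 : IsProbabilityMeasure (Q.map fun ω i => T i ω) :=
    Measure.isProbabilityMeasure_map hTm.aemeasurable
  have hp2 : IsProbabilityMeasure (Q.map fun ω i => D i ω) :=
    Measure.isProbabilityMeasure_map hDm.aemeasurable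
  calc ∫ ω, ∏ i ∈ Finset.range k, g (arrival T (i + 1) ω) ^ D i ω ∂Q
      = ∫ q, F q ∂(Q.map fun ω => ((fun i => T i ω), (fun i => D i ω))) := by
        rw [integral_map (hTm.prodMk hDm).aemeasurable hFm.aestronglyMeasurable]
        rfl
    _ = ∫ t, ∫ d, F (t, d) ∂(Q.map fun ω i => D i ω) ∂(Q.map fun ω i => T i ω) := by
        rw [hlaw]
        exact integral_prod _ (Integrable.of_bound hFm.aestronglyMeasurable 1
          (Eventually.of_forall hFb))
    _ = ∫ ω, ∫ d, F ((fun i => T i ω), d) ∂(Q.map fun ω i => D i ω) ∂Q :=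
        integral_map hTm.aemeasurable
          hFm.stronglyMeasurable.integral_prod_right.aestronglyMeasurable
    _ = _ := by
        refine integral_congr_ae (Eventually.of_forall fun ω => ?_)
        simp only
        rw [integral_map hDm.aemeasurable (f := fun d => F (fun i => T i ω, d))
          (hFm.comp measurable_prodMk_left).aestronglyMeasurable]
        simp only [hF]
        have hind' : iIndepFun (fun i : Fin k => D i) Q := hindD.precomp Fin.val_injective
        have := hind'.integral_fun_prod_comp (𝕜 := ℂ) (X := fun i : Fin k => D i)
          (f := fun (i : Fin k) (n : ℕ) => g (∑ j ∈ Finset.range ((i : ℕ) + 1), T j ω) ^ n)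
          (fun i => (hD i).aemeasurable)
          (fun i => (measurable_of_countable _).aestronglyMeasurable)
        simp_rw [hρ _ _ (hg1 _)] at this
        simp_rw [Finset.prod_range]
        exact this

/-- Once an arrival has passed `B` the factor `expTail` is `1`. The constant mean of the martingale,
`expTail 0`, is therefore also the limit of the means of the plain products, which tend to the mean
of `Y` by dominated convergence. -/
theorem integral_limit_marked (hθ : 0 < θ) (hT : ∀ i, Measurable (T i))
    (hexp : ∀ i, Q.map (T i) = expMeasure θ) (hind : iIndepFun T Q) (hD : ∀ i, Measurable (D i))
    (hindD : iIndepFun D Q) (hTD : IndepFun (fun ω i => T i ω) (fun ω i => D i ω) Q)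
    {ρ : ℂ → ℂ} (hρ : ∀ i z, ‖z‖ ≤ 1 → ∫ ω, z ^ D i ω ∂Q = ρ z)
    {g : ℝ → ℂ} (hg : Measurable g) (hρg : Measurable (ρ ∘ g))
    (hg1 : ∀ s, ‖g s‖ ≤ 1) (hrc : ∀ s, ContinuousWithinAt (ρ ∘ g) (Ioi s) s) {B : ℝ}
    (hB0 : 0 ≤ B) (hB : ∀ s, B ≤ s → g s = 1) {Y : Ω → ℂ}
    (hY : ∀ᵐ ω ∂Q, ∀ᶠ k in atTop,
      ∏ i ∈ Finset.range k, g (arrival T (i + 1) ω) ^ D i ω = Y ω) :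
    ∫ ω, Y ω ∂Q = expTail θ (ρ ∘ g) B 0 := by
  have hr1 : ∀ s, ‖(ρ ∘ g) s‖ ≤ 1 := fun s => by
    rw [Function.comp_apply, ← hρ 0 _ (hg1 s)]
    refine (norm_integral_le_of_norm_le_const (C := 1) (Eventually.of_forall fun ω => ?_)).trans
      (by simp)
    rw [norm_pow]
    exact pow_le_one₀ (norm_nonneg _) (hg1 _)
  have hρ1 : ρ 1 = 1 := by rw [← hρ 0 1 (by simp)]; simp
  have hrB : ∀ s, B ≤ s → (ρ ∘ g) s = 1 := fun s hs => by
    rw [Function.comp_apply, hB s hs, hρ1]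
  have hm := (continuous_expTail (θ := θ) (B := B) hρg hr1).measurable
  have h1 : Tendsto (fun k => ∫ ω, ∏ i ∈ Finset.range k, g (arrival T (i + 1) ω) ^ D i ω ∂Q)
      atTop (𝓝 (∫ ω, Y ω ∂Q)) := by
    refine tendsto_integral_of_dominated_convergence (fun _ => 1) (fun k => ?_)
      (integrable_const _) (fun k => Eventually.of_forall fun ω => ?_) ?_
    · refine (Finset.measurable_fun_prod _ fun i _ => ?_).aestronglyMeasurable
      exact (hg.comp (measurable_arrival hT _)).pow (hD i)
    · rw [norm_prod]
      refine Finset.prod_le_one (fun _ _ => norm_nonneg _) fun _ _ => ?_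
      rw [norm_pow]
      exact pow_le_one₀ (norm_nonneg _) (hg1 _)
    · filter_upwards [hY] with ω hω
      exact tendsto_const_nhds.congr' (hω.mono fun k hk => hk.symm)
  refine tendsto_nhds_unique h1 ?_
  simp_rw [integral_prod_pow_mark hT hD hindD hTD hρ hg hg1]
  have hpm : ∀ k, Measurable fun ω => ∏ i ∈ Finset.range k, ρ (g (arrival T (i + 1) ω)) := fun k =>
    Finset.measurable_fun_prod _ fun i _ => hρg.comp (measurable_arrival hT _)
  have hpb : ∀ k ω, ‖∏ i ∈ Finset.range k, ρ (g (arrival T (i + 1) ω))‖ ≤ 1 := fun k ω => by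
    rw [norm_prod]
    exact Finset.prod_le_one (fun _ _ => norm_nonneg _) fun _ _ => hr1 _
  have hem : ∀ k, Measurable fun ω => expTail θ (ρ ∘ g) B (max (arrival T k ω) 0) := fun k => by
    have := measurable_arrival hT k
    fun_prop
  have heb : ∀ k ω, ‖expTail θ (ρ ∘ g) B (max (arrival T k ω) 0)‖ ≤ Real.exp (θ * (2 * B)) :=
    fun k ω => norm_expTail_le hθ hr1 hB0 hrB (le_max_right _ _)
  -- The difference between the plain product and the martingale vanishes in mean, since the
  -- arrivals tend to infinity almost surely.
  have h2 : Tendsto (fun k => ∫ ω, (∏ i ∈ Finset.range k, ρ (g (arrival T (i + 1) ω))) *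
      (1 - expTail θ (ρ ∘ g) B (max (arrival T k ω) 0)) ∂Q) atTop (𝓝 (∫ _, (0 : ℂ) ∂Q)) := by
    refine tendsto_integral_of_dominated_convergence (fun _ => 1 + Real.exp (θ * (2 * B)))
      (fun k => ((hpm k).mul ((hem k).const_sub 1)).aestronglyMeasurable)
      (integrable_const _) (fun k => Eventually.of_forall fun ω => ?_) ?_
    · rw [norm_mul]
      refine (mul_le_of_le_one_left (norm_nonneg _) (hpb k ω)).trans ((norm_sub_le _ _).trans ?_)
      rw [norm_one]
      gcongr
      exact heb k ω
    · filter_upwards [ae_tendsto_sum_atTop hθ hT hexp hind] with ω hω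
      refine tendsto_const_nhds.congr' ?_
      filter_upwards [hω.eventually_ge_atTop B] with k hk
      rw [expTail_eq_one hrB (le_max_of_le_left (b := arrival T k ω) hk), sub_self, mul_zero]
  rw [integral_zero] at h2
  have h3 := h2.add_const (expTail θ (ρ ∘ g) B 0)
  rw [zero_add] at h3
  refine h3.congr fun k => ?_
  have h4 := integral_prod_mul_expTail hθ hT hexp hind hρg hr1 hrc hB0 hrB k
  simp only [Function.comp_apply] at h4
  have i1 : Integrable (fun ω => ∏ i ∈ Finset.range k, ρ (g (arrival T (i + 1) ω))) Q :=
    Integrable.of_bound (hpm k).aestronglyMeasurable 1 (Eventually.of_forall (hpb k))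
  have i2 : Integrable (fun ω => (∏ i ∈ Finset.range k, ρ (g (arrival T (i + 1) ω))) *
      expTail θ (ρ ∘ g) B (max (arrival T k ω) 0)) Q := by
    refine Integrable.of_bound ((hpm k).mul (hem k)).aestronglyMeasurable
      (Real.exp (θ * (2 * B))) (Eventually.of_forall fun ω => ?_)
    rw [norm_mul]
    exact (mul_le_of_le_one_left (norm_nonneg _) (hpb k ω)).trans (heb k ω)
  simp_rw [mul_sub, mul_one]
  rw [integral_sub i1 i2, h4]
  ring

end Martingale

/-! ### The compound Poisson process -/

/-- The exponent of a geometric compound Poisson law: `θ (π̂(z) - 1)`, with `π̂` the generating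
function of the geometric multiplicities. -/
noncomputable def clusterExponent (θ : ℝ) (z : ℂ) : ℂ := (z - 1) * θ / (1 - (1 - θ) * z)

section ArrivalTimes

variable {Ω : Type*}

/-- The random measure `∑_i D_i δ_{T_0 + ⋯ + T_i}`. -/
noncomputable def markedMeasure (T : ℕ → Ω → ℝ) (D : ℕ → Ω → ℕ) (ω : Ω) : Measure ℝ≥0 :=
  Measure.sum fun i => (D i ω : ℝ≥0∞) • Measure.dirac (arrival T (i + 1) ω).toNNReal

/-- The waiting times are nonnegative and sum to infinity. -/
def IsProper (T : ℕ → Ω → ℝ) (ω : Ω) : Prop :=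
  (∀ i, 0 ≤ T i ω) ∧ Tendsto (fun k => arrival T k ω) atTop atTop

theorem markedMeasure_apply {T : ℕ → Ω → ℝ} {D : ℕ → Ω → ℕ} {ω : Ω} (h : IsProper T ω) {b : ℝ≥0}
    {A : Set ℝ≥0} [DecidablePred (· ∈ A)] (hA : MeasurableSet A) (hAb : A ⊆ Iio b) {k : ℕ}
    (hk : (b : ℝ) ≤ arrival T (k + 1) ω) :
    markedMeasure T D ω A
      = ((∑ i ∈ Finset.range k, if (arrival T (i + 1) ω).toNNReal ∈ A then D i ω else 0 : ℕ)
          : ℝ≥0∞) := by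
  rw [markedMeasure, Measure.sum_apply _ hA, tsum_eq_sum (s := Finset.range k)]
  · push_cast
    refine Finset.sum_congr rfl fun i _ => ?_
    rw [Pi.smul_apply, Measure.dirac_apply' _ hA, indicator_apply]
    split_ifs <;> simp
  · intro i hi
    rw [Measure.coe_smul, Pi.smul_apply, Measure.dirac_apply' _ hA, indicator_of_notMem, smul_zero]
    intro hmem
    have h1 : (arrival T (i + 1) ω).toNNReal < b := hAb hmem
    rw [Finset.mem_range, not_lt] at hi
    have h2 := arrival_mono h.1 (Nat.succ_le_succ hi)
    rw [← NNReal.coe_lt_coe, Real.coe_toNNReal _ (arrival_nonneg h.1 _)] at h1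
    simp only [Nat.succ_eq_add_one] at h2
    linarith

theorem isLocallyFinite_markedMeasure {T : ℕ → Ω → ℝ} {D : ℕ → Ω → ℕ} {ω : Ω}
    (h : IsProper T ω) : IsLocallyFiniteMeasure (markedMeasure T D ω) := by
  classical
  refine ⟨fun s => ⟨Iio (s + 1), Iio_mem_nhds (by simp), ?_⟩⟩
  obtain ⟨k, hk⟩ := (((tendsto_add_atTop_iff_nat 1).2 h.2).eventually_ge_atTop
    ((s + 1 : ℝ≥0) : ℝ)).exists
  rw [markedMeasure_apply h measurableSet_Iio le_rfl hk]
  exact ENNReal.natCast_lt_top _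

open Classical in
/-- The random measure `∑_i D_i δ_{T_0 + ⋯ + T_i}` as a locally finite measure (zero on the null
set where it is not locally finite). -/
noncomputable def markedProcess (T : ℕ → Ω → ℝ) (D : ℕ → Ω → ℕ) (ω : Ω) : LocFinMeasure :=
  if h : IsProper T ω then ⟨markedMeasure T D ω, isLocallyFinite_markedMeasure h⟩
  else ⟨0, inferInstance⟩

theorem markedProcess_of_isProper {T : ℕ → Ω → ℝ} {D : ℕ → Ω → ℕ} {ω : Ω} (h : IsProper T ω) :
    (markedProcess T D ω).1 = markedMeasure T D ω := congrArg Subtype.val (dif_pos h)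

theorem markedProcess_of_not_isProper {T : ℕ → Ω → ℝ} {D : ℕ → Ω → ℕ} {ω : Ω}
    (h : ¬IsProper T ω) : (markedProcess T D ω).1 = 0 := congrArg Subtype.val (dif_neg h)

/-- The mass of the `j`-th cell. -/
noncomputable def markedCount (T : ℕ → Ω → ℝ) (D : ℕ → Ω → ℕ) (h : ℝ≥0) (j : ℕ) (ω : Ω) : ℕ :=
  ⌊((markedProcess T D ω).1 (cell h j)).toReal⌋₊

theorem exists_markedCount_eq {T : ℕ → Ω → ℝ} {D : ℕ → Ω → ℕ} {ω : Ω} (hω : IsProper T ω)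
    {h : ℝ≥0} (hh : 0 < h) (j : ℕ) : ∀ᶠ k in atTop,
      (markedProcess T D ω).1 (cell h j) = ((∑ i ∈ Finset.range k,
        if ⌊arrival T (i + 1) ω / h⌋₊ = j then D i ω else 0 : ℕ) : ℝ≥0∞) := by
  classical
  filter_upwards [((tendsto_add_atTop_iff_nat 1).2 hω.2).eventually_ge_atTop
    (((j + 1) * h : ℝ≥0) : ℝ)] with k hk
  rw [markedProcess_of_isProper hω,
    markedMeasure_apply hω (measurableSet_cell h j) Ico_subset_Iio_self hk]
  congr 1
  refine Finset.sum_congr rfl fun i _ => ?_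
  have : (arrival T (i + 1) ω).toNNReal ∈ cell h j ↔ ⌊arrival T (i + 1) ω / h⌋₊ = j := by
    have h0 := arrival_nonneg hω.1 (i + 1)
    have hh' : (0 : ℝ) < h := hh
    rw [cell, mem_Ico, ← NNReal.coe_le_coe, ← NNReal.coe_lt_coe, Real.coe_toNNReal _ h0,
      Nat.floor_eq_iff (by positivity), le_div_iff₀ hh', div_lt_iff₀ hh']
    push_cast
    rfl
  simp only [this]

theorem markedProcess_cell (T : ℕ → Ω → ℝ) (D : ℕ → Ω → ℕ) {h : ℝ≥0} (hh : 0 < h) (j : ℕ)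
    (ω : Ω) : (markedProcess T D ω).1 (cell h j) = markedCount T D h j ω := by
  by_cases hω : IsProper T ω
  · obtain ⟨k, hk⟩ := (exists_markedCount_eq hω hh j).exists (f := atTop)
    rw [markedCount, hk, ENNReal.toReal_natCast, Nat.floor_natCast]
  · simp [markedCount, markedProcess_of_not_isProper hω]

variable [MeasurableSpace Ω]

theorem measurableSet_isProper {T : ℕ → Ω → ℝ} (hT : ∀ i, Measurable (T i)) :
    MeasurableSet {ω | IsProper T ω} := by
  refine MeasurableSet.inter (s₁ := {ω | ∀ i, 0 ≤ T i ω}) ?_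
    (measurableSet_tendsto atTop (measurable_arrival hT))
  simp only [ofPred_forall]
  exact .iInter fun i => measurableSet_le measurable_const (hT i)

theorem measurable_markedCount {T : ℕ → Ω → ℝ} {D : ℕ → Ω → ℕ} (hT : ∀ i, Measurable (T i))
    (hD : ∀ i, Measurable (D i)) (h : ℝ≥0) (j : ℕ) : Measurable (markedCount T D h j) := by
  classical
  refine Nat.measurable_floor.comp (ENNReal.measurable_toReal.comp ?_)
  have : (fun ω => (markedProcess T D ω).1 (cell h j))
      = {ω | IsProper T ω}.indicator fun ω => ∑' i, (D i ω : ℝ≥0∞) *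
        (cell h j).indicator 1 (arrival T (i + 1) ω).toNNReal := by
    ext ω
    rw [indicator_apply]
    by_cases hω : IsProper T ω
    · rw [markedProcess_of_isProper hω, if_pos (show ω ∈ {ω | IsProper T ω} from hω), markedMeasure, Measure.sum_apply _ (measurableSet_cell h j)]
      simp [Measure.dirac_apply' _ (measurableSet_cell h j)]
    · rw [markedProcess_of_not_isProper hω, if_neg (show ω ∉ {ω | IsProper T ω} from hω)]
      simp
  rw [this]
  refine Measurable.indicator ?_ (measurableSet_isProper hT)
  refine Measurable.tsum fun i => ?_
  refine ((measurable_of_countable _).comp (hD i)).mul ?_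
  exact (measurable_one.indicator (measurableSet_cell h j)).comp
    (measurable_arrival hT _).real_toNNReal

end ArrivalTimes

theorem tendsto_floor_div_right {h : ℝ} (hh : 0 < h) (s : ℝ) :
    ∀ᶠ x in 𝓝[>] s, ⌊x / h⌋₊ = ⌊s / h⌋₊ := by
  have h1 : s < (⌊s / h⌋₊ + 1) * h := by
    rw [← div_lt_iff₀ hh]
    exact Nat.lt_floor_add_one _
  filter_upwards [Ioo_mem_nhdsGT h1] with x hx
  have h2 : x / h < ⌊s / h⌋₊ + 1 := by
    rw [div_lt_iff₀ hh]
    exact hx.2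
  refine le_antisymm ?_ (Nat.floor_mono (by gcongr; exact hx.1.le))
  have h3 : ⌊x / h⌋₊ < ⌊s / h⌋₊ + 1 := by
    rw [Nat.floor_lt' (by omega)]
    exact_mod_cast h2
  omega

theorem integral_floor_step {h : ℝ} (hh : 0 < h) (c : ℕ → ℂ) (M : ℕ) :
    ∫ x in (0 : ℝ)..M * h, c ⌊x / h⌋₊ = ∑ j ∈ Finset.range M, h * c j := by
  have key : ∀ j : ℕ, EqOn (fun x => c ⌊x / h⌋₊) (fun _ => c j) (Ioo (j * h) ((j + 1 : ℕ) * h)) := by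
    intro j x hx
    have : ⌊x / h⌋₊ = j := by
      have h0 : 0 ≤ x := le_trans (by positivity) hx.1.le
      rw [Nat.floor_eq_iff (by positivity), le_div_iff₀ hh, div_lt_iff₀ hh]
      exact ⟨hx.1.le, by simpa using hx.2⟩
    simp only [this]
  have hle : ∀ j : ℕ, (j : ℝ) * h ≤ (j + 1 : ℕ) * h := fun j => by
    gcongr
    exact_mod_cast j.le_succ
  have h1 : ∀ j : ℕ, ∫ x in ((j : ℝ) * h)..((j + 1 : ℕ) * h), c ⌊x / h⌋₊ = h * c j := by
    intro j
    rw [intervalIntegral.integral_of_le (hle j), integral_Ioc_eq_integral_Ioo,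
      setIntegral_congr_fun measurableSet_Ioo (key j), ← integral_Ioc_eq_integral_Ioo,
      ← intervalIntegral.integral_of_le (hle j), intervalIntegral.integral_const,
      Complex.real_smul]
    congr 1
    push_cast
    ring
  have h2 : ∀ j < M, IntervalIntegrable (fun x => c ⌊x / h⌋₊) volume ((j : ℝ) * h)
      ((j + 1 : ℕ) * h) := by
    intro j _
    rw [intervalIntegrable_iff, uIoc_of_le (hle j), integrableOn_Ioc_iff_integrableOn_Ioo]
    exact (integrableOn_const measure_Ioo_lt_top.ne).congr_fun (fun x hx => (key j hx).symm)
      measurableSet_Ioo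
  have h3 := intervalIntegral.sum_integral_adjacent_intervals (a := fun j : ℕ => (j : ℝ) * h) h2
  simp only [Nat.cast_zero, zero_mul] at h3
  rw [← h3]
  exact Finset.sum_congr rfl fun j _ => h1 j

/-- Regrouping the product over cells by arrivals gives each arrival `s` the factor `w ⌊s / h⌋₊`
raised to its mark. The claim is then `integral_limit_marked` for this step function, which is `1`
from `M * h` on. -/
theorem integral_prod_markedCount {Ω : Type*} [MeasurableSpace Ω] {Q : Measure Ω}
    [IsProbabilityMeasure Q] {T : ℕ → Ω → ℝ} {D : ℕ → Ω → ℕ} {θ : ℝ}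
    (hθ : 0 < θ) (hT : ∀ i, Measurable (T i))
    (hexp : ∀ i, Q.map (T i) = expMeasure θ) (hind : iIndepFun T Q) (hD : ∀ i, Measurable (D i))
    (hindD : iIndepFun D Q) (hTD : IndepFun (fun ω i => T i ω) (fun ω i => D i ω) Q)
    {ρ : ℂ → ℂ} (hρ : ∀ i z, ‖z‖ ≤ 1 → ∫ ω, z ^ D i ω ∂Q = ρ z) {h : ℝ≥0} (hh : 0 < h) (M : ℕ)
    {w : ℕ → ℂ} (hw : ∀ j, ‖w j‖ ≤ 1) (hwM : ∀ j, M ≤ j → w j = 1) :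
    ∫ ω, ∏ j ∈ Finset.range M, w j ^ markedCount T D h j ω ∂Q
      = Complex.exp (∑ j ∈ Finset.range M, h * (θ * (ρ (w j) - 1))) := by
  have hh' : (0 : ℝ) < h := hh
  have hfm : Measurable fun s : ℝ => ⌊s / (h : ℝ)⌋₊ := Nat.measurable_floor.comp (by fun_prop)
  have hfl : ∀ s : ℝ, M * (h : ℝ) ≤ s → M ≤ ⌊s / (h : ℝ)⌋₊ := fun s hs => by
    rw [Nat.le_floor_iff (div_nonneg (le_trans (by positivity) hs) hh'.le), le_div_iff₀ hh']
    exact hs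
  have h1 := integral_limit_marked (g := fun s => w ⌊s / (h : ℝ)⌋₊) (B := M * (h : ℝ))
    (Y := fun ω => ∏ j ∈ Finset.range M, w j ^ markedCount T D h j ω)
    hθ hT hexp hind hD hindD hTD hρ ((measurable_of_countable w).comp hfm)
    ((measurable_of_countable (ρ ∘ w)).comp hfm) (fun s => hw _)
    (fun s => ?_) (by positivity) (fun s hs => hwM _ (hfl s hs)) ?_
  · rw [h1, expTail]
    congr 1
    have h2 := integral_floor_step hh' (fun j => ρ (w j) - 1) M
    simp only [Function.comp_apply]
    rw [h2, Finset.mul_sum]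
    refine Finset.sum_congr rfl fun j _ => ?_
    ring
  · refine tendsto_const_nhds.congr' ?_
    filter_upwards [tendsto_floor_div_right hh' s] with x hx
    simp [hx]
  · filter_upwards [ae_tendsto_sum_atTop hθ hT hexp hind, ae_nonneg_of_map_expMeasure hT hexp]
      with ω hω hnn
    have hproper : IsProper T ω := ⟨hnn, hω⟩
    have h3 : ∀ᶠ k in atTop, ∀ j ∈ Finset.range M, markedCount T D h j ω
        = ∑ i ∈ Finset.range k, if ⌊arrival T (i + 1) ω / h⌋₊ = j then D i ω else 0 := by
      rw [Filter.eventually_all_finset]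
      intro j _
      filter_upwards [exists_markedCount_eq hproper hh j] with k hk
      rw [markedProcess_cell T D hh] at hk
      exact_mod_cast hk
    filter_upwards [h3] with k hk
    have h4 : ∏ j ∈ Finset.range M, w j ^ markedCount T D h j ω
        = ∏ j ∈ Finset.range M, ∏ i ∈ Finset.range k,
          w j ^ (if ⌊arrival T (i + 1) ω / h⌋₊ = j then D i ω else 0) :=
      Finset.prod_congr rfl fun j hj => by rw [hk j hj, Finset.prod_pow_eq_pow_sum]
    rw [h4, Finset.prod_comm]
    refine Finset.prod_congr rfl fun i _ => ?_
    rcases lt_or_ge ⌊arrival T (i + 1) ω / h⌋₊ M with hlt | hge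
    · rw [Finset.prod_eq_single ⌊arrival T (i + 1) ω / h⌋₊]
      · simp
      · intro j _ hj
        rw [if_neg hj.symm, pow_zero]
      · intro hn
        exact absurd (Finset.mem_range.2 hlt) hn
    · rw [hwM _ hge, one_pow]
      refine (Finset.prod_eq_one fun j hj => ?_).symm
      rw [if_neg, pow_zero]
      have := Finset.mem_range.1 hj
      omega

theorem norm_one_sub_mul_lt {θ : ℝ} (hθ0 : 0 < θ) (hθ1 : θ < 1) {z : ℂ} (hz : ‖z‖ ≤ 1) :
    ‖(1 - θ : ℂ) * z‖ < 1 := by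
  have h1 : ‖(1 - θ : ℂ)‖ = 1 - θ := by
    rw [← Complex.ofReal_one, ← Complex.ofReal_sub, Complex.norm_real, Real.norm_eq_abs,
      abs_of_pos (by linarith)]
  rw [norm_mul, h1]
  nlinarith [norm_nonneg z]

theorem one_sub_mul_ne_zero {θ : ℝ} (hθ0 : 0 < θ) (hθ1 : θ < 1) {z : ℂ} (hz : ‖z‖ ≤ 1) :
    (1 - (1 - θ) * z : ℂ) ≠ 0 := by
  intro h
  have := norm_one_sub_mul_lt hθ0 hθ1 hz
  rw [← sub_eq_zero.1 h, norm_one] at this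
  exact lt_irrefl _ this

theorem exists_compoundPoisson {θ : ℝ} (hθ0 : 0 < θ) (hθ1 : θ < 1) :
    ∃ (Ω : Type) (_ : MeasurableSpace Ω) (Q : Measure Ω) (_ : IsProbabilityMeasure Q)
      (N : Ω → LocFinMeasure) (K : (m : ℕ) → Ω → Fin (m * 2 ^ m) → ℕ),
      IsCompoundPoissonProcess Q θ (geometricMultiplicity θ) N ∧ HasDyadicCounts N K ∧
      ∀ (m : ℕ) (z : Fin (m * 2 ^ m) → ℂ), (∀ j, ‖z j‖ = 1) →
        ∫ ω, ∏ j, z j ^ K m ω j ∂Q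
          = ∏ j, Complex.exp (dyadicMesh m * clusterExponent θ (z j)) := by
  have hexpP := isProbabilityMeasure_expMeasure hθ0
  let p : unitInterval := ⟨θ, hθ0.le, hθ1.le⟩
  have hp : p ≠ 0 := fun h => hθ0.ne' (congrArg Subtype.val h)
  let QT : Measure (ℕ → ℝ) := Measure.infinitePi fun _ => expMeasure θ
  let QD : Measure (ℕ → ℕ) := Measure.infinitePi fun _ => geometricMeasure p
  let Q := QT.prod QD
  let T : ℕ → (ℕ → ℝ) × (ℕ → ℕ) → ℝ := fun i ω => ω.1 i
  -- The geometric law lives on `{0, 1, ...}` and gives the depth; the cluster size is one more.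
  let D : ℕ → (ℕ → ℝ) × (ℕ → ℕ) → ℕ := fun i ω => ω.2 i + 1
  have hT : ∀ i, Measurable (T i) := fun i => by fun_prop
  have hD : ∀ i, Measurable (D i) := fun i => by fun_prop
  have hexp : ∀ i, Q.map (T i) = expMeasure θ := fun i => by
    have h1 : T i = (fun t : ℕ → ℝ => t i) ∘ Prod.fst := rfl
    rw [h1, ← Measure.map_map (measurable_pi_apply i) measurable_fst, Measure.map_fst_prod,
      measure_univ, one_smul]
    exact Measure.infinitePi_map_eval _ i
  have hgeo : ∀ i, Q.map (fun ω => ω.2 i) = geometricMeasure p := fun i => by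
    have h1 : (fun ω : (ℕ → ℝ) × (ℕ → ℕ) => ω.2 i) = (fun t : ℕ → ℕ => t i) ∘ Prod.snd := rfl
    rw [h1, ← Measure.map_map (measurable_pi_apply i) measurable_snd, Measure.map_snd_prod,
      measure_univ, one_smul]
    exact Measure.infinitePi_map_eval _ i
  have hind : iIndepFun T Q := by
    rw [iIndepFun_iff_map_fun_eq_infinitePi_map hT]
    simp_rw [hexp]
    exact (Measure.map_fst_prod (μ := QT) (ν := QD)).trans (by rw [measure_univ, one_smul])
  have hindD : iIndepFun D Q := by
    have h0 : iIndepFun (fun i (ω : (ℕ → ℝ) × (ℕ → ℕ)) => ω.2 i) Q := by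
      rw [iIndepFun_iff_map_fun_eq_infinitePi_map fun i => by fun_prop]
      simp_rw [hgeo]
      exact (Measure.map_snd_prod (μ := QT) (ν := QD)).trans (by rw [measure_univ, one_smul])
    exact h0.comp (fun _ n => n + 1) fun _ => measurable_of_countable _
  have hTD : IndepFun (fun ω i => T i ω) (fun ω i => D i ω) Q :=
    indepFun_prod (μ := QT) (ν := QD) (X := id) (Y := fun d i => d i + 1) measurable_id
      (measurable_pi_lambda _ fun i => by fun_prop)
  have hmass : ∀ i k, Q.real {ω | D i ω = k} = geometricMultiplicity θ k := by
    intro i k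
    cases k with
    | zero => simp [D, geometricMultiplicity]
    | succ k =>
      have h1 : {ω | D i ω = k + 1} = (fun ω => ω.2 i) ⁻¹' {k} := by
        ext ω; simp [D]
      rw [h1, ← map_measureReal_apply (by fun_prop) (measurableSet_singleton k), hgeo,
        geometricMeasure_real_singleton hp, geometricMultiplicity, mul_comm]
  have hρ : ∀ (i : ℕ) (z : ℂ), ‖z‖ ≤ 1 → ∫ ω, z ^ D i ω ∂Q = θ * z / (1 - (1 - θ) * z) := by
    intro i z hz
    have h1 : ∫ ω, z ^ D i ω ∂Q = ∫ n, z ^ (n + 1) ∂(Q.map fun ω => ω.2 i) := by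
      rw [integral_map (by fun_prop) (measurable_of_countable _).aestronglyMeasurable]
    rw [h1, hgeo, integral_geometricMeasure hp]
    have h2 : ∀ n : ℕ, ((1 - (p : ℝ)) ^ n * (p : ℝ)) • z ^ (n + 1)
        = ((1 - θ : ℂ) * z) ^ n * (θ * z) := fun n => by
      rw [Complex.real_smul]
      push_cast
      rw [mul_pow, pow_succ]
      ring
    simp_rw [h2]
    rw [tsum_mul_right, tsum_geometric_of_norm_lt_one (norm_one_sub_mul_lt hθ0 hθ1 hz)]
    rw [div_eq_mul_inv]
    ring
  refine ⟨(ℕ → ℝ) × (ℕ → ℕ), inferInstance, Q, inferInstance, markedProcess T D,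
    fun m ω j => markedCount T D (dyadicMesh m) j ω,
    ⟨T, D, hT, hD, hexp, hind, hmass, hindD, hTD, ?_⟩, ⟨?_, ?_⟩, ?_⟩
  · filter_upwards [ae_tendsto_sum_atTop hθ0 hT hexp hind, ae_nonneg_of_map_expMeasure hT hexp]
      with ω hω hnn
    exact markedProcess_of_isProper ⟨hnn, hω⟩
  · exact fun m => measurable_pi_lambda _ fun j => measurable_markedCount hT hD _ _
  · exact fun m ω j => markedProcess_cell T D (dyadicMesh_pos m) j ω
  · intro m z hz
    set w : ℕ → ℂ := fun j => if h : j < m * 2 ^ m then z ⟨j, h⟩ else 1 with hw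
    have hwz : ∀ j : Fin (m * 2 ^ m), w j = z j := fun j => by simp [hw]
    have hw1 : ∀ j, ‖w j‖ ≤ 1 := fun j => by
      by_cases h : j < m * 2 ^ m
      · simp [hw, h, hz]
      · simp [hw, h]
    have key := integral_prod_markedCount hθ0 hT hexp hind hD hindD hTD hρ (dyadicMesh_pos m)
      (m * 2 ^ m) hw1 (fun j hj => by simp [hw, hj])
    rw [Complex.exp_sum] at key
    simp_rw [Finset.prod_range, hwz] at key
    rw [key]
    refine Finset.prod_congr rfl fun j _ => ?_
    congr 2
    have hne := one_sub_mul_ne_zero hθ0 hθ1 (hz j).le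
    rw [clusterExponent, div_sub_one hne, mul_div_assoc']
    congr 1
    ring

/-! ### Exceedances at a fixed level -/

section Combinatorics

variable {X : Type*} {f : X → X} {φ : X → EReal} {p : ℕ} {u : EReal}

theorem mem_nestedSet {κ : ℕ} {x : X} :
    x ∈ nestedSet f φ p κ u ↔ ∀ j ≤ κ, f^[j * p] x ∈ exceedSet φ u := by
  simp [nestedSet]

theorem nestedSet_antitone {κ κ' : ℕ} (h : κ ≤ κ') :
    nestedSet f φ p κ' u ⊆ nestedSet f φ p κ u :=
  fun _ hx => mem_nestedSet.2 fun j hj => mem_nestedSet.1 hx j (hj.trans h)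

theorem mem_annulus {κ : ℕ} {x : X} : x ∈ annulus f φ p κ u ↔
    (∀ j ≤ κ, f^[j * p] x ∈ exceedSet φ u) ∧ f^[(κ + 1) * p] x ∉ exceedSet φ u := by
  rw [annulus, Set.mem_sdiff, mem_nestedSet, mem_nestedSet]
  refine and_congr_right fun h => not_congr ⟨fun h' => h' _ le_rfl, fun h' j hj => ?_⟩
  rcases Nat.le_succ_iff.1 hj with hj | rfl
  · exact h j hj
  · exact h'

theorem annulus_subset_exceedSet (κ : ℕ) : annulus f φ p κ u ⊆ exceedSet φ u :=
  fun x hx => by simpa using (mem_annulus.1 hx).1 0 (Nat.zero_le _)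

/-- The indicators of the nested sets telescope. Truncating at depth `K` leaves finitely many annuli
to control, and by (R2) the remainder has relative probability close to `(1 - θ) ^ (K + 1)`. -/
theorem sum_indicator_annulus (K : ℕ) (x : X) :
    ∑ κ ∈ Finset.range (K + 1), (annulus f φ p κ u).indicator (1 : X → ℂ) x
      + (nestedSet f φ p (K + 1) u).indicator 1 x = (exceedSet φ u).indicator 1 x := by
  classical
  have h : ∀ κ, (annulus f φ p κ u).indicator (1 : X → ℂ) x
      = (nestedSet f φ p κ u).indicator 1 x - (nestedSet f φ p (κ + 1) u).indicator 1 x := by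
    intro κ
    rw [annulus, Set.indicator_sdiff (nestedSet_antitone κ.le_succ)]
    rfl
  simp_rw [h]
  rw [Finset.sum_range_sub' (fun κ => (nestedSet f φ p κ u).indicator (1 : X → ℂ) x),
    nestedSet_zero]
  ring

open Classical in
/-- The product over `i ∈ [a, b)` of `w i` if `X_i > u` and `1` otherwise. -/
noncomputable def exceedWeight (f : X → X) (φ : X → EReal) (u : EReal) (w : ℕ → ℂ) (a b : ℕ)
    (x : X) : ℂ :=
  ∏ i ∈ Finset.Ico a b, if f^[i] x ∈ exceedSet φ u then w i else 1

theorem exceedWeight_self (w : ℕ → ℂ) (a : ℕ) (x : X) : exceedWeight f φ u w a a x = 1 := by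
  simp [exceedWeight]

theorem exceedWeight_mul (w : ℕ → ℂ) {a b c : ℕ} (hab : a ≤ b) (hbc : b ≤ c) (x : X) :
    exceedWeight f φ u w a b x * exceedWeight f φ u w b c x = exceedWeight f φ u w a c x :=
  Finset.prod_Ico_consecutive _ hab hbc

theorem norm_exceedWeight_le {w : ℕ → ℂ} (hw : ∀ i, ‖w i‖ ≤ 1) (a b : ℕ) (x : X) :
    ‖exceedWeight f φ u w a b x‖ ≤ 1 := by
  rw [exceedWeight, norm_prod]
  refine Finset.prod_le_one (fun _ _ => norm_nonneg _) fun i _ => ?_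
  split_ifs
  · exact hw i
  · simp

/-- Beside the exceedance at time `a` only later times appear, so it does not matter whether this
exceedance opens its cluster. -/
theorem exceedWeight_sub_succ (w : ℕ → ℂ) {a b : ℕ} (hab : a < b) (x : X) :
    exceedWeight f φ u w a b x - exceedWeight f φ u w (a + 1) b x
      = (w a - 1) * ((exceedSet φ u).indicator 1 (f^[a] x) * exceedWeight f φ u w (a + 1) b x) := by
  classical
  rw [← exceedWeight_mul w a.le_succ hab]
  have : exceedWeight f φ u w a (a + 1) x = if f^[a] x ∈ exceedSet φ u then w a else 1 := by
    simp [exceedWeight]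
  rw [Nat.succ_eq_add_one, this, indicator_apply]
  split_ifs
  · simp; ring
  · simp

open Classical in
/-- The number of exceedances at the times in `[a, b)`. -/
noncomputable def exceedCard (f : X → X) (φ : X → EReal) (u : EReal) (a b : ℕ) (x : X) : ℕ :=
  ((Finset.Ico a b).filter fun i => f^[i] x ∈ exceedSet φ u).card

theorem exceedWeight_eq_pow {w : ℕ → ℂ} {z : ℂ} {a b : ℕ} (hw : ∀ i, a ≤ i → i < b → w i = z)
    (x : X) : exceedWeight f φ u w a b x = z ^ exceedCard f φ u a b x := by
  classical
  rw [exceedWeight, exceedCard, Finset.prod_ite, Finset.prod_const_one, mul_one,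
    ← Finset.prod_const]
  refine Finset.prod_congr rfl fun i hi => ?_
  have := Finset.mem_Ico.1 (Finset.mem_filter.1 hi).1
  exact hw i this.1 this.2

theorem exceedCard_add (a b s : ℕ) (x : X) :
    exceedCard f φ u (a + s) (b + s) x = exceedCard f φ u a b (f^[s] x) := by
  classical
  rw [exceedCard, exceedCard, ← Finset.map_add_right_Ico, Finset.filter_map, Finset.card_map]
  congr 1
  ext i
  simp [Function.iterate_add_apply]

theorem exceedCount_Ico (a b : ℕ) (x : X) :
    exceedCount f φ u (Ico (a : ℝ) b) x = exceedCard f φ u a b x := by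
  classical
  rw [exceedCount, exceedCard, ← Set.encard_coe_eq_coe_finsetCard]
  congr 1
  ext i
  rw [Finset.mem_coe, Finset.mem_filter, Finset.mem_Ico]
  simp [process, exceedSet]

theorem exceedWeight_eq_prod {w ζ : ℕ → ℂ} {α : ℕ → ℕ} (hα : Monotone α) (M : ℕ)
    (hw : ∀ j < M, ∀ i, α j ≤ i → i < α (j + 1) → w i = ζ j) (x : X) :
    exceedWeight f φ u w (α 0) (α M) x
      = ∏ j ∈ Finset.range M, ζ j ^ exceedCard f φ u (α j) (α (j + 1)) x := by
  induction M with
  | zero => simp [exceedWeight_self]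
  | succ M ih =>
    rw [Finset.prod_range_succ, ← ih fun j hj => hw j (by omega),
      ← exceedWeight_mul w (hα M.zero_le) (hα M.le_succ)]
    congr 1
    exact exceedWeight_eq_pow (hw M (by omega)) x

/-- A cluster that starts at time `0` and has depth `κ` has exactly `κ` further exceedances before
time `E`, unless an extra exceedance occurs. -/
theorem exceedCard_of_mem_annulus (hp : 0 < p) {κ E : ℕ} (hE : κ * p < E) {y : X}
    (hy : y ∈ annulus f φ p κ u)
    (hreg : ∀ i, 0 < i → i < E → f^[i] y ∈ exceedSet φ u → ∃ j ≤ κ, i = j * p) :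
    exceedCard f φ u 1 E y = κ := by
  classical
  have h : (Finset.Ico 1 E).filter (fun i => f^[i] y ∈ exceedSet φ u)
      = (Finset.Icc 1 κ).image (· * p) := by
    ext i
    simp only [Finset.mem_filter, Finset.mem_Ico, Finset.mem_image, Finset.mem_Icc]
    constructor
    · rintro ⟨⟨h1, h2⟩, h3⟩
      obtain ⟨j, hj, rfl⟩ := hreg i h1 h2 h3
      exact ⟨j, ⟨Nat.pos_of_mul_pos_right h1, hj⟩, rfl⟩
    · rintro ⟨j, ⟨h1, h2⟩, rfl⟩
      refine ⟨⟨Nat.mul_pos h1 hp, lt_of_le_of_lt (Nat.mul_le_mul_right p h2) hE⟩,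
        (mem_annulus.1 hy).1 j h2⟩
  rw [exceedCard, h, Finset.card_image_of_injective _ (fun i j h => Nat.eq_of_mul_eq_mul_right hp h),
    Nat.card_Icc, Nat.add_sub_cancel]

/-- An exceedance outside the cluster chain produces an escape followed by an exceedance. -/
theorem exists_escape_of_extra_exceedance {κ E : ℕ} (hE : κ * p < E) {y : X}
    (hy : y ∈ annulus f φ p κ u) {i : ℕ} (hi : i < E) (hiA : f^[i] y ∈ exceedSet φ u)
    (hirr : ¬∃ j ≤ κ, i = j * p) :
    ∃ s ≤ κ * p, ∃ j ∈ Finset.Icc 1 (E + p),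
      f^[s] y ∈ annulus f φ p 0 u ∧ f^[j] (f^[s] y) ∈ exceedSet φ u := by
  -- The chain breaks after its last exceedance, which is thus an escape.
  have hq : f^[κ * p] y ∈ annulus f φ p 0 u := by
    rw [mem_annulus] at hy ⊢
    refine ⟨fun j hj => ?_, ?_⟩
    · rw [Nat.le_zero.1 hj]
      simpa using hy.1 κ le_rfl
    · rw [← Function.iterate_add_apply]
      convert! hy.2 using 3
      ring
  -- Follow the stray exceedance in steps of `p`. If it escapes before `κ * p`, the exceedance at `κ
  -- * p` comes after that escape; if it passes `κ * p`, it comes after the escape there, at lag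
  -- below `p` if the last step jumped over. It cannot land on `κ * p`, for it would then have
  -- belonged to the chain from the start.
  induction hn : κ * p - i using Nat.strong_induction_on generalizing i with
  | _ n ih =>
    rcases lt_trichotomy i (κ * p) with hlt | heq | hgt
    · by_cases hip : f^[i + p] y ∈ exceedSet φ u
      · rcases lt_trichotomy (i + p) (κ * p) with hlt' | heq' | hgt'
        · rcases Nat.eq_zero_or_pos p with rfl | hp
          · simp at hlt
          refine ih (κ * p - (i + p)) (by omega) (hlt'.trans hE) hip ?_ rfl
          rintro ⟨j, hj, hj'⟩
          refine hirr ⟨j - 1, by omega, ?_⟩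
          rw [Nat.sub_mul]
          omega
        · refine absurd ⟨κ - 1, by omega, ?_⟩ hirr
          rw [Nat.sub_mul]
          omega
        · refine ⟨κ * p, le_rfl, i + p - κ * p, Finset.mem_Icc.2 ⟨by omega, by omega⟩, hq, ?_⟩
          rwa [← Function.iterate_add_apply, Nat.sub_add_cancel hgt'.le]
      · refine ⟨i, hlt.le, κ * p - i, Finset.mem_Icc.2 ⟨by omega, by omega⟩, ?_, ?_⟩
        · rw [mem_annulus]
          refine ⟨fun j hj => ?_, ?_⟩
          · rw [Nat.le_zero.1 hj]
            simpa using hiA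
          · rw [← Function.iterate_add_apply]
            convert! hip using 3
            ring
        · rw [← Function.iterate_add_apply]
          rw [Nat.sub_add_cancel hlt.le]
          exact (mem_annulus.1 hy).1 κ le_rfl
    · exact absurd ⟨κ, le_rfl, heq⟩ hirr
    · refine ⟨κ * p, le_rfl, i - κ * p, Finset.mem_Icc.2 ⟨by omega, by omega⟩, hq, ?_⟩
      rwa [← Function.iterate_add_apply, Nat.sub_add_cancel hgt.le]

end Combinatorics

/-- Covariance of a bounded function of a discrete variable with an event, from the covariances
with finitely many of the values. -/
theorem norm_covariance_le {X ι : Type*} [MeasurableSpace X] {P : Measure X}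
    [IsProbabilityMeasure P] [MeasurableSpace ι] [DiscreteMeasurableSpace ι] {K : X → ι}
    (hK : Measurable K) {A : Set X} (hA : MeasurableSet A) {W : ι → ℂ} (hW : ∀ i, ‖W i‖ ≤ 1)
    (F : Finset ι) {γ : ℝ}
    (h : ∀ i ∈ F, |P.real (A ∩ K ⁻¹' {i}) - P.real A * P.real (K ⁻¹' {i})| ≤ γ) :
    ‖∫ x in A, W (K x) ∂P - P.real A * ∫ x, W (K x) ∂P‖
      ≤ 2 * (F.card * γ) + 2 * (P.real A * P.real (K ⁻¹' (F : Set ι)ᶜ)) := by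
  have hms : ∀ s : Set ι, MeasurableSet (K ⁻¹' s) := fun s => hK (MeasurableSet.of_discrete)
  have hint : Integrable (fun x => W (K x)) P :=
    Integrable.of_bound ((Measurable.of_discrete (f := W)).comp hK).aestronglyMeasurable 1
      (Eventually.of_forall fun x => hW _)
  set T := K ⁻¹' (F : Set ι)ᶜ with hT
  have hTc : T = (⋃ i ∈ F, K ⁻¹' {i})ᶜ := by
    ext x; simp [hT]
  have hUm : MeasurableSet (⋃ i ∈ F, K ⁻¹' {i}) := F.measurableSet_biUnion fun i _ => hms _
  have hdisj : (F : Set ι).PairwiseDisjoint fun i => K ⁻¹' {i} := by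
    intro i _ j _ hij
    exact Disjoint.preimage _ (by simpa using hij)
  have hdec : ∀ B : Set X, MeasurableSet B → ∫ x in B, W (K x) ∂P
      = ∑ i ∈ F, (P.real (B ∩ K ⁻¹' {i}) : ℂ) * W i + ∫ x in B ∩ T, W (K x) ∂P := by
    intro B hB
    rw [← integral_inter_add_sdiff hUm hint.integrableOn, inter_iUnion₂,
      integral_biUnion_finset F (fun i _ => hB.inter (hms _))
        (fun i hi j hj hij => (hdisj hi hj hij).mono inter_subset_right inter_subset_right)
        (fun i _ => hint.integrableOn), hTc, Set.sdiff_eq]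
    congr 1
    refine Finset.sum_congr rfl fun i _ => ?_
    rw [setIntegral_congr_fun (g := fun _ => W i) (hB.inter (hms _))
      (fun x hx => by rw [show K x = i from hx.2]), setIntegral_const, Complex.real_smul]
  have hmass : ∀ B : Set X, MeasurableSet B →
      P.real B = ∑ i ∈ F, P.real (B ∩ K ⁻¹' {i}) + P.real (B ∩ T) := by
    intro B hB
    rw [← measureReal_inter_add_sdiff (s := B) hUm, inter_iUnion₂, measureReal_biUnion_finset
      (fun i hi j hj hij => (hdisj hi hj hij).mono inter_subset_right inter_subset_right)
      (fun i _ => hB.inter (hms _)), hTc, Set.sdiff_eq]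
  have hsum : |∑ i ∈ F, (P.real (A ∩ K ⁻¹' {i}) - P.real A * P.real (K ⁻¹' {i}))|
      ≤ F.card * γ := by
    refine (Finset.abs_sum_le_sum_abs _ _).trans ((Finset.sum_le_sum h).trans ?_)
    rw [Finset.sum_const, nsmul_eq_mul]
  -- Nothing is assumed about values outside `F`; comparing total masses transfers the bound to the
  -- tail event `T`.
  have hAT : P.real (A ∩ T) ≤ P.real A * P.real T + F.card * γ := by
    have h1 := hmass A hA
    have h2 := hmass univ .univ
    simp only [univ_inter] at h2
    rw [probReal_univ] at h2
    rw [Finset.sum_sub_distrib, ← Finset.mul_sum, abs_le] at hsum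
    have h3 : ∑ i ∈ F, P.real (K ⁻¹' {i}) = 1 - P.real T := by linarith
    rw [h3] at hsum
    linarith [hsum.1]
  have hb : ∀ B : Set X, ‖∫ x in B, W (K x) ∂P‖ ≤ P.real B := fun B => by
    simpa using norm_setIntegral_le_of_norm_le_const (μ := P) (s := B) (C := 1)
      (measure_lt_top _ _) (fun x _ => hW (K x))
  have h1 := hdec A hA
  have h2 := hdec univ .univ
  simp only [univ_inter, Measure.restrict_univ] at h2
  have h3 : ∫ x in A, W (K x) ∂P - P.real A * ∫ x, W (K x) ∂P
      = ∑ i ∈ F, ((P.real (A ∩ K ⁻¹' {i}) - P.real A * P.real (K ⁻¹' {i}) : ℝ) : ℂ) * W i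
        + ∫ x in A ∩ T, W (K x) ∂P - P.real A * ∫ x in T, W (K x) ∂P := by
    rw [h1, h2, mul_add, Finset.mul_sum]
    push_cast
    simp_rw [sub_mul]
    rw [Finset.sum_sub_distrib]
    simp_rw [mul_assoc]
    ring
  rw [h3]
  refine (norm_sub_le _ _).trans ((add_le_add_left (norm_add_le _ _) _).trans ?_)
  have h4 : ‖∑ i ∈ F, ((P.real (A ∩ K ⁻¹' {i}) - P.real A * P.real (K ⁻¹' {i}) : ℝ) : ℂ) * W i‖
      ≤ F.card * γ := by
    refine (norm_sum_le _ _).trans ((Finset.sum_le_sum (g := fun _ => γ) fun i hi => ?_).trans ?_)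
    · rw [norm_mul, Complex.norm_real, Real.norm_eq_abs]
      exact (mul_le_of_le_one_right (abs_nonneg _) (hW i)).trans (h i hi)
    · rw [Finset.sum_const, nsmul_eq_mul]
  have h5 : ‖(P.real A : ℂ) * ∫ x in T, W (K x) ∂P‖ ≤ P.real A * P.real T := by
    rw [norm_mul, Complex.norm_real, Real.norm_eq_abs, abs_of_nonneg measureReal_nonneg]
    gcongr
    exact hb T
  linarith [hb (A ∩ T)]

/-! ### One backward step of the recursion, at a fixed level -/

section FixedLevel

variable {X : Type*} {f : X → X} {φ : X → EReal} {p : ℕ} {u : EReal}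

theorem exceedCard_eq_sum (a b : ℕ) (x : X) : (exceedCard f φ u a b x : ℝ)
    = ∑ i ∈ Finset.Ico a b, {x | f^[i] x ∈ exceedSet φ u}.indicator (1 : X → ℝ) x := by
  classical
  rw [exceedCard, Finset.card_filter]
  push_cast
  rfl

variable [MeasurableSpace X] {P : Measure X}

theorem measureReal_iterate_preimage (hf : MeasurePreserving f P P) (i : ℕ) {A : Set X}
    (hA : MeasurableSet A) : P.real (f^[i] ⁻¹' A) = P.real A :=
  (hf.iterate i).measureReal_preimage hA.nullMeasurableSet

/-- The probability of escaping and exceeding again within time `J`, summed over times. -/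
noncomputable def escapeSum (P : Measure X) (f : X → X) (φ : X → EReal) (p : ℕ) (u : EReal)
    (J : ℕ) : ℝ :=
  ∑ j ∈ Finset.Icc 1 J, P.real (annulus f φ p 0 u ∩ {x | u < process f φ j x})

theorem escapeSum_mono {J J' : ℕ} (h : J ≤ J') :
    escapeSum P f φ p u J ≤ escapeSum P f φ p u J' :=
  Finset.sum_le_sum_of_subset_of_nonneg (Finset.Icc_subset_Icc_right h)
    fun _ _ _ => measureReal_nonneg

theorem escapeSum_nonneg (J : ℕ) : 0 ≤ escapeSum P f φ p u J :=
  Finset.sum_nonneg fun _ _ => measureReal_nonneg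

variable [IsProbabilityMeasure P]

theorem measurableSet_exceedSet (hφ : Measurable φ) (u : EReal) : MeasurableSet (exceedSet φ u) :=
  measurableSet_lt measurable_const hφ

theorem measurableSet_iterate_exceedSet (hf : Measurable f) (hφ : Measurable φ) (u : EReal)
    (i : ℕ) : MeasurableSet {x | f^[i] x ∈ exceedSet φ u} :=
  (hf.iterate i) (measurableSet_exceedSet hφ u)

theorem measurableSet_nestedSet (hf : Measurable f) (hφ : Measurable φ) (p κ : ℕ) (u : EReal) :
    MeasurableSet (nestedSet f φ p κ u) :=
  Finset.measurableSet_biInter _ fun _ _ => (hf.iterate _) (measurableSet_exceedSet hφ u)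

theorem measurableSet_annulus (hf : Measurable f) (hφ : Measurable φ) (p κ : ℕ) (u : EReal) :
    MeasurableSet (annulus f φ p κ u) :=
  (measurableSet_nestedSet hf hφ p κ u).diff (measurableSet_nestedSet hf hφ p (κ + 1) u)

theorem measurable_exceedWeight (hf : Measurable f) (hφ : Measurable φ) (u : EReal) (w : ℕ → ℂ)
    (a b : ℕ) : Measurable (exceedWeight f φ u w a b) :=
  Finset.measurable_fun_prod _ fun i _ =>
    Measurable.ite (measurableSet_iterate_exceedSet hf hφ u i) measurable_const measurable_const

theorem measurable_exceedCard (hf : Measurable f) (hφ : Measurable φ) (u : EReal) (a b : ℕ) :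
    Measurable (exceedCard f φ u a b) := by
  classical
  have : exceedCard f φ u a b
      = fun x => ∑ i ∈ Finset.Ico a b, if f^[i] x ∈ exceedSet φ u then 1 else 0 := by
    ext x
    rw [exceedCard, Finset.card_filter]
  rw [this]
  exact Finset.measurable_fun_sum _ fun i _ =>
    Measurable.ite (measurableSet_iterate_exceedSet hf hφ u i) measurable_const measurable_const

theorem integral_exceedCard (hf : MeasurePreserving f P P) (hφ : Measurable φ) (a b : ℕ) :
    ∫ x, (exceedCard f φ u a b x : ℝ) ∂P = (b - a : ℕ) * P.real (exceedSet φ u) := by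
  simp_rw [exceedCard_eq_sum]
  rw [integral_finsetSum]
  · have h : ∀ i ∈ Finset.Ico a b,
        ∫ x, {x | f^[i] x ∈ exceedSet φ u}.indicator (1 : X → ℝ) x ∂P
          = P.real (exceedSet φ u) := fun i _ =>
      (integral_indicator_one (measurableSet_iterate_exceedSet hf.measurable hφ u i)).trans
        (measureReal_iterate_preimage hf i (measurableSet_exceedSet hφ u))
    rw [Finset.sum_congr rfl h]
    simp
  · exact fun i _ => (integrable_const 1).indicator
      (measurableSet_iterate_exceedSet hf.measurable hφ u i)

/-- The expectation of `exceedWeight`. -/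
noncomputable def meanWeight (P : Measure X) (f : X → X) (φ : X → EReal) (u : EReal) (w : ℕ → ℂ)
    (a b : ℕ) : ℂ := ∫ x, exceedWeight f φ u w a b x ∂P

theorem integrable_exceedWeight (hf : Measurable f) (hφ : Measurable φ) {w : ℕ → ℂ}
    (hw : ∀ i, ‖w i‖ ≤ 1) (a b : ℕ) : Integrable (exceedWeight f φ u w a b) P :=
  Integrable.of_bound (measurable_exceedWeight hf hφ u w a b).aestronglyMeasurable 1
    (Eventually.of_forall fun x => norm_exceedWeight_le hw a b x)

/-- Dropping one time changes the weight only if there is an exceedance at that time, and then by at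
most `‖w a - 1‖ ≤ 2`. -/
theorem norm_meanWeight_sub_succ_le (hf : MeasurePreserving f P P) (hφ : Measurable φ)
    {w : ℕ → ℂ} (hw : ∀ i, ‖w i‖ ≤ 1) {a b : ℕ} (hab : a < b) :
    ‖meanWeight P f φ u w a b - meanWeight P f φ u w (a + 1) b‖
      ≤ 2 * P.real (exceedSet φ u) := by
  have hA := measurableSet_iterate_exceedSet hf.measurable hφ u a
  rw [meanWeight, meanWeight, ← integral_sub (integrable_exceedWeight hf.measurable hφ hw _ _)
    (integrable_exceedWeight hf.measurable hφ hw _ _)]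
  simp_rw [exceedWeight_sub_succ w hab]
  rw [integral_const_mul, norm_mul]
  have h1 : ‖w a - 1‖ ≤ 2 := (norm_sub_le _ _).trans (by simpa using by linarith [hw a])
  have h2 : ‖∫ x, (exceedSet φ u).indicator 1 (f^[a] x) * exceedWeight f φ u w (a + 1) b x ∂P‖
      ≤ P.real (exceedSet φ u) := by
    have h3 : ∫ x, {x | f^[a] x ∈ exceedSet φ u}.indicator (1 : X → ℝ) x ∂P
        = P.real (exceedSet φ u) := (integral_indicator_one hA).trans
      (measureReal_iterate_preimage hf a (measurableSet_exceedSet hφ u))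
    rw [← h3]
    refine norm_integral_le_of_norm_le ((integrable_const 1).indicator hA)
      (Eventually.of_forall fun x => ?_)
    rw [norm_mul]
    refine (mul_le_of_le_one_right (norm_nonneg _) (norm_exceedWeight_le hw _ _ x)).trans ?_
    by_cases hx : f^[a] x ∈ exceedSet φ u
    · simp [hx]
    · simp [hx]
  gcongr

theorem norm_meanWeight_sub_le (hf : MeasurePreserving f P P) (hφ : Measurable φ)
    {w : ℕ → ℂ} (hw : ∀ i, ‖w i‖ ≤ 1) (a d : ℕ) {b : ℕ} (hab : a + d ≤ b) :
    ‖meanWeight P f φ u w a b - meanWeight P f φ u w (a + d) b‖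
      ≤ 2 * d * P.real (exceedSet φ u) := by
  induction d with
  | zero => simp
  | succ d ih =>
    have h1 := norm_meanWeight_sub_succ_le (u := u) hf hφ hw (show a + d < b by omega)
    have h2 := ih (by omega)
    rw [← add_assoc]
    push_cast
    have h3 := norm_sub_le_norm_sub_add_norm_sub (meanWeight P f φ u w a b)
      (meanWeight P f φ u w (a + d) b) (meanWeight P f φ u w (a + d + 1) b)
    linarith

/-- The event that a cluster of depth `κ` is accompanied by another exceedance before time `E`. -/
def irregularSet (f : X → X) (φ : X → EReal) (p : ℕ) (u : EReal) (κ E : ℕ) : Set X :=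
  annulus f φ p κ u ∩
    {y | ∃ i, 0 < i ∧ i < E ∧ f^[i] y ∈ exceedSet φ u ∧ ¬∃ j ≤ κ, i = j * p}

theorem measurableSet_irregularSet (hf : Measurable f) (hφ : Measurable φ) (p : ℕ) (u : EReal)
    (κ E : ℕ) : MeasurableSet (irregularSet f φ p u κ E) := by
  refine (measurableSet_annulus hf hφ p κ u).inter ?_
  have : {y | ∃ i, 0 < i ∧ i < E ∧ f^[i] y ∈ exceedSet φ u ∧ ¬∃ j ≤ κ, i = j * p}
      = ⋃ i, ⋃ (_ : 0 < i), ⋃ (_ : i < E), ⋃ (_ : ¬∃ j ≤ κ, i = j * p),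
        {y | f^[i] y ∈ exceedSet φ u} := by
    ext y
    simp only [mem_iUnion, mem_ofPred_eq, exists_prop]
    exact exists_congr fun i => by tauto
  rw [this]
  exact .iUnion fun i => .iUnion fun _ => .iUnion fun _ => .iUnion fun _ =>
    measurableSet_iterate_exceedSet hf hφ u i

/-- A union bound over the escape time `s ≤ κ * p` and the lag of the exceedance after it;
stationarity makes every `s` contribute the same sum. -/
theorem measureReal_irregularSet_le (hf : MeasurePreserving f P P) (hφ : Measurable φ)
    {κ E : ℕ} (hE : κ * p < E) :
    P.real (irregularSet f φ p u κ E) ≤ (κ * p + 1) * escapeSum P f φ p u (E + p) := by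
  have hsub : irregularSet f φ p u κ E ⊆ ⋃ s ∈ Finset.range (κ * p + 1),
      ⋃ j ∈ Finset.Icc 1 (E + p),
        f^[s] ⁻¹' (annulus f φ p 0 u ∩ {x | u < process f φ j x}) := by
    rintro y ⟨hy, i, -, hi, hiA, hirr⟩
    obtain ⟨s, hs, j, hj, h1, h2⟩ := exists_escape_of_extra_exceedance hE hy hi hiA hirr
    simp only [mem_iUnion]
    exact ⟨s, Finset.mem_range.2 (by omega), j, hj, h1, h2⟩
  refine (measureReal_mono hsub (measure_ne_top _ _)).trans ((measureReal_biUnion_finset_le _ _).trans ?_)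
  have h1 : ∀ s ∈ Finset.range (κ * p + 1), P.real (⋃ j ∈ Finset.Icc 1 (E + p),
      f^[s] ⁻¹' (annulus f φ p 0 u ∩ {x | u < process f φ j x}))
        ≤ escapeSum P f φ p u (E + p) := by
    intro s _
    refine (measureReal_biUnion_finset_le _ _).trans (Finset.sum_le_sum fun j _ => ?_)
    refine (measureReal_iterate_preimage hf s ?_).le
    exact (measurableSet_annulus hf.measurable hφ p 0 u).inter
      (measurableSet_iterate_exceedSet hf.measurable hφ u j)
  refine (Finset.sum_le_sum h1).trans ?_
  rw [Finset.sum_const, Finset.card_range, nsmul_eq_mul]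
  push_cast
  exact le_rfl

/-- On a cluster of depth `κ`, the weight of the next `E` steps may be replaced by `z ^ κ`. -/
theorem norm_integral_annulus_sub_le (hf : MeasurePreserving f P P) (hφ : Measurable φ)
    (hp : 0 < p) {w : ℕ → ℂ} (hw : ∀ i, ‖w i‖ ≤ 1) {κ E a b : ℕ} (hE : κ * p < E)
    (hb : a + E ≤ b) {z : ℂ} (hz : ∀ i, a + 1 ≤ i → i < a + E → w i = z) (hz1 : ‖z‖ ≤ 1) :
    ‖∫ x in f^[a] ⁻¹' annulus f φ p κ u, exceedWeight f φ u w (a + 1) b x ∂P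
        - z ^ κ * ∫ x in f^[a] ⁻¹' annulus f φ p κ u, exceedWeight f φ u w (a + E) b x ∂P‖
      ≤ 2 * ((κ * p + 1) * escapeSum P f φ p u (E + p)) := by
  have hQ := hf.measurable.iterate a (measurableSet_annulus hf.measurable hφ p κ u)
  have hI := measurableSet_irregularSet hf.measurable hφ p u κ E
  have hi1 := fun c => (integrable_exceedWeight (P := P) (u := u) hf.measurable hφ hw c b)
  rw [← integral_const_mul, ← integral_sub (hi1 _).integrableOn
    ((hi1 _).const_mul _).integrableOn, ← integral_indicator hQ]
  have hbound : ∀ x, ‖(f^[a] ⁻¹' annulus f φ p κ u).indicator (fun x =>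
      exceedWeight f φ u w (a + 1) b x - z ^ κ * exceedWeight f φ u w (a + E) b x) x‖
      ≤ (f^[a] ⁻¹' irregularSet f φ p u κ E).indicator (fun _ => (2 : ℝ)) x := by
    intro x
    by_cases hx : f^[a] x ∈ annulus f φ p κ u
    · rw [indicator_of_mem (show x ∈ f^[a] ⁻¹' annulus f φ p κ u from hx)]
      by_cases hx' : f^[a] x ∈ irregularSet f φ p u κ E
      · rw [indicator_of_mem (show x ∈ f^[a] ⁻¹' irregularSet f φ p u κ E from hx')]
        refine (norm_sub_le _ _).trans ?_
        rw [norm_mul, norm_pow]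
        have h1 := norm_exceedWeight_le (f := f) (φ := φ) (u := u) hw (a + 1) b x
        have h2 := norm_exceedWeight_le (f := f) (φ := φ) (u := u) hw (a + E) b x
        have h3 := pow_le_one₀ (norm_nonneg z) hz1 (n := κ)
        nlinarith [norm_nonneg (exceedWeight f φ u w (a + E) b x), pow_nonneg (norm_nonneg z) κ]
      · rw [indicator_of_notMem (show x ∉ f^[a] ⁻¹' irregularSet f φ p u κ E from hx')]
        have hcard : exceedCard f φ u 1 E (f^[a] x) = κ := by
          refine exceedCard_of_mem_annulus hp hE hx fun i h1 h2 h3 => ?_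
          by_contra hirr
          exact hx' ⟨hx, i, h1, h2, h3, hirr⟩
        rw [← exceedWeight_mul w (show a + 1 ≤ a + E by omega) hb, exceedWeight_eq_pow hz,
          add_comm a 1, add_comm a E, exceedCard_add, hcard, sub_self, norm_zero]
    · rw [indicator_of_notMem (show x ∉ f^[a] ⁻¹' annulus f φ p κ u from hx), norm_zero]
      exact indicator_nonneg (fun _ _ => by norm_num) _
  refine (norm_integral_le_of_norm_le ((integrable_const 2).indicator
    (hf.measurable.iterate a hI)) (Eventually.of_forall hbound)).trans ?_
  rw [integral_indicator (hf.measurable.iterate a hI), setIntegral_const, smul_eq_mul, mul_comm,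
    measureReal_iterate_preimage hf a hI]
  gcongr
  exact measureReal_irregularSet_le hf hφ hE

/-- The error terms are, in order: chains deeper than `K`, stray exceedances within the next `E`
times, failure of independence across the gap, and the replacement of the mean from `a + E` by the
mean from `a + 1`. The last one is quadratic because the annulus already carries a factor `P(X_0 >
u)`. -/
theorem norm_meanWeight_step_le (hf : MeasurePreserving f P P) (hφ : Measurable φ)
    (hp : 0 < p) {w : ℕ → ℂ} (hw : ∀ i, ‖w i‖ ≤ 1) {K E a b : ℕ} (hE : K * p < E)
    (hb : a + E ≤ b) {z : ℂ} (hz : ∀ i, a ≤ i → i < a + E → w i = z) {η : ℝ}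
    (hmix : ∀ κ ≤ K, ‖∫ x in f^[a] ⁻¹' annulus f φ p κ u, exceedWeight f φ u w (a + E) b x ∂P
      - P.real (annulus f φ p κ u) * meanWeight P f φ u w (a + E) b‖ ≤ η) :
    ‖meanWeight P f φ u w a b - meanWeight P f φ u w (a + 1) b
      - (z - 1) * (∑ κ ∈ Finset.range (K + 1), z ^ κ * P.real (annulus f φ p κ u))
        * meanWeight P f φ u w (a + 1) b‖
      ≤ 2 * (P.real (nestedSet f φ p (K + 1) u) + (K + 1) *
        (2 * ((K * p + 1) * escapeSum P f φ p u (E + p)) + η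
          + 2 * E * P.real (exceedSet φ u) ^ 2)) := by
  have hza : w a = z := hz a le_rfl (by omega)
  have hz1 : ‖z‖ ≤ 1 := hza ▸ hw a
  have hEb : a < b := by omega
  set I := fun c => meanWeight P f φ u w c b with hI
  have hi := fun c => (integrable_exceedWeight (P := P) (u := u) hf.measurable hφ hw c b)
  have hQ : ∀ κ, MeasurableSet (f^[a] ⁻¹' annulus f φ p κ u) := fun κ =>
    hf.measurable.iterate a (measurableSet_annulus hf.measurable hφ p κ u)
  have hN : MeasurableSet (f^[a] ⁻¹' nestedSet f φ p (K + 1) u) :=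
    hf.measurable.iterate a (measurableSet_nestedSet hf.measurable hφ p (K + 1) u)
  have hdec : I a - I (a + 1) = (z - 1) * (∑ κ ∈ Finset.range (K + 1),
      ∫ x in f^[a] ⁻¹' annulus f φ p κ u, exceedWeight f φ u w (a + 1) b x ∂P
      + ∫ x in f^[a] ⁻¹' nestedSet f φ p (K + 1) u, exceedWeight f φ u w (a + 1) b x ∂P) := by
    simp only [hI, meanWeight]
    rw [← integral_sub (hi _) (hi _)]
    simp_rw [exceedWeight_sub_succ w hEb, ← sum_indicator_annulus (f := f) (p := p) K, hza]
    rw [integral_const_mul]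
    congr 1
    simp_rw [← integral_indicator (hQ _), ← integral_indicator hN]
    rw [← integral_finsetSum _ fun κ _ => (hi _).indicator (hQ κ),
      ← integral_add (integrable_finsetSum _ fun κ _ => (hi _).indicator (hQ κ))
        ((hi _).indicator hN)]
    refine integral_congr_ae (Eventually.of_forall fun x => ?_)
    have key : ∀ S : Set X, (f^[a] ⁻¹' S).indicator (exceedWeight f φ u w (a + 1) b) x
        = S.indicator 1 (f^[a] x) * exceedWeight f φ u w (a + 1) b x := by
      intro S
      by_cases hx : f^[a] x ∈ S
      · simp [hx]
      · simp [hx]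
    simp only
    rw [add_mul, Finset.sum_mul, ← key]
    congr 1
    exact Finset.sum_congr rfl fun κ _ => (key _).symm
  set d := escapeSum P f φ p u (E + p) with hd
  set A := P.real (exceedSet φ u) with hA
  have hd0 : 0 ≤ d := escapeSum_nonneg _
  have hA0 : 0 ≤ A := measureReal_nonneg
  have hterm : ∀ κ ∈ Finset.range (K + 1),
      ‖∫ x in f^[a] ⁻¹' annulus f φ p κ u, exceedWeight f φ u w (a + 1) b x ∂P
        - z ^ κ * P.real (annulus f φ p κ u) * I (a + 1)‖
      ≤ 2 * ((K * p + 1) * d) + η + 2 * E * A ^ 2 := by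
    intro κ hκ
    have hκK : κ ≤ K := Nat.lt_succ_iff.1 (Finset.mem_range.1 hκ)
    have hκp : κ * p ≤ K * p := Nat.mul_le_mul_right p hκK
    have h1 := norm_integral_annulus_sub_le (P := P) (u := u) hf hφ hp hw (hκp.trans_lt hE) hb
      (fun i h1 h2 => hz i (by omega) h2) hz1
    have h2 := hmix κ hκK
    have h3 : ‖I (a + E) - I (a + 1)‖ ≤ 2 * E * A := by
      have := norm_meanWeight_sub_le (P := P) (u := u) hf hφ hw (a + 1) (E - 1) (b := b) (by omega)
      rw [show a + 1 + (E - 1) = a + E by omega, norm_sub_rev] at this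
      refine this.trans ?_
      have : ((E - 1 : ℕ) : ℝ) ≤ E := by exact_mod_cast Nat.sub_le _ _
      gcongr
    have hzk : ‖z ^ κ‖ ≤ 1 := by
      rw [norm_pow]
      exact pow_le_one₀ (norm_nonneg z) hz1
    have hQA : P.real (annulus f φ p κ u) ≤ A := measureReal_mono (annulus_subset_exceedSet κ)
    set q := P.real (annulus f φ p κ u)
    set J1 := ∫ x in f^[a] ⁻¹' annulus f φ p κ u, exceedWeight f φ u w (a + 1) b x ∂P
    set J2 := ∫ x in f^[a] ⁻¹' annulus f φ p κ u, exceedWeight f φ u w (a + E) b x ∂P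
    have hsplit : J1 - z ^ κ * q * I (a + 1) = (J1 - z ^ κ * J2)
        + z ^ κ * (J2 - q * I (a + E)) + z ^ κ * (q * (I (a + E) - I (a + 1))) := by ring
    have h4 : ‖z ^ κ * (J2 - q * I (a + E))‖ ≤ η := by
      rw [norm_mul]
      exact (mul_le_of_le_one_left (norm_nonneg _) hzk).trans h2
    have h5 : ‖z ^ κ * (q * (I (a + E) - I (a + 1)))‖ ≤ 2 * E * A ^ 2 := by
      rw [norm_mul, norm_mul, Complex.norm_real, Real.norm_eq_abs, abs_of_nonneg measureReal_nonneg]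
      refine (mul_le_of_le_one_left (by positivity) hzk).trans ?_
      calc q * ‖I (a + E) - I (a + 1)‖ ≤ A * (2 * E * A) := by gcongr
        _ = _ := by ring
    have h6 : 2 * ((κ * p + 1) * d) ≤ 2 * ((K * p + 1) * d) := by
      have : ((κ * p : ℕ) : ℝ) ≤ (K * p : ℕ) := by exact_mod_cast hκp
      push_cast at this
      gcongr
    rw [hsplit]
    refine (norm_add_le _ _).trans ((add_le_add_left (norm_add_le _ _) _).trans ?_)
    linarith
  have hnest : ‖∫ x in f^[a] ⁻¹' nestedSet f φ p (K + 1) u, exceedWeight f φ u w (a + 1) b x ∂P‖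
      ≤ P.real (nestedSet f φ p (K + 1) u) := by
    rw [← measureReal_iterate_preimage hf a (measurableSet_nestedSet hf.measurable hφ p (K + 1) u)]
    simpa using norm_setIntegral_le_of_norm_le_const (μ := P) (C := 1)
      (s := f^[a] ⁻¹' nestedSet f φ p (K + 1) u) (measure_lt_top _ _)
      (fun x _ => norm_exceedWeight_le hw (a + 1) b x)
  have hz2 : ‖z - 1‖ ≤ 2 := (norm_sub_le _ _).trans (by simpa using by linarith)
  have hfin : I a - I (a + 1) - (z - 1) * (∑ κ ∈ Finset.range (K + 1),
      z ^ κ * P.real (annulus f φ p κ u)) * I (a + 1)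
      = (z - 1) * (∫ x in f^[a] ⁻¹' nestedSet f φ p (K + 1) u, exceedWeight f φ u w (a + 1) b x ∂P
        + ∑ κ ∈ Finset.range (K + 1),
          (∫ x in f^[a] ⁻¹' annulus f φ p κ u, exceedWeight f φ u w (a + 1) b x ∂P
            - z ^ κ * P.real (annulus f φ p κ u) * I (a + 1))) := by
    rw [hdec, Finset.sum_sub_distrib, ← Finset.sum_mul]
    ring
  rw [hfin, norm_mul]
  refine mul_le_mul hz2 ?_ (norm_nonneg _) (by norm_num)
  refine (norm_add_le _ _).trans (add_le_add hnest ?_)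
  refine (norm_sum_le _ _).trans ((Finset.sum_le_sum hterm).trans ?_)
  rw [Finset.sum_const, Finset.card_range, nsmul_eq_mul]
  push_cast
  exact le_rfl

end FixedLevel

/-! ### From joint counts to mixing of weights -/

section Mixing

variable {X : Type*} {f : X → X} {φ : X → EReal} {p : ℕ} {u : EReal}

theorem exceedCard_mono {a a' b b' : ℕ} (ha : a' ≤ a) (hb : b ≤ b') (x : X) :
    exceedCard f φ u a b x ≤ exceedCard f φ u a' b' x := by
  classical
  exact Finset.card_le_card (Finset.filter_subset_filter _ (Finset.Ico_subset_Ico ha hb))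

variable [MeasurableSpace X] {P : Measure X} [IsProbabilityMeasure P]

/-- Markov's inequality, with the mean number of exceedances given by stationarity. -/
theorem measureReal_lt_exceedCard_le (hf : MeasurePreserving f P P) (hφ : Measurable φ)
    (a b R : ℕ) :
    P.real {x | R < exceedCard f φ u a b x} ≤ b * P.real (exceedSet φ u) / (R + 1) := by
  have hm := measurable_exceedCard hf.measurable hφ u a b
  have hint : Integrable (fun x => (exceedCard f φ u a b x : ℝ)) P := by
    refine Integrable.of_bound (C := ((b - a : ℕ) : ℝ))
      ((measurable_of_countable _).comp hm).aestronglyMeasurable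
      (Eventually.of_forall fun x => ?_)
    rw [Real.norm_eq_abs, Nat.abs_cast, Nat.cast_le]
    classical
    exact (Finset.card_filter_le _ _).trans (by simp)
  have h := mul_meas_ge_le_integral_of_nonneg (μ := P)
    (Eventually.of_forall fun x => Nat.cast_nonneg (exceedCard f φ u a b x)) hint ((R : ℝ) + 1)
  rw [integral_exceedCard hf hφ] at h
  rw [le_div_iff₀ (by positivity), mul_comm]
  have hset : {x | R < exceedCard f φ u a b x}
      = {x | (R : ℝ) + 1 ≤ exceedCard f φ u a b x} := by
    ext x
    simp only [mem_ofPred_eq]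
    exact_mod_cast Nat.lt_iff_add_one_le
  rw [hset]
  refine h.trans ?_
  gcongr
  exact Nat.sub_le _ _

/-- The weight is a bounded function of the counts in `M` intervals, while the hypothesis treats one
count vector at a time. It is summed over the `(R + 1) ^ M` vectors with entries at most `R`; larger
counts are rare by Markov's inequality, and their contribution keeps the factor `P(X_0 > u)` coming
from the annulus. -/
theorem norm_mixing_le (hf : MeasurePreserving f P P) (hφ : Measurable φ) {t : ℕ} {γ : ℝ}
    {κ₁ : ℕ} (hD : ∀ (m : ℕ) (a b : Fin m → ℝ) (κ : Fin m → ℕ), (∀ j, (t : ℝ) ≤ a j) →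
      Pairwise (fun i j => Disjoint (Ico (a i) (b i)) (Ico (a j) (b j))) →
      |P.real (annulus f φ p κ₁ u ∩ {x | ∀ j, exceedCount f φ u (Ico (a j) (b j)) x = κ j})
        - P.real (annulus f φ p κ₁ u) *
          P.real {x | ∀ j, exceedCount f φ u (Ico (a j) (b j)) x = κ j}| ≤ γ)
    {w ζ : ℕ → ℂ} {β : ℕ → ℕ} (hβ : Monotone β) {M a E : ℕ} (htE : t ≤ E) (hβ0 : β 0 ≤ a + E)
    (hβM : a + E ≤ β M) (hw : ∀ j < M, ∀ i, β j ≤ i → i < β (j + 1) → w i = ζ j)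
    (hζ : ∀ j, ‖ζ j‖ ≤ 1) (R : ℕ) :
    ‖∫ x in f^[a] ⁻¹' annulus f φ p κ₁ u, exceedWeight f φ u w (a + E) (β M) x ∂P
      - P.real (annulus f φ p κ₁ u) * meanWeight P f φ u w (a + E) (β M)‖
      ≤ 2 * (((R : ℝ) + 1) ^ M * γ) + 2 * (P.real (exceedSet φ u) *
        (β M * P.real (exceedSet φ u) / (R + 1))) := by
  -- The endpoints seen from time `a`: cells ending before `a + E` become empty, and the cell
  -- containing `a + E` is cut there.
  set α : ℕ → ℕ := fun j => max (a + E) (β j) - a with hα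
  have hαa : ∀ j, α j + a = max (a + E) (β j) := fun j =>
    Nat.sub_add_cancel ((Nat.le_add_right _ _).trans (le_max_left _ _))
  have hαE : ∀ j, E ≤ α j := fun j => by
    have := hαa j
    have := le_max_left (a + E) (β j)
    omega
  have hαm : Monotone α := fun i j hij => Nat.sub_le_sub_right (max_le_max le_rfl (hβ hij)) _
  let K : X → Fin M → ℕ := fun x j => exceedCard f φ u (α j) (α (j + 1)) x
  let W : (Fin M → ℕ) → ℂ := fun κ => ∏ j : Fin M, ζ j ^ κ j
  have hK : Measurable K :=
    measurable_pi_lambda _ fun j => measurable_exceedCard hf.measurable hφ u _ _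
  have hW : ∀ κ, ‖W κ‖ ≤ 1 := fun κ => by
    simp only [W]
    rw [norm_prod]
    refine Finset.prod_le_one (fun _ _ => norm_nonneg _) fun j _ => ?_
    rw [norm_pow]
    exact pow_le_one₀ (norm_nonneg _) (hζ _)
  have hWm : Measurable W := .of_discrete
  have hweight : ∀ x, exceedWeight f φ u w (a + E) (β M) x = W (K (f^[a] x)) := by
    intro x
    have h := exceedWeight_eq_prod (f := f) (φ := φ) (u := u) (w := w) (ζ := ζ)
      (α := fun j => α j + a) (fun i j hij => Nat.add_le_add_right (hαm hij) a) M
      (fun j hj i h1 h2 => by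
        simp only [hαa] at h1 h2
        refine hw j hj i ((le_max_right _ _).trans h1) ?_
        rcases lt_max_iff.1 h2 with h3 | h3
        · exact absurd ((le_max_left _ _).trans h1) (not_le.2 h3)
        · exact h3) x
    simp only [exceedCard_add] at h
    rw [hαa 0, hαa M, max_eq_left hβ0, max_eq_right hβM] at h
    rw [h, Finset.prod_range]
  have hmap := (hf.iterate a).map_eq
  have hQ := measurableSet_annulus hf.measurable hφ p κ₁ u
  have h1 : ∫ x in f^[a] ⁻¹' annulus f φ p κ₁ u, exceedWeight f φ u w (a + E) (β M) x ∂P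
      = ∫ y in annulus f φ p κ₁ u, W (K y) ∂P := by
    simp_rw [hweight]
    conv_rhs => rw [← hmap]
    rw [setIntegral_map (f := fun y => W (K y)) hQ (hWm.comp hK).aestronglyMeasurable (hf.measurable.iterate a).aemeasurable]
  have h2 : meanWeight P f φ u w (a + E) (β M) = ∫ y, W (K y) ∂P := by
    simp_rw [meanWeight, hweight]
    conv_rhs => rw [← hmap]
    rw [integral_map (φ := f^[a]) (f := fun y => W (K y)) (hf.measurable.iterate a).aemeasurable (hWm.comp hK).aestronglyMeasurable]
  rw [h1, h2]
  set F : Finset (Fin M → ℕ) := Fintype.piFinset fun _ => Finset.range (R + 1) with hF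
  refine (norm_covariance_le hK hQ hW F (γ := γ) fun κ _ => ?_).trans ?_
  · have h3 := hD M (fun j => (α j : ℝ)) (fun j => (α (j + 1) : ℝ)) κ
      (fun j => by exact_mod_cast htE.trans (hαE j)) ?_
    · have hset : {x | ∀ j : Fin M,
          exceedCount f φ u (Ico (α j : ℝ) (α (j + 1) : ℝ)) x = κ j} = K ⁻¹' {κ} := by
        ext x
        simp only [mem_ofPred_eq, exceedCount_Ico, Nat.cast_inj, mem_preimage,
          mem_singleton_iff, K, funext_iff]
      rwa [hset] at h3
    · have key : ∀ i j : Fin M, i < j → Disjoint (Ico (α i : ℝ) (α (i + 1) : ℝ))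
          (Ico (α j : ℝ) (α (j + 1) : ℝ)) := by
        intro i j hij
        rw [Set.Ico_disjoint_Ico]
        refine (min_le_left _ _).trans (le_trans ?_ (le_max_right _ _))
        exact_mod_cast hαm (Nat.succ_le_of_lt hij)
      intro i j hij
      rcases lt_or_gt_of_ne hij with h | h
      · exact key i j h
      · exact (key j i h).symm
  · have hcard : (F.card : ℝ) = ((R : ℝ) + 1) ^ M := by
      rw [hF, Fintype.card_piFinset]
      simp
    rw [hcard]
    have hq : P.real (annulus f φ p κ₁ u) ≤ P.real (exceedSet φ u) :=
      measureReal_mono (annulus_subset_exceedSet κ₁) (measure_ne_top _ _)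
    have hT : P.real (K ⁻¹' (F : Set (Fin M → ℕ))ᶜ)
        ≤ β M * P.real (exceedSet φ u) / (R + 1) := by
      refine (measureReal_mono (fun x hx => ?_) (measure_ne_top _ _)).trans
        (measureReal_lt_exceedCard_le (u := u) hf hφ 0 (β M) R)
      simp only [mem_preimage, mem_compl_iff, Finset.mem_coe, hF, Fintype.mem_piFinset,
        Finset.mem_range, not_forall, not_lt] at hx
      obtain ⟨j, hj⟩ := hx
      refine (Nat.lt_of_succ_le hj).trans_le (exceedCard_mono (Nat.zero_le _) ?_ x)
      refine (hαm (Nat.succ_le_of_lt j.2)).trans ?_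
      have := hαa M
      rw [max_eq_right hβM] at this
      omega
    have := mul_le_mul hq hT measureReal_nonneg measureReal_nonneg
    linarith

end Mixing

/-! ### The exponential recursion and its limit -/

section Recursion

/-- The remainder of the geometric series is `(z - 1) * θ / (1 - (1 - θ) z) * ((1 - θ) z) ^ (K +
1)`, and the denominator has modulus at least `θ`. -/
theorem norm_clusterExponent_add_le {θ : ℝ} (hθ0 : 0 < θ) (hθ1 : θ < 1) {z : ℂ} (hz : ‖z‖ ≤ 1)
    (K : ℕ) : ‖clusterExponent θ z
      - (z - 1) * ∑ κ ∈ Finset.range (K + 1), z ^ κ * ((θ * (1 - θ) ^ κ : ℝ) : ℂ)‖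
      ≤ 2 * (1 - θ) ^ (K + 1) := by
  have hne := one_sub_mul_ne_zero hθ0 hθ1 hz
  have hsum : ∑ κ ∈ Finset.range (K + 1), z ^ κ * ((θ * (1 - θ) ^ κ : ℝ) : ℂ)
      = θ * (1 - ((1 - θ) * z) ^ (K + 1)) / (1 - (1 - θ) * z) := by
    rw [eq_div_iff hne]
    have h1 : ∀ κ, z ^ κ * ((θ * (1 - θ) ^ κ : ℝ) : ℂ) = θ * ((1 - θ) * z) ^ κ := fun κ => by
      push_cast
      rw [mul_pow]
      ring
    simp_rw [h1]
    rw [← Finset.mul_sum, mul_assoc, geom_sum_mul_neg]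
  have hlow : θ ≤ ‖(1 - (1 - θ) * z : ℂ)‖ := by
    have h2 : ‖(1 - θ : ℂ) * z‖ ≤ 1 - θ := by
      rw [norm_mul, ← Complex.ofReal_one, ← Complex.ofReal_sub, Complex.norm_real,
        Real.norm_eq_abs, abs_of_pos (by linarith)]
      nlinarith [norm_nonneg z]
    have h3 := norm_sub_norm_le (1 : ℂ) ((1 - θ) * z)
    rw [norm_one] at h3
    linarith
  have heq : clusterExponent θ z
      - (z - 1) * (θ * (1 - ((1 - θ) * z) ^ (K + 1)) / (1 - (1 - θ) * z))
      = (z - 1) * ((θ / (1 - (1 - θ) * z)) * ((1 - θ) * z) ^ (K + 1)) := by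
    rw [clusterExponent]
    ring
  rw [hsum, heq, norm_mul, norm_mul, norm_div, Complex.norm_real, Real.norm_eq_abs,
    abs_of_pos hθ0]
  have h4 : ‖z - 1‖ ≤ 2 := (norm_sub_le _ _).trans (by simpa using by linarith)
  have h5 : θ / ‖(1 - (1 - θ) * z : ℂ)‖ ≤ 1 := by
    rw [div_le_one (hθ0.trans_le hlow)]
    exact hlow
  have h6 : ‖((1 - θ : ℂ) * z) ^ (K + 1)‖ ≤ (1 - θ) ^ (K + 1) := by
    rw [norm_pow]
    refine pow_le_pow_left₀ (norm_nonneg _) ?_ _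
    rw [norm_mul, ← Complex.ofReal_one, ← Complex.ofReal_sub, Complex.norm_real,
      Real.norm_eq_abs, abs_of_pos (by linarith)]
    nlinarith [norm_nonneg z]
  have h7 : θ / ‖(1 - (1 - θ) * z : ℂ)‖ * ‖((1 - θ : ℂ) * z) ^ (K + 1)‖ ≤ (1 - θ) ^ (K + 1) :=
    (mul_le_of_le_one_left (norm_nonneg _) h5).trans h6
  exact mul_le_mul h4 h7 (by positivity) (by norm_num)

/-- The exponent is `θ (ρ(z) - 1)` with `ρ(z) = θ z / (1 - (1 - θ) z)` of modulus at most `1`. Hence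
each step multiplies by a number of modulus at most `1`, and errors merely add up. -/
theorem clusterExponent_re_nonpos {θ : ℝ} (hθ0 : 0 < θ) (hθ1 : θ < 1) {z : ℂ} (hz : ‖z‖ ≤ 1) :
    (clusterExponent θ z).re ≤ 0 := by
  have hne := one_sub_mul_ne_zero hθ0 hθ1 hz
  have hlow : θ ≤ ‖(1 - (1 - θ) * z : ℂ)‖ := by
    have h2 : ‖(1 - θ : ℂ) * z‖ ≤ 1 - θ := by
      rw [norm_mul, ← Complex.ofReal_one, ← Complex.ofReal_sub, Complex.norm_real,
        Real.norm_eq_abs, abs_of_pos (by linarith)]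
      nlinarith [norm_nonneg z]
    have h3 := norm_sub_norm_le (1 : ℂ) ((1 - θ) * z)
    rw [norm_one] at h3
    linarith
  have heq : clusterExponent θ z = θ * (θ * z / (1 - (1 - θ) * z) - 1) := by
    rw [clusterExponent, div_sub_one hne, mul_div_assoc']
    congr 1
    ring
  rw [heq, Complex.re_ofReal_mul]
  refine mul_nonpos_of_nonneg_of_nonpos hθ0.le ?_
  rw [Complex.sub_re, Complex.one_re, sub_nonpos]
  refine (Complex.re_le_norm _).trans ?_
  rw [norm_div, norm_mul, Complex.norm_real, Real.norm_eq_abs, abs_of_pos hθ0,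
    div_le_one (hθ0.trans_le hlow)]
  nlinarith [norm_nonneg z]

theorem norm_sub_pow_mul_le {R : ℕ → ℂ} {q : ℂ} (hq : ‖q‖ ≤ 1) {ε : ℝ} (α m : ℕ)
    (h : ∀ a, α ≤ a → a < α + m → ‖R a - q * R (a + 1)‖ ≤ ε) :
    ‖R α - q ^ m * R (α + m)‖ ≤ m * ε := by
  induction m with
  | zero => simp
  | succ m ih =>
    have h1 := ih fun a ha hm => h a ha (by omega)
    have h2 := h (α + m) (by omega) (by omega)
    have h3 : R α - q ^ (m + 1) * R (α + (m + 1))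
        = (R α - q ^ m * R (α + m)) + q ^ m * (R (α + m) - q * R (α + m + 1)) := by
      rw [← add_assoc]
      ring
    rw [h3]
    refine (norm_add_le _ _).trans ?_
    rw [norm_mul, norm_pow]
    have h4 := pow_le_one₀ (norm_nonneg q) hq (n := m)
    have h5 : ‖q‖ ^ m * ‖R (α + m) - q * R (α + m + 1)‖ ≤ ε :=
      (mul_le_of_le_one_left (norm_nonneg _) h4).trans h2
    push_cast
    linarith

/-- Backward propagation of a limit through intervals of asymptotic length `h / π n`. -/
theorem tendsto_of_exp_recursion {R : ℕ → ℕ → ℂ} {π : ℕ → ℝ} {α β g : ℕ → ℕ} {c r : ℂ} {h : ℝ}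
    (hc : c.re ≤ 0) (hπ : ∀ᶠ n in atTop, 0 ≤ π n) (hαβ : ∀ n, α n ≤ β n)
    (hlen : Tendsto (fun n => ((β n - α n : ℕ) : ℝ) * π n) atTop (𝓝 h)) (hh : 0 < h)
    (hg : Tendsto (fun n => (g n : ℝ) * π n) atTop (𝓝 0))
    (hstep : ∀ δ > 0, ∀ᶠ n in atTop, ∀ a, α n ≤ a → a + g n ≤ β n →
      ‖R n a - Complex.exp (π n * c) * R n (a + 1)‖ ≤ δ * π n)
    (hend : ∀ᶠ n in atTop, g n ≤ β n → ‖R n (β n - g n) - R n (β n)‖ ≤ 2 * g n * π n)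
    (hr : Tendsto (fun n => R n (β n)) atTop (𝓝 r)) :
    Tendsto (fun n => R n (α n)) atTop (𝓝 (Complex.exp (h * c) * r)) := by
  have hgle : ∀ᶠ n in atTop, g n ≤ β n - α n := by
    have h1 := (hlen.sub hg).eventually (lt_mem_nhds (show (0 : ℝ) < h - 0 by simpa using hh))
    filter_upwards [h1, hπ] with n h1 h2
    by_contra hlt
    have h3 : ((β n - α n : ℕ) : ℝ) ≤ g n := by exact_mod_cast (not_le.1 hlt).le
    nlinarith
  -- The one-step estimate needs room `g n` before the end of the interval, so only `m n` steps use
  -- it; the last `g n` times are dropped at a cost of order `g n * π n`.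
  set m : ℕ → ℕ := fun n => β n - α n - g n with hm
  have hmlen : Tendsto (fun n => (m n : ℝ) * π n) atTop (𝓝 h) := by
    have h1 := hlen.sub hg
    rw [sub_zero] at h1
    refine h1.congr' ?_
    filter_upwards [hgle] with n hn
    simp only [hm]
    rw [Nat.cast_sub hn]
    ring
  have hq : ∀ᶠ n in atTop, ‖Complex.exp (π n * c)‖ ≤ 1 := by
    filter_upwards [hπ] with n hn
    rw [Complex.norm_exp, Complex.re_ofReal_mul, Real.exp_le_one_iff]
    exact mul_nonpos_of_nonneg_of_nonpos hn hc
  have h1 : Tendsto (fun n => R n (α n) - Complex.exp (π n * c) ^ m n * R n (β n - g n)) atTop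
      (𝓝 0) := by
    rw [Metric.tendsto_nhds]
    intro ε hε
    -- The total error is `m n * π n` times this number, and `m n * π n` is eventually below `h +
    -- 1`.
    have hδ : 0 < ε / (2 * (h + 1)) := by positivity
    filter_upwards [hstep _ hδ, hq, hgle, hπ,
      hmlen.eventually (gt_mem_nhds (show h < h + 1 by linarith))] with n h1 h2 h3 h4 h5
    have h6 := norm_sub_pow_mul_le (R := R n) h2 (α n) (m n)
      (fun a ha ham => h1 a ha (by simp only [hm] at ham; omega))
    have h7 : α n + m n = β n - g n := by simp only [hm]; have := hαβ n; omega
    rw [h7] at h6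
    rw [dist_zero_right]
    refine h6.trans_lt ?_
    calc (m n : ℝ) * (ε / (2 * (h + 1)) * π n) = (m n * π n) * (ε / (2 * (h + 1))) := by ring
      _ ≤ (h + 1) * (ε / (2 * (h + 1))) := by gcongr
      _ = ε / 2 := by field_simp
      _ < ε := by linarith
  have h2 : Tendsto (fun n => R n (β n - g n)) atTop (𝓝 r) := by
    have h3 : Tendsto (fun n => R n (β n - g n) - R n (β n)) atTop (𝓝 0) := by
      refine squeeze_zero_norm' (a := fun n => 2 * ((g n : ℝ) * π n)) ?_ (by simpa using hg.const_mul 2)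
      filter_upwards [hend, hgle] with n h3 h4
      exact (h3 (h4.trans (Nat.sub_le _ _))).trans (by linarith)
    simpa using h3.add hr
  have h3 : Tendsto (fun n => Complex.exp (π n * c) ^ m n) atTop (𝓝 (Complex.exp (h * c))) := by
    have h4 : Tendsto (fun n => Complex.exp (((m n * π n : ℝ) : ℂ) * c)) atTop
        (𝓝 (Complex.exp (h * c))) :=
      (Complex.continuous_exp.tendsto _).comp
        (((Complex.continuous_ofReal.tendsto _).comp hmlen).mul_const c)
    refine h4.congr fun n => ?_
    rw [← Complex.exp_nat_mul]
    push_cast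
    ring_nf
  have h4 := h1.add (h3.mul h2)
  simpa using h4

end Recursion

/-! ### Dyadic cells in integer time -/

section DyadicTimes

variable {X : Type*} {f : X → X} {φ : X → EReal} {u : EReal}

/-- The first integer time in the rescaled dyadic cell `v [j 2⁻ᵐ, (j + 1) 2⁻ᵐ)`. -/
noncomputable def dyadicTime (v : ℝ) (m j : ℕ) : ℕ := ⌈v * (j * dyadicMesh m)⌉₊

theorem dyadicTime_monotone {v : ℝ} (hv : 0 ≤ v) (m : ℕ) : Monotone (dyadicTime v m) := by
  intro i j hij
  refine Nat.ceil_le_ceil ?_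
  gcongr

theorem dyadicTime_zero (v : ℝ) (m : ℕ) : dyadicTime v m 0 = 0 := by
  simp [dyadicTime]

/-- For an integer `i`, `v s ≤ i` means `⌈v s⌉ ≤ i`, so the half-open rescaled cell contains exactly
the integers between the two ceilings. -/
theorem rescaledExceedMeasure_cell {v : ℝ} (hv : 0 < v) (x : X) (m j : ℕ) :
    rescaledExceedMeasure f φ u v x (cell (dyadicMesh m) j)
      = exceedCard f φ u (dyadicTime v m j) (dyadicTime v m (j + 1)) x := by
  have h : exceedCount f φ u ((fun s : ℝ≥0 => v * (s : ℝ)) '' cell (dyadicMesh m) j) x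
      = exceedCount f φ u (Ico (dyadicTime v m j : ℝ) (dyadicTime v m (j + 1) : ℝ)) x := by
    unfold exceedCount
    congr 1
    ext i
    simp only [mem_ofPred_eq]
    refine and_congr_left fun _ => ?_
    rw [mem_Ico, Nat.cast_le, Nat.cast_lt, dyadicTime, dyadicTime, Nat.ceil_le, Nat.lt_ceil]
    constructor
    · rintro ⟨s, hs, hi⟩
      simp only at hi
      rw [← hi]
      have h1 := NNReal.coe_le_coe.2 hs.1
      have h2 := NNReal.coe_lt_coe.2 hs.2
      push_cast at h1 h2 ⊢
      exact ⟨by gcongr, by gcongr⟩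
    · rintro ⟨h1, h2⟩
      refine ⟨(i : ℝ≥0) / v.toNNReal, ⟨?_, ?_⟩, ?_⟩
      · rw [← NNReal.coe_le_coe]
        push_cast
        rw [Real.coe_toNNReal v hv.le, le_div_iff₀ hv]
        linarith
      · rw [← NNReal.coe_lt_coe]
        push_cast at h2 ⊢
        rw [Real.coe_toNNReal v hv.le, div_lt_iff₀ hv]
        linarith
      · push_cast
        rw [Real.coe_toNNReal v hv.le]
        field_simp
  rw [rescaledExceedMeasure_apply _ _ _ hv _ (measurableSet_cell _ _), h, exceedCount_Ico]
  simp

variable [MeasurableSpace X] {P : Measure X}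

open Classical in
/-- The masses of the dyadic cells under the rare event point process. -/
noncomputable def rareEventCounts (P : Measure X) (f : X → X) (φ : X → EReal) (u : EReal) (m : ℕ)
    (x : X) : Fin (m * 2 ^ m) → ℕ := fun j =>
  if 0 < 1 / P.real (exceedSet φ u) then
    exceedCard f φ u (dyadicTime (1 / P.real (exceedSet φ u)) m j)
      (dyadicTime (1 / P.real (exceedSet φ u)) m (j + 1)) x
  else 0

theorem hasDyadicCounts_rareEventPointProcess [IsProbabilityMeasure P] (hf : Measurable f)
    (hφ : Measurable φ) :
    HasDyadicCounts (rareEventPointProcess P f φ u) (rareEventCounts P f φ u) where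
  measurable m := by
    refine measurable_pi_lambda _ fun j => ?_
    by_cases hv : 0 < 1 / P.real (exceedSet φ u)
    · simp only [rareEventCounts, if_pos hv]
      exact measurable_exceedCard hf hφ u _ _
    · simp only [rareEventCounts, if_neg hv]
      exact measurable_const
  apply_cell m x j := by
    by_cases hv : 0 < 1 / P.real (exceedSet φ u)
    · have h : (rareEventPointProcess P f φ u x).1
          = rescaledExceedMeasure f φ u (1 / P.real (exceedSet φ u)) x :=
        congrArg Subtype.val (dif_pos hv)
      rw [h, rescaledExceedMeasure_cell hv, rareEventCounts, if_pos hv]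
    · have h : (rareEventPointProcess P f φ u x).1 = 0 :=
        congrArg Subtype.val (dif_neg hv)
      rw [h, rareEventCounts, if_neg hv]
      simp

end DyadicTimes

/-! ### The recursion along the levels `u n` -/

section Levels

variable {X : Type*} [MeasurableSpace X] {P : Measure X} [IsProbabilityMeasure P]
  {f : X → X} {φ : X → EReal} {p : ℕ}

theorem norm_meanWeight_le {u : EReal} {w : ℕ → ℂ} (hw : ∀ i, ‖w i‖ ≤ 1) (a b : ℕ) :
    ‖meanWeight P f φ u w a b‖ ≤ 1 := by
  simpa [meanWeight] using norm_integral_le_of_norm_le_const (μ := P)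
    (Eventually.of_forall fun x => norm_exceedWeight_le (f := f) (φ := φ) (u := u) hw a b x)

/-- Replacing a two term recursion with approximate rate by an exponential one. -/
theorem norm_sub_exp_mul_le {x y S c : ℂ} {π e₁ e₂ e₃ : ℝ} (hy : ‖y‖ ≤ 1) (hπ : 0 ≤ π)
    (hπc : π * ‖c‖ ≤ 1) {S' : ℂ} (h₁ : ‖x - y - S * y‖ ≤ e₁) (h₂ : ‖S - π * S'‖ ≤ e₂)
    (h₃ : ‖c - S'‖ ≤ e₃) :
    ‖x - Complex.exp (π * c) * y‖ ≤ e₁ + e₂ + π * e₃ + (π * ‖c‖) ^ 2 := by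
  have hn : ‖(π * c : ℂ)‖ = π * ‖c‖ := by
    rw [norm_mul, Complex.norm_real, Real.norm_eq_abs, abs_of_nonneg hπ]
  have h4 : ‖Complex.exp (π * c) - 1 - π * c‖ ≤ (π * ‖c‖) ^ 2 := by
    rw [← hn]
    exact Complex.norm_exp_sub_one_sub_id_le (hn.trans_le hπc)
  have h5 : x - Complex.exp (π * c) * y = (x - y - S * y) + ((S - π * S') - π * (c - S')
      - (Complex.exp (π * c) - 1 - π * c)) * y := by ring
  rw [h5]
  refine (norm_add_le _ _).trans ?_
  have h6 : ‖(S - π * S') - π * (c - S') - (Complex.exp (π * c) - 1 - π * c)‖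
      ≤ e₂ + π * e₃ + (π * ‖c‖) ^ 2 := by
    refine (norm_sub_le _ _).trans (add_le_add ((norm_sub_le _ _).trans (add_le_add h₂ ?_)) h4)
    rw [norm_mul, Complex.norm_real, Real.norm_eq_abs, abs_of_nonneg hπ]
    gcongr
  rw [norm_mul]
  have h7 := mul_le_of_le_one_right (norm_nonneg ((S - π * S') - π * (c - S')
    - (Complex.exp (π * c) - 1 - π * c))) hy
  linarith

variable {θ : ℝ} {u : ℕ → EReal} {t g : ℕ → ℕ} {γ : ℕ → ℝ} {w : ℕ → ℕ → ℂ} {ζ : ℕ → ℂ}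
  {β : ℕ → ℕ → ℕ} {M : ℕ}

/-- The parameters are chosen in the order `K`, `R`, `n`: `K` makes deep chains negligible, `R`,
depending on `K`, does so for large counts, and every other error divided by `π n` tends to `0` for
fixed `K` and `R`. -/
theorem eventually_norm_meanWeight_sub_exp_le (hf : MeasurePreserving f P P) (hφ : Measurable φ)
    (hp : 0 < p) (hθ0 : 0 < θ) (hθ1 : θ < 1)
    (hpos : ∀ᶠ n in atTop, 0 < P.real (exceedSet φ (u n)))
    (hzero : Tendsto (fun n => P.real (exceedSet φ (u n))) atTop (𝓝 0))
    (hnest : ∀ κ, Tendsto (fun n => P.real (nestedSet f φ p κ (u n)) / P.real (exceedSet φ (u n)))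
      atTop (𝓝 ((1 - θ) ^ κ)))
    (hann : ∀ κ, Tendsto (fun n => P.real (annulus f φ p κ (u n)) / P.real (exceedSet φ (u n)))
      atTop (𝓝 (θ * (1 - θ) ^ κ)))
    (hD : ∀ (n κ₁ m : ℕ) (a b : Fin m → ℝ) (κ : Fin m → ℕ), (∀ j, (t n : ℝ) ≤ a j) →
      Pairwise (fun i j => Disjoint (Ico (a i) (b i)) (Ico (a j) (b j))) →
      |P.real (annulus f φ p κ₁ (u n) ∩ {x | ∀ j, exceedCount f φ (u n) (Ico (a j) (b j)) x = κ j})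
        - P.real (annulus f φ p κ₁ (u n)) *
          P.real {x | ∀ j, exceedCount f φ (u n) (Ico (a j) (b j)) x = κ j}| ≤ γ n)
    (hγ : Tendsto (fun n => γ n / P.real (exceedSet φ (u n))) atTop (𝓝 0))
    (hg : Tendsto (fun n => g n * P.real (exceedSet φ (u n))) atTop (𝓝 0))
    (hgt : ∀ E : ℕ, ∀ᶠ n in atTop, t n + E ≤ g n)
    (hesc : Tendsto (fun n => escapeSum P f φ p (u n) (g n) / P.real (exceedSet φ (u n))) atTop
      (𝓝 0))
    (hw : ∀ n i, ‖w n i‖ ≤ 1) (hζ : ∀ j, ‖ζ j‖ ≤ 1) (hβ : ∀ n, Monotone (β n))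
    (hβ0 : ∀ n, β n 0 = 0)
    (hwβ : ∀ᶠ n in atTop, ∀ j < M, ∀ i, β n j ≤ i → i < β n (j + 1) → w n i = ζ j)
    {H : ℝ} (hH : ∀ᶠ n in atTop, β n M * P.real (exceedSet φ (u n)) ≤ H)
    {j : ℕ} (hj : j < M) {δ : ℝ} (hδ : 0 < δ) :
    ∀ᶠ n in atTop, ∀ a, β n j ≤ a → a + g n ≤ β n (j + 1) →
      ‖meanWeight P f φ (u n) (w n) a (β n M)
        - Complex.exp (P.real (exceedSet φ (u n)) * clusterExponent θ (ζ j))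
          * meanWeight P f φ (u n) (w n) (a + 1) (β n M)‖ ≤ δ * P.real (exceedSet φ (u n)) := by
  set c := clusterExponent θ (ζ j) with hc
  set π : ℕ → ℝ := fun n => P.real (exceedSet φ (u n)) with hπ
  have hH0 : 0 ≤ H := by
    obtain ⟨n, hn⟩ := hH.exists
    exact le_trans (by positivity) hn
  -- The term `(1 - θ) ^ (K + 1)` occurs with total coefficient `4`: from the nested set and from
  -- the tail of the exponent. It may use up half of `δ`.
  obtain ⟨K, hK⟩ : ∃ K : ℕ, (1 - θ) ^ (K + 1) < δ / 8 := by
    have h1 := (tendsto_pow_atTop_nhds_zero_of_lt_one (r := 1 - θ) (by linarith)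
      (by linarith)).comp (tendsto_add_atTop_nat 1)
    exact (h1.eventually (gt_mem_nhds (show (0 : ℝ) < δ / 8 by positivity))).exists
  obtain ⟨R, hR⟩ : ∃ R : ℕ, 4 * (K + 1) * (H / (R + 1)) < δ / 2 := by
    have h1 : Tendsto (fun R : ℕ => 4 * ((K : ℝ) + 1) * (H / (R + 1))) atTop (𝓝 0) := by
      have := (tendsto_one_div_add_atTop_nhds_zero_nat (𝕜 := ℝ)).const_mul
        (4 * ((K : ℝ) + 1) * H)
      rw [mul_zero] at this
      refine this.congr fun R => ?_
      ring
    exact (h1.eventually (gt_mem_nhds (show (0 : ℝ) < δ / 2 by positivity))).exists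
  -- The whole one-step error divided by `π n`.
  set Φ : ℕ → ℝ := fun n =>
    2 * (P.real (nestedSet f φ p (K + 1) (u n)) / π n + (K + 1) *
      (2 * ((K * p + 1) * (escapeSum P f φ p (u n) (g n) / π n))
        + (2 * (((R : ℝ) + 1) ^ M * (γ n / π n)) + 2 * (H / (R + 1))) + 2 * (g n * π n)))
    + 2 * ∑ κ ∈ Finset.range (K + 1),
        |P.real (annulus f φ p κ (u n)) / π n - θ * (1 - θ) ^ κ|
    + 2 * (1 - θ) ^ (K + 1) + π n * ‖c‖ ^ 2 with hΦ
  have hΦlim : Tendsto Φ atTop (𝓝 (2 * ((1 - θ) ^ (K + 1) + (K + 1) *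
      (2 * ((K * p + 1) * 0) + (2 * (((R : ℝ) + 1) ^ M * 0) + 2 * (H / (R + 1))) + 2 * 0))
      + 2 * ∑ κ ∈ Finset.range (K + 1), |θ * (1 - θ) ^ κ - θ * (1 - θ) ^ κ|
      + 2 * (1 - θ) ^ (K + 1) + 0 * ‖c‖ ^ 2)) := by
    refine ((((hnest (K + 1)).add (((((hesc.const_mul _).const_mul _).add
      (((hγ.const_mul _).const_mul _).add_const _)).add (hg.const_mul _)).const_mul _)).const_mul
      _).add ((tendsto_finsetSum _ fun κ _ => ((hann κ).sub_const _).abs).const_mul _)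
      |>.add_const _).add (hzero.mul_const _)
  have hlt : 2 * ((1 - θ) ^ (K + 1) + (K + 1) *
      (2 * ((K * p + 1) * 0) + (2 * (((R : ℝ) + 1) ^ M * 0) + 2 * (H / (R + 1))) + 2 * 0))
      + 2 * ∑ κ ∈ Finset.range (K + 1), |θ * (1 - θ) ^ κ - θ * (1 - θ) ^ κ|
      + 2 * (1 - θ) ^ (K + 1) + 0 * ‖c‖ ^ 2 < δ := by
    simp only [sub_self, abs_zero, Finset.sum_const_zero]
    linarith
  have hπc : ∀ᶠ n in atTop, π n * ‖c‖ < 1 :=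
    (hzero.mul_const ‖c‖).eventually (gt_mem_nhds (by simp))
  filter_upwards [hΦlim.eventually (gt_mem_nhds hlt), hpos, hH, hgt (K * p + 1 + p), hwβ, hπc]
    with n hΦn hposn hHn hgn hwn hπcn a ha hag
  change 0 < π n at hposn
  have hβM : β n (j + 1) ≤ β n M := hβ n hj
  -- Long enough to contain a chain of depth `K` and to leave a gap of at least `t n`; `E + p` still
  -- fits into the horizon `g n` of the escape sum.
  set E := t n + K * p + 1 with hE
  have hEg : E + p ≤ g n := by omega
  have hmix : ∀ κ ≤ K, ‖∫ x in f^[a] ⁻¹' annulus f φ p κ (u n),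
      exceedWeight f φ (u n) (w n) (a + E) (β n M) x ∂P
      - P.real (annulus f φ p κ (u n)) * meanWeight P f φ (u n) (w n) (a + E) (β n M)‖
      ≤ 2 * (((R : ℝ) + 1) ^ M * γ n) + 2 * (π n * (H / (R + 1))) := by
    intro κ _
    refine (norm_mixing_le hf hφ (hD n κ) (hβ n) (by omega) (by rw [hβ0]; omega) (by omega) hwn hζ
      R).trans ?_
    gcongr
  have h₁ := norm_meanWeight_step_le (P := P) (u := u n) hf hφ hp (hw n) (K := K) (E := E)
    (a := a) (b := β n M) (by omega) (by omega) (z := ζ j)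
    (fun i h1 h2 => hwn j hj i (by omega) (by omega)) hmix
  have h₂ : ‖(ζ j - 1) * (∑ κ ∈ Finset.range (K + 1), ζ j ^ κ * P.real (annulus f φ p κ (u n)))
      - π n * ((ζ j - 1) * ∑ κ ∈ Finset.range (K + 1), ζ j ^ κ * ((θ * (1 - θ) ^ κ : ℝ) : ℂ))‖
      ≤ 2 * ∑ κ ∈ Finset.range (K + 1),
        |P.real (annulus f φ p κ (u n)) - π n * (θ * (1 - θ) ^ κ)| := by
    have h3 : (ζ j - 1) * (∑ κ ∈ Finset.range (K + 1), ζ j ^ κ * P.real (annulus f φ p κ (u n)))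
        - π n * ((ζ j - 1) * ∑ κ ∈ Finset.range (K + 1), ζ j ^ κ * ((θ * (1 - θ) ^ κ : ℝ) : ℂ))
        = (ζ j - 1) * ∑ κ ∈ Finset.range (K + 1), ζ j ^ κ *
          ((P.real (annulus f φ p κ (u n)) - π n * (θ * (1 - θ) ^ κ) : ℝ) : ℂ) := by
      push_cast
      simp_rw [mul_sub]
      rw [Finset.sum_sub_distrib, mul_sub, mul_left_comm, Finset.mul_sum (a := (π n : ℂ))]
      congr 2
      refine Finset.sum_congr rfl fun κ _ => ?_
      ring
    rw [h3, norm_mul]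
    refine mul_le_mul ((norm_sub_le _ _).trans (by simpa using by linarith [hζ j])) ?_
      (norm_nonneg _) (by norm_num)
    refine (norm_sum_le _ _).trans (Finset.sum_le_sum fun κ _ => ?_)
    rw [norm_mul, norm_pow, Complex.norm_real, Real.norm_eq_abs]
    exact mul_le_of_le_one_left (abs_nonneg _) (pow_le_one₀ (norm_nonneg _) (hζ j))
  refine (norm_sub_exp_mul_le (norm_meanWeight_le (hw n) _ _) hposn.le hπcn.le h₁ h₂
    (norm_clusterExponent_add_le hθ0 hθ1 (hζ j) K)).trans ?_
  have hsum : ∑ κ ∈ Finset.range (K + 1),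
      |P.real (annulus f φ p κ (u n)) - π n * (θ * (1 - θ) ^ κ)|
      = π n * ∑ κ ∈ Finset.range (K + 1),
        |P.real (annulus f φ p κ (u n)) / π n - θ * (1 - θ) ^ κ| := by
    rw [Finset.mul_sum]
    refine Finset.sum_congr rfl fun κ _ => ?_
    conv_rhs => enter [1]; rw [← abs_of_pos hposn]
    rw [← abs_mul, mul_sub, mul_div_cancel₀ _ hposn.ne']
  have hesc' : escapeSum P f φ p (u n) (E + p) ≤ escapeSum P f φ p (u n) (g n) :=
    escapeSum_mono hEg
  have hE' : (E : ℝ) ≤ g n := by exact_mod_cast (by omega : E ≤ g n)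
  calc _ ≤ 2 * (P.real (nestedSet f φ p (K + 1) (u n)) + (K + 1) *
      (2 * ((K * p + 1) * escapeSum P f φ p (u n) (g n))
        + (2 * (((R : ℝ) + 1) ^ M * γ n) + 2 * (π n * (H / (R + 1)))) + 2 * g n * π n ^ 2))
    + 2 * (π n * ∑ κ ∈ Finset.range (K + 1),
        |P.real (annulus f φ p κ (u n)) / π n - θ * (1 - θ) ^ κ|)
    + π n * (2 * (1 - θ) ^ (K + 1)) + (π n * ‖c‖) ^ 2 := by
        rw [hsum]
        gcongr
    _ = Φ n * π n := by
        have hne := hposn.ne'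
        simp only [hΦ]
        field_simp
    _ ≤ δ * π n := by gcongr

/-- Backward induction over the cells, starting from the empty product at the right end; each cell
contributes one exponential factor. -/
theorem tendsto_meanWeight (hf : MeasurePreserving f P P) (hφ : Measurable φ)
    (hp : 0 < p) (hθ0 : 0 < θ) (hθ1 : θ < 1)
    (hpos : ∀ᶠ n in atTop, 0 < P.real (exceedSet φ (u n)))
    (hzero : Tendsto (fun n => P.real (exceedSet φ (u n))) atTop (𝓝 0))
    (hnest : ∀ κ, Tendsto (fun n => P.real (nestedSet f φ p κ (u n)) / P.real (exceedSet φ (u n)))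
      atTop (𝓝 ((1 - θ) ^ κ)))
    (hann : ∀ κ, Tendsto (fun n => P.real (annulus f φ p κ (u n)) / P.real (exceedSet φ (u n)))
      atTop (𝓝 (θ * (1 - θ) ^ κ)))
    (hD : ∀ (n κ₁ m : ℕ) (a b : Fin m → ℝ) (κ : Fin m → ℕ), (∀ j, (t n : ℝ) ≤ a j) →
      Pairwise (fun i j => Disjoint (Ico (a i) (b i)) (Ico (a j) (b j))) →
      |P.real (annulus f φ p κ₁ (u n) ∩ {x | ∀ j, exceedCount f φ (u n) (Ico (a j) (b j)) x = κ j})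
        - P.real (annulus f φ p κ₁ (u n)) *
          P.real {x | ∀ j, exceedCount f φ (u n) (Ico (a j) (b j)) x = κ j}| ≤ γ n)
    (hγ : Tendsto (fun n => γ n / P.real (exceedSet φ (u n))) atTop (𝓝 0))
    (hg : Tendsto (fun n => g n * P.real (exceedSet φ (u n))) atTop (𝓝 0))
    (hgt : ∀ E : ℕ, ∀ᶠ n in atTop, t n + E ≤ g n)
    (hesc : Tendsto (fun n => escapeSum P f φ p (u n) (g n) / P.real (exceedSet φ (u n))) atTop
      (𝓝 0))
    (hw : ∀ n i, ‖w n i‖ ≤ 1) (hζ : ∀ j, ‖ζ j‖ ≤ 1) (hβ : ∀ n, Monotone (β n))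
    (hβ0 : ∀ n, β n 0 = 0)
    (hwβ : ∀ᶠ n in atTop, ∀ j < M, ∀ i, β n j ≤ i → i < β n (j + 1) → w n i = ζ j)
    {h : ℝ} (hh : 0 < h)
    (hlen : ∀ j, Tendsto (fun n => β n j * P.real (exceedSet φ (u n))) atTop (𝓝 (j * h))) :
    Tendsto (fun n => meanWeight P f φ (u n) (w n) 0 (β n M)) atTop
      (𝓝 (∏ j ∈ Finset.range M, Complex.exp (h * clusterExponent θ (ζ j)))) := by
  have hH : ∀ᶠ n in atTop, β n M * P.real (exceedSet φ (u n)) ≤ M * h + 1 :=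
    ((hlen M).eventually (gt_mem_nhds (lt_add_one _))).mono fun n hn => hn.le
  have key : Tendsto (fun n => meanWeight P f φ (u n) (w n) (β n 0) (β n M)) atTop
      (𝓝 (∏ j ∈ Finset.Ico 0 M, Complex.exp (h * clusterExponent θ (ζ j)))) := by
    refine Nat.decreasingInduction' (P := fun i =>
      Tendsto (fun n => meanWeight P f φ (u n) (w n) (β n i) (β n M)) atTop
        (𝓝 (∏ j ∈ Finset.Ico i M, Complex.exp (h * clusterExponent θ (ζ j)))))
      (fun i hi _ ih => ?_) M.zero_le ?_
    · rw [Finset.prod_eq_prod_Ico_succ_bot hi]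
      refine tendsto_of_exp_recursion (g := g)
        (R := fun n a => meanWeight P f φ (u n) (w n) a (β n M)) (π := fun n =>
          P.real (exceedSet φ (u n))) (clusterExponent_re_nonpos hθ0 hθ1 (hζ i))
        (hpos.mono fun _ h => h.le) (fun n => hβ n i.le_succ) ?_ hh hg
        (fun δ hδ => eventually_norm_meanWeight_sub_exp_le hf hφ hp hθ0 hθ1 hpos hzero hnest hann
          hD hγ hg hgt hesc hw hζ hβ hβ0 hwβ hH hi hδ) ?_ ih
      · have h1 := (hlen (i + 1)).sub (hlen i)
        have h2 : ((i + 1 : ℕ) : ℝ) * h - i * h = h := by push_cast; ring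
        rw [h2] at h1
        refine h1.congr fun n => ?_
        rw [Nat.cast_sub (hβ n i.le_succ)]
        ring
      · refine Eventually.of_forall fun n hn => ?_
        have h1 := norm_meanWeight_sub_le (P := P) (u := u n) hf hφ (hw n) (β n (i + 1) - g n)
          (g n) (b := β n M) (by rw [Nat.sub_add_cancel hn]; exact hβ n hi)
        rwa [Nat.sub_add_cancel hn] at h1
    · simp [meanWeight, exceedWeight_self]
  simpa [hβ0] using key

end Levels

/-! ### Asymptotics of levels, gaps and cell endpoints -/

section Asymptotics

theorem tendsto_div_of_tendsto_mul {a π : ℕ → ℝ} {s τ : ℝ} (hτ : τ ≠ 0)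
    (ha : Tendsto (fun n : ℕ => n * a n) atTop (𝓝 s))
    (hπ : Tendsto (fun n : ℕ => n * π n) atTop (𝓝 τ)) :
    Tendsto (fun n => a n / π n) atTop (𝓝 (s / τ)) := by
  refine (ha.div hπ hτ).congr' ?_
  filter_upwards [eventually_ne_atTop 0] with n hn
  exact mul_div_mul_left _ _ (Nat.cast_ne_zero.2 hn)

theorem tendsto_natDiv_div {k : ℕ → ℕ} (hk : Tendsto k atTop atTop) :
    Tendsto (fun n : ℕ => ((n / k n : ℕ) : ℝ) / n) atTop (𝓝 0) := by
  refine squeeze_zero (fun n => by positivity) (fun n => ?_)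
    (tendsto_inv_atTop_zero.comp (tendsto_natCast_atTop_atTop.comp hk))
  simp only [Function.comp]
  rcases Nat.eq_zero_or_pos n with rfl | hn
  · simp
  · have hn' : (0 : ℝ) < n := by exact_mod_cast hn
    rw [div_le_iff₀ hn', mul_comm, ← div_eq_mul_inv]
    exact Nat.cast_div_le

/-- Positivity of `t n` lets the additive constant be absorbed: `t n + E ≤ (E + 1) * t n`, and `k n
* t n = o(n)` does the rest. -/
theorem eventually_add_le_natDiv {k t : ℕ → ℕ} (hk : Tendsto k atTop atTop)
    (hkt : (fun n => (k n : ℝ) * (t n : ℝ)) =o[atTop] (fun n => (n : ℝ)))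
    (ht : ∀ᶠ n in atTop, 0 < t n) (E : ℕ) : ∀ᶠ n in atTop, t n + E ≤ n / k n := by
  filter_upwards [hkt.def (show (0 : ℝ) < 1 / (E + 1) by positivity), ht,
    hk.eventually (eventually_gt_atTop 0)] with n h1 h2 h3
  rw [Nat.le_div_iff_mul_le h3]
  rw [Real.norm_eq_abs, Real.norm_eq_abs, Nat.abs_cast, abs_of_nonneg (by positivity),
    one_div, inv_mul_eq_div, le_div_iff₀ (by positivity)] at h1
  have h4 : k n * t n * (E + 1) ≤ n := by exact_mod_cast h1
  refine le_trans ?_ h4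
  calc (t n + E) * k n ≤ (t n + E * t n) * k n := by
        gcongr
        exact Nat.le_mul_of_pos_right E h2
    _ = k n * t n * (E + 1) := by ring

theorem exceedSet_antitone {X : Type*} {φ : X → EReal} {a b : EReal} (h : a ≤ b) :
    exceedSet φ b ⊆ exceedSet φ a :=
  fun _ hx => lt_of_le_of_lt h hx

variable {X : Type*} [MeasurableSpace X] {P : Measure X} [IsProbabilityMeasure P]
  {f : X → X} {φ : X → EReal} {p : ℕ}

/-- Levels whose exceedance probabilities are positive and tend to `0` approach the maximum from
below. -/
theorem tendsto_nhdsLT_of_tendsto_measureReal {ζ : X} (hmax : ∀ x, φ x ≤ φ ζ)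
    (hnear : ∀ᶠ v in 𝓝[<] (φ ζ), 0 < P.real (exceedSet φ v)) {u : ℕ → EReal}
    (hpos : ∀ᶠ n in atTop, 0 < P.real (exceedSet φ (u n)))
    (hzero : Tendsto (fun n => P.real (exceedSet φ (u n))) atTop (𝓝 0)) :
    Tendsto u atTop (𝓝[<] (φ ζ)) := by
  have hlt : ∀ᶠ n in atTop, u n < φ ζ := by
    filter_upwards [hpos] with n hn
    by_contra hle
    have hempty : exceedSet φ (u n) = ∅ :=
      eq_empty_of_forall_notMem fun x hx => hle (lt_of_lt_of_le hx (hmax x))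
    simp [hempty] at hn
  refine tendsto_nhdsWithin_iff.2 ⟨tendsto_order.2 ⟨fun a ha => ?_, fun a ha => ?_⟩, hlt⟩
  · obtain ⟨l, hl, hsub⟩ := (mem_nhdsLT_iff_exists_Ioo_subset' ha).1 hnear
    obtain ⟨b, hb1, hb2⟩ := exists_between (max_lt ha hl)
    have hb : 0 < P.real (exceedSet φ b) := hsub ⟨(le_max_right _ _).trans_lt hb1, hb2⟩
    filter_upwards [hzero.eventually (gt_mem_nhds hb)] with n hn
    refine ((le_max_left a l).trans_lt hb1).trans_le (le_of_not_ge fun hle => ?_)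
    exact absurd (measureReal_mono (exceedSet_antitone hle) (measure_ne_top P _)) (not_le.2 hn)
  · exact hlt.mono fun n hn => hn.trans ha

theorem measureReal_annulus (hf : Measurable f) (hφ : Measurable φ) (κ : ℕ) (u : EReal) :
    P.real (annulus f φ p κ u)
      = P.real (nestedSet f φ p κ u) - P.real (nestedSet f φ p (κ + 1) u) :=
  measureReal_sdiff (nestedSet_antitone κ.le_succ) (measurableSet_nestedSet hf hφ p (κ + 1) u)

/-- A gap of length `0` decouples an escape only with a non-negligible error. -/
theorem measureReal_annulus_mul_le (hφ : Measurable φ) {u : EReal} {γ : ℝ}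
    (hD : ∀ (m : ℕ) (a b : Fin m → ℝ) (κ : Fin m → ℕ), (∀ j, 0 ≤ a j) →
      Pairwise (fun i j => Disjoint (Ico (a i) (b i)) (Ico (a j) (b j))) →
      |P.real (annulus f φ p 0 u ∩ {x | ∀ j, exceedCount f φ u (Ico (a j) (b j)) x = κ j})
        - P.real (annulus f φ p 0 u) *
          P.real {x | ∀ j, exceedCount f φ u (Ico (a j) (b j)) x = κ j}| ≤ γ) :
    P.real (annulus f φ p 0 u) * (1 - P.real (exceedSet φ u)) ≤ γ := by
  -- Test against having no exceedance at time `0`: the annulus lies in the exceedance set, so the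
  -- intersection is empty and the error is the full product of the probabilities.
  have h := hD 1 (fun _ => ((0 : ℕ) : ℝ)) (fun _ => ((1 : ℕ) : ℝ)) (fun _ => 0) (by simp)
    (fun i j hij => absurd (Subsingleton.elim i j) hij)
  have hset : {x | ∀ _ : Fin 1, exceedCount f φ u (Ico ((0 : ℕ) : ℝ) ((1 : ℕ) : ℝ)) x
      = ((0 : ℕ) : ℕ∞)} = (exceedSet φ u)ᶜ := by
    ext x
    simp only [mem_ofPred_eq, exceedCount_Ico, Nat.cast_inj, forall_const, exceedCard,
      Finset.card_eq_zero, Finset.filter_eq_empty_iff, Finset.mem_Ico, mem_compl_iff]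
    refine ⟨fun h => h (x := 0) ⟨le_rfl, one_pos⟩, fun h i hi => ?_⟩
    obtain rfl : i = 0 := by omega
    exact h
  have hinter : annulus f φ p 0 u ∩ (exceedSet φ u)ᶜ = ∅ := by
    ext x
    simp only [mem_inter_iff, mem_compl_iff, mem_empty_iff_false, iff_false, not_and, not_not]
    exact fun hx => annulus_subset_exceedSet 0 hx
  rw [hset, hinter, probReal_compl_eq_one_sub (measurableSet_exceedSet hφ u)] at h
  simp only [measureReal_empty, zero_sub, abs_neg] at h
  exact (le_abs_self _).trans h

theorem tendsto_dyadicTime_mul {π : ℕ → ℝ} (hpos : ∀ᶠ n in atTop, 0 < π n)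
    (hzero : Tendsto π atTop (𝓝 0)) (m j : ℕ) :
    Tendsto (fun n => dyadicTime (1 / π n) m j * π n) atTop (𝓝 (j * dyadicMesh m)) := by
  have h1 : Tendsto (fun n => (j : ℝ) * dyadicMesh m + π n) atTop (𝓝 (j * dyadicMesh m)) := by
    simpa using hzero.const_add ((j : ℝ) * dyadicMesh m)
  refine tendsto_of_tendsto_of_tendsto_of_le_of_le' tendsto_const_nhds h1 ?_ ?_
  · filter_upwards [hpos] with n hn
    have h2 := Nat.le_ceil (1 / π n * ((j : ℝ) * dyadicMesh m))
    rw [one_div_mul_eq_div, div_le_iff₀ hn, ← one_div_mul_eq_div] at h2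
    exact h2
  · filter_upwards [hpos] with n hn
    have h2 := (Nat.ceil_lt_add_one (a := 1 / π n * ((j : ℝ) * dyadicMesh m))
      (by positivity)).le
    calc (dyadicTime (1 / π n) m j : ℝ) * π n
        ≤ (1 / π n * ((j : ℝ) * dyadicMesh m) + 1) * π n := by
          gcongr
          exact h2
      _ = _ := by field_simp

/-- The weight which is constant on the rescaled dyadic cells. -/
noncomputable def stepWeight (v : ℝ) (m : ℕ) (ζ : ℕ → ℂ) (i : ℕ) : ℂ :=
  ζ ⌊(i : ℝ) / (v * dyadicMesh m)⌋₊

theorem stepWeight_eq {v : ℝ} (hv : 0 < v) {m j i : ℕ} (ζ : ℕ → ℂ) (h₁ : dyadicTime v m j ≤ i)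
    (h₂ : i < dyadicTime v m (j + 1)) : stepWeight v m ζ i = ζ j := by
  have hm : (0 : ℝ) < dyadicMesh m := dyadicMesh_pos m
  rw [dyadicTime, Nat.ceil_le] at h₁
  rw [dyadicTime, Nat.lt_ceil] at h₂
  push_cast at h₂
  rw [stepWeight]
  congr 1
  rw [Nat.floor_eq_iff (by positivity), le_div_iff₀ (by positivity), div_lt_iff₀ (by positivity)]
  constructor <;> linarith

end Asymptotics

/-! ### Convergence of the generating functions of the counts -/

section Convergence

variable {X : Type*} [TopologicalSpace X] [MeasurableSpace X] {P : Measure X}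
  [IsProbabilityMeasure P] {f : X → X} {φ : X → EReal} {ζ : X} {p : ℕ} {θ τ : ℝ} {u : ℕ → ℝ}
  {t : ℕ → ℕ}

theorem tendsto_integral_rareEventCounts (hf : MeasurePreserving f P P) (hφ : Measurable φ)
    (hmax : ∀ x, φ x ≤ φ ζ) (hp : 0 < p) (hθ0 : 0 < θ) (hθ1 : θ < 1)
    (hR2 : ConditionR2 P f φ ζ p θ) (hτ : 0 < τ)
    (hu : Tendsto (fun n : ℕ => (n : ℝ) * P.real (exceedSet φ (u n))) atTop (𝓝 τ))
    (hD : ConditionDpStar P f φ p u t) (hD' : ConditionDpPrimeStar P f φ p u t)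
    (m : ℕ) {z : Fin (m * 2 ^ m) → ℂ} (hz : ∀ j, ‖z j‖ = 1) :
    Tendsto (fun n => ∫ x, ∏ j, z j ^ rareEventCounts P f φ (u n) m x j ∂P) atTop
      (𝓝 (∏ j, Complex.exp (dyadicMesh m * clusterExponent θ (z j)))) := by
  set π : ℕ → ℝ := fun n => P.real (exceedSet φ (u n)) with hπ
  obtain ⟨γ, hγD, -, hγ, -⟩ := hD
  obtain ⟨k, hk, hkt, hesc⟩ := hD'
  have hpos : ∀ᶠ n in atTop, 0 < π n := by
    filter_upwards [hu.eventually (lt_mem_nhds hτ)] with n hn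
    exact pos_of_mul_pos_right hn n.cast_nonneg
  have hzero : Tendsto π atTop (𝓝 0) := by
    have h := hu.mul (tendsto_inv_atTop_nhds_zero_nat (𝕜 := ℝ))
    rw [mul_zero] at h
    refine h.congr' ?_
    filter_upwards [eventually_ne_atTop 0] with n hn
    have : (n : ℝ) ≠ 0 := Nat.cast_ne_zero.2 hn
    field_simp
    rfl
  -- In (R2) with `i = 0` the ratio of a number with itself tends to `1`, whereas it would be `0 / 0
  -- = 0` at a level of zero probability.
  have hnear : ∀ᶠ v in 𝓝[<] (φ ζ), 0 < P.real (exceedSet φ v) := by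
    have h := (hR2 0).2
    rw [pow_zero] at h
    filter_upwards [h.eventually (lt_mem_nhds one_pos)] with v hv
    refine measureReal_nonneg.lt_of_ne fun h0 => ?_
    rw [← h0, div_zero] at hv
    exact lt_irrefl _ hv
  have hlev : Tendsto (fun n => (u n : EReal)) atTop (𝓝[<] (φ ζ)) :=
    tendsto_nhdsLT_of_tendsto_measureReal hmax hnear hpos hzero
  have hnest : ∀ κ, Tendsto (fun n => P.real (nestedSet f φ p κ (u n)) / π n) atTop
      (𝓝 ((1 - θ) ^ κ)) := fun κ => (hR2 κ).2.comp hlev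
  have hann : ∀ κ, Tendsto (fun n => P.real (annulus f φ p κ (u n)) / π n) atTop
      (𝓝 (θ * (1 - θ) ^ κ)) := fun κ => by
    have h := (hnest κ).sub (hnest (κ + 1))
    rw [show (1 - θ) ^ κ - (1 - θ) ^ (κ + 1) = θ * (1 - θ) ^ κ by ring] at h
    refine h.congr fun n => ?_
    rw [measureReal_annulus hf.measurable hφ, sub_div]
  have hγπ : Tendsto (fun n => γ n (t n) / π n) atTop (𝓝 0) := by
    simpa using tendsto_div_of_tendsto_mul hτ.ne' hγ hu
  -- If `t n = 0`, then `γ n 0` would be at least `P(Q^0) (1 - π n)`, of order `θ π n`,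
  -- contradicting `γ n (t n) = o(π n)`.
  have ht : ∀ᶠ n in atTop, 0 < t n := by
    have h1 := ((hann 0).mul (hzero.const_sub 1)).sub hγπ
    have h2 : 0 < θ * (1 - θ) ^ 0 * (1 - 0) - 0 := by simpa using hθ0
    filter_upwards [h1.eventually (lt_mem_nhds h2), hpos] with n hn hposn
    refine Nat.pos_of_ne_zero fun h0 => ?_
    have h3 := measureReal_annulus_mul_le (u := u n) hφ
      (fun m a b κ ha => hγD n (t n) 0 m a b κ (by simpa [h0] using ha))
    rw [sub_pos, div_mul_eq_mul_div, div_lt_div_iff_of_pos_right hposn] at hn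
    exact absurd h3 (not_le.2 hn)
  have hg : Tendsto (fun n => ((n / k n : ℕ) : ℝ) * π n) atTop (𝓝 0) := by
    have h := (tendsto_natDiv_div hk).mul hu
    rw [zero_mul] at h
    refine h.congr' ?_
    filter_upwards [eventually_ne_atTop 0] with n hn
    have : (n : ℝ) ≠ 0 := Nat.cast_ne_zero.2 hn
    rw [← mul_assoc, div_mul_cancel₀ _ this]
  have hescπ : Tendsto (fun n => escapeSum P f φ p (u n) (n / k n) / π n) atTop (𝓝 0) := by
    simpa [escapeSum] using tendsto_div_of_tendsto_mul hτ.ne' hesc hu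
  set ξ : ℕ → ℂ := fun j => if h : j < m * 2 ^ m then z ⟨j, h⟩ else 1 with hξ
  have hξz : ∀ j : Fin (m * 2 ^ m), ξ j = z j := fun j => by simp [hξ]
  have hξ1 : ∀ j, ‖ξ j‖ ≤ 1 := fun j => by
    by_cases h : j < m * 2 ^ m
    · simp [hξ, h, hz]
    · simp [hξ, h]
  -- The gap is `n / k n`, the horizon of `D'`: negligible against `1 / π n` since `k n → ∞`, yet
  -- larger than `t n` plus any constant.
  have hlim := tendsto_meanWeight (P := P) (p := p) (g := fun n => n / k n)
    (w := fun n => stepWeight (1 / π n) m ξ) (β := fun n => dyadicTime (1 / π n) m)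
    (M := m * 2 ^ m) hf hφ hp hθ0 hθ1 hpos hzero hnest hann
    (fun n κ₁ => hγD n (t n) κ₁) hγπ hg (eventually_add_le_natDiv hk hkt ht) hescπ
    (fun n i => hξ1 _) hξ1
    (fun n => dyadicTime_monotone (one_div_nonneg.2 measureReal_nonneg) m)
    (fun n => dyadicTime_zero _ m)
    (hpos.mono fun n hn j _ i h1 h2 => stepWeight_eq (one_div_pos.2 hn) ξ h1 h2)
    (NNReal.coe_pos.2 (dyadicMesh_pos m)) (tendsto_dyadicTime_mul hpos hzero m)
  rw [Finset.prod_range] at hlim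
  simp only [hξz] at hlim
  refine hlim.congr' ?_
  filter_upwards [hpos] with n hn
  have hv : 0 < 1 / π n := one_div_pos.2 hn
  rw [meanWeight]
  refine integral_congr_ae (Eventually.of_forall fun x => ?_)
  have h := exceedWeight_eq_prod (f := f) (φ := φ) (u := u n) (dyadicTime_monotone hv.le m)
    (m * 2 ^ m) (fun j _ i h1 h2 => stepWeight_eq hv ξ h1 h2) x
  rw [dyadicTime_zero, Finset.prod_range] at h
  simp only [hξz] at h
  refine h.trans (Finset.prod_congr rfl fun j _ => ?_)
  rw [rareEventCounts, if_pos hv]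

end Convergence

end REPP

theorem mainTheorem1 {X : Type*} [TopologicalSpace X] [MeasurableSpace X] [BorelSpace X]
    (P : Measure X) [IsProbabilityMeasure P]
    (f : X → X) (hf : MeasurePreserving f P P)
    (φ : X → EReal) (hφ : Measurable φ)
    (ζ : X) (hmax : ∀ x, φ x ≤ φ ζ)
    (p : ℕ) (hp : 0 < p) (hper : Function.minimalPeriod f ζ = p)
    (θ : ℝ) (hθ0 : 0 < θ) (hθ1 : θ < 1)
    (hR1 : REPP.ConditionR1 P φ ζ) (hR2 : REPP.ConditionR2 P f φ ζ p θ)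
    (u : ℕ → ℝ) (τ : ℝ) (hτ : 0 < τ)
    (hu : Tendsto (fun n : ℕ => (n : ℝ) * P.real {x | (u n : EReal) < φ x}) atTop (𝓝 τ))
    (t : ℕ → ℕ) (hD : REPP.ConditionDpStar P f φ p u t)
    (hD' : REPP.ConditionDpPrimeStar P f φ p u t) :
    ∃ (Ω : Type) (_ : MeasurableSpace Ω) (Q : Measure Ω) (_ : IsProbabilityMeasure Q)
      (N : Ω → REPP.LocFinMeasure),
      REPP.IsCompoundPoissonProcess Q θ (REPP.geometricMultiplicity θ) N ∧
      TendstoInDistribution (fun (n : ℕ) (x : X) => REPP.rareEventPointProcess P f φ (u n) x)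
        atTop N (fun _ => P) Q := by

  obtain ⟨Ω, mΩ, Q, hQ, N, K, hN, hNK, hK⟩ := REPP.exists_compoundPoisson hθ0 hθ1
  refine ⟨Ω, mΩ, Q, hQ, N, hN, ?_⟩
  have hcounts : ∀ n : ℕ, REPP.HasDyadicCounts
      (fun x => REPP.rareEventPointProcess P f φ (u n) x) (REPP.rareEventCounts P f φ (u n)) :=
    fun n => REPP.hasDyadicCounts_rareEventPointProcess hf.measurable hφ
  refine REPP.tendstoInDistribution_of_dyadicCounts hcounts hNK fun m =>
    REPP.tendsto_measure_singleton_of_charFun (fun n => (hcounts n).measurable m)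
      (hNK.measurable m) fun z hz => ?_
  rw [hK m z hz]
  exact REPP.tendsto_integral_rareEventCounts hf hφ hmax hp hθ0 hθ1 hR2 hτ hu hD hD' m hz
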